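/- **Corollary (expansion of dual inhomogeneous $q$-Whittaker polynomials into $q$-Whittaker polynomials).** *Notation.* Write $(a;q)_k=\prod_{i=0}^{k-1}(1-aq^i)$ and $\binom{a}{b}_q=\frac{(q;q)_a}{(q;q)_{a-b}(q;q)_b}$ for $0\le b\le a$, $\binom ab_q=0$ for $b>a$. Here $q$ is an element of a field that is not a root of unity ($q^k\neq1$ for all $k\ge1$; e.g. $q$ an indeterminate), and $x_1,\dots,x_n$ are non-zero elements of that field (e.g. indeterminates). For a partition $\lambda$ let $\ell(\lambda)$ be its number of parts, $\lambda'$ its conjugate, and $m_i(\lambda')=\lambda_i-\lambda_{i+1}$ the number of columns of size $i$ in its diagram. In a rectangular lattice every edge is labelled by a non-negative integer; the partition function with given boundary labels is the sum over all labellings of the product of the vertex weights, where a vertex has bottom, left, top, right labels $a,b,c,d$. *Dual inhomogeneous $q$-Whittaker polynomials.* $\mathbb G_\lambda(x_1,\dots,x_n)$ is the partition function of the lattice with $n$ rows, carrying $x_n,\dots,x_1$ from bottom to top, and $\ell(\lambda)$ columns, with bottom labels $m_{\ell(\lambda)}(\lambda'),\dots,m_1(\lambda')$ from left to right, left and top labels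 $0$, free right labels (summed over), and, in the row carrying $x$, the weights $$\mathbf 1_{a+b=c+d}\;x^d\sum_{p=0}^{\min(b,c)}(ux;q)_{c-p}\,(v/x;q)_p\,(x/v)^{p-b}\binom{c+d-p}{c-p}_q\binom bp_q\qquad\text{at }u=0,\ v=1.$$ *$q$-Whittaker polynomials.* $W_\mu(x_1,\dots,x_n)$ is given by the branching rule: $W_\mu=0$ if $\ell(\mu)>n$, $W_\varnothing()=1$ for $n=0$, and for $\ell(\mu)\le n$ $$W_\mu(x_1,\dots,x_n)=\sum_{\nu}x_n^{|\mu|-|\nu|}\prod_{i=1}^{n-1}\frac{(q;q)_{\mu_i-\mu_{i+1}}}{(q;q)_{\mu_i-\nu_i}(q;q)_{\nu_i-\mu_{i+1}}}\;W_\nu(x_1,\dots,x_{n-1}),$$ the sum over $\nu=(\nu_1,\dots,\nu_{n-1})$ with $\mu_{i+1}\le\nu_i\le\mu_i$. *Statement.* Let $n$ be a positive integer, $\lambda$ a partition, and $N\ge\ell(\lambda)$ an integer (if $\ell(\lambda)\le n$ one may take $N=n$). For a partition $\mu$ let $c_{\lambda,\mu}(q)$ be the partition function of the lattice with $n$ rows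 and $N$ columns, with bottom labels $m_N(\lambda'),\dots,m_1(\lambda')$ from left to right, left and top labels $0$, right labels $m_1(\mu'),\dots,m_n(\mu')$ from bottom to top, and the vertex weights $$\mathbf 1_{a+b=c+d}\,\mathbf 1_{c\le b}\binom bc_q .$$ Then: 1. $\displaystyle\mathbb G_\lambda(x_1,\dots,x_n)=\sum_\mu c_{\lambda,\mu}(q)\,W_\mu(x_1,\dots,x_n)$, where the sum is over all partitions $\mu$ and only finitely many terms are non-zero. 2. $c_{\lambda,\mu}(q)\in\mathbb N[q]$ for every $\mu$, i.e. $c_{\lambda,\mu}(q)$ is the value at $q$ of a polynomial with coefficients in $\mathbb N$ that does not depend on the field or on $q$. Hence $\mathbb G_\lambda$ is $q$-Whittaker positive. 3. $\mathbb G_\lambda$ is Schur-positive: there are polynomials $K_\nu\in\mathbb N[q]$, depending only on $\lambda$, $n$ and $\nu$ and only finitely many of them non-zero, such that $\mathbb G_\lambda(x_1,\dots,x_n)=\sum_\nu K_\nu(q)\,s_\nu(x_1,\dots,x_n)$. -/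

import Mathlib

open Finset

universe u

noncomputable section

namespace LatticeWhittaker

/-! ### `q`-Pochhammer symbols and `q`-binomial coefficients -/

/-- The `q`-Pochhammer symbol `(a;q)_k = (1 - a)(1 - aq) ⋯ (1 - aq^{k-1})`. -/
def qPoch {F : Type u} [Field F] (q a : F) (k : ℕ) : F :=
  ∏ i ∈ range k, (1 - a * q ^ i)

/-- The `q`-binomial coefficient `(q;q)_a / ((q;q)_{a-b} (q;q)_b)`, which is `0` for `b > a`. It is
used only when `q` is not a root of unity (of order `≥ 1`), so that no denominator vanishes. -/
def qBinom {F : Type u} [Field F] (q : F) (a b : ℕ) : F :=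
  if b ≤ a then qPoch q q a / (qPoch q q (a - b) * qPoch q q b) else 0

/-! ### Partitions

A partition is a `YoungDiagram`; `lam.rowLen i` is its part number `i + 1`. -/

/-- The number of parts (rows) of a partition. -/
def numParts (lam : YoungDiagram) : ℕ := lam.colLen 0

/-- `m_i(λ')`: the multiplicity of `i` as a part of the conjugate partition `λ'`, that is, the
number of columns of size `i` in the diagram of `λ` (for `i ≥ 1`). -/
def colMult (lam : YoungDiagram) (i : ℕ) : ℕ := lam.transpose.rowLens.count i

/-! ### Partition functions -/

/-- The partition function of a lattice with `R` rows (numbered from bottom to top) and `C` columns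
(numbered from left to right). A configuration labels the edges by non-negative integers:
`v r j` is the vertical edge of column `j` below row `r` (and `v R j` the one above all rows), and
`h r j` is the horizontal edge of row `r` to the left of column `j` (and `h r C` the one to the
right of all columns). The weight of a configuration is the product over the vertices of
`w r j a b c d` with `a, b, c, d` the labels of the bottom, left, top and right edges of the vertex.
The left, bottom and top boundary labels are fixed, and the labels on the right boundary satisfy
`right`. Labels are bounded by the number of particles that enter the lattice; for weights that
vanish unless `a + b = c + d`, all other configurations have weight zero. -/
def latticeZ {F : Type u} [Field F] (R C : ℕ)
    (w : Fin R → Fin C → ℕ → ℕ → ℕ → ℕ → F)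
    (left : Fin R → ℕ) (bottom top : Fin C → ℕ) (right : (Fin R → ℕ) → Prop) : F :=
  open scoped Classical in
  ∑ h : Fin R → Fin (C + 1) → Fin (∑ r, left r + ∑ j, bottom j + 1),
  ∑ v : Fin (R + 1) → Fin C → Fin (∑ r, left r + ∑ j, bottom j + 1),
    if (∀ r, (h r 0 : ℕ) = left r) ∧ (∀ j, (v 0 j : ℕ) = bottom j) ∧
        (∀ j, (v (Fin.last R) j : ℕ) = top j) ∧ right (fun r => (h r (Fin.last C) : ℕ)) then
      ∏ r : Fin R, ∏ j : Fin C,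
        w r j (v r.castSucc j) (h r j.castSucc) (v r.succ j) (h r j.succ)
    else 0

/-! ### The polynomials `𝔊^{(u,v)}_λ` and `𝔾_λ` -/

/-- The Boltzmann weight `𝕎_{x;(u,v)}(a,b,c,d)`. The factor `(x/v)^{p-b}`, with `p ≤ b`, is written
as `(v/x)^{b-p}`, so that `v = 0` is allowed. -/
def bigWeight {F : Type u} [Field F] (q x u v : F) (a b c d : ℕ) : F :=
  if a + b = c + d then
    x ^ d * ∑ p ∈ range (min b c + 1),
      qPoch q (u * x) (c - p) * qPoch q (v / x) p * (v / x) ^ (b - p) *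
        qBinom q (c + d - p) (c - p) * qBinom q b p
  else 0

/-- `𝔊^{(𝐮,𝐯)}_λ(x_1, …, x_n)`. Site `i` (counted from the right, starting at `1`) carries the
parameters `(u_i, v_i)` and has bottom label `m_i(λ')` and top label `0`; the rows from bottom to top
carry `x_n, …, x_1`; the left labels are `0` and the right labels are free. All sites `i` larger than
the number of parts of `λ` have only zero labels, hence weight `1`, and are left out. -/
def frakG {F : Type u} [Field F] (q : F) (u v : ℕ → F) {n : ℕ} (x : Fin n → F)
    (lam : YoungDiagram) : F :=
  latticeZ n (numParts lam)
    (fun r j => bigWeight q (x r.rev) (u (numParts lam - j)) (v (numParts lam - j)))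
    (fun _ => 0) (fun j => colMult lam (numParts lam - j)) (fun _ => 0) (fun _ => True)

/-- The dual inhomogeneous `q`-Whittaker polynomial `𝔾_λ(x_1, …, x_n)`: the specialisation
`u_i = 0`, `v_i = 1` of `𝔊^{(𝐮,𝐯)}_λ`. -/
def dualInhomWhittaker {F : Type u} [Field F] (q : F) {n : ℕ} (x : Fin n → F)
    (lam : YoungDiagram) : F :=
  frakG q (fun _ => 0) (fun _ => 1) x lam

/-! ### `q`-Whittaker polynomials -/

/-- The `q`-Whittaker polynomial in `n` variables of a partition `(λ_1 ≥ … ≥ λ_n ≥ 0)` with at most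
`n` parts, through its branching rule: the sum over all `μ = (μ_1, …, μ_{n-1})` that interlace with
`λ` of
`x_n^{|λ| - |μ|} ∏_i (q;q)_{λ_i - λ_{i+1}} / ((q;q)_{λ_i - μ_i} (q;q)_{μ_i - λ_{i+1}})
W_μ(x_1, …, x_{n-1})`. -/
def whittakerSeq {F : Type u} [Field F] (q : F) : (n : ℕ) → (Fin n → F) → (Fin n → ℕ) → F
  | 0, _, _ => 1
  | n + 1, x, l =>
    ∑ m ∈ Fintype.piFinset (fun i : Fin n => Icc (l i.succ) (l i.castSucc)),
      x (Fin.last n) ^ (∑ i, l i - ∑ i, m i) *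
        (∏ i : Fin n, qPoch q q (l i.castSucc - l i.succ) /
          (qPoch q q (l i.castSucc - m i) * qPoch q q (m i - l i.succ))) *
        whittakerSeq q n (fun i => x i.castSucc) m

/-- The `q`-Whittaker polynomial `W_λ(x_1, …, x_n)`; it is zero if `λ` has more than `n` parts. -/
def qWhittaker {F : Type u} [Field F] (q : F) {n : ℕ} (x : Fin n → F) (lam : YoungDiagram) : F :=
  if numParts lam ≤ n then whittakerSeq q n x (fun i => lam.rowLen i) else 0

/-! ### The coefficients `c_{λ,μ}(q)` -/

/-- The vertex weight `1_{a+b=c+d} 1_{c≤b} (b choose c)_q`. -/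
def coeffWeight {F : Type u} [Field F] (q : F) (a b c d : ℕ) : F :=
  if a + b = c + d ∧ c ≤ b then qBinom q b c else 0

/-- `c_{λ,μ}(q)`: the partition function of the lattice with `n` rows and `N` columns whose bottom
labels are, from left to right, `m_N(λ'), …, m_1(λ')`, whose right labels are, from bottom to top,
`m_1(μ'), …, m_n(μ')`, and whose left and top labels are `0`. -/
def transCoeff {F : Type u} [Field F] (q : F) (n N : ℕ) (lam mu : YoungDiagram) : F :=
  latticeZ n N (fun _ _ => coeffWeight q)
    (fun _ => 0) (fun j => colMult lam (N - j)) (fun _ => 0)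
    (fun d => ∀ r : Fin n, d r = colMult mu (r + 1))

/-! ### Schur polynomials -/

/-- Semistandard Young tableaux of shape `nu` with entries in `{0, …, n - 1}`. -/
abbrev BoundedSSYT (nu : YoungDiagram) (n : ℕ) : Type :=
  {T : SemistandardYoungTableau nu // ∀ c ∈ nu.cells, T c.1 c.2 < n}

instance (nu : YoungDiagram) (n : ℕ) : Finite (BoundedSSYT nu n) := by
  refine Finite.of_injective
    (fun (T : BoundedSSYT nu n) (c : nu.cells) => (⟨T.1 c.1.1 c.1.2, T.2 c.1 c.2⟩ : Fin n)) ?_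
  intro S T hST
  apply Subtype.ext
  apply SemistandardYoungTableau.ext
  intro i j
  by_cases hij : (i, j) ∈ nu
  · exact congrArg Fin.val (congrFun hST ⟨(i, j), hij⟩)
  · rw [S.1.zeros hij, T.1.zeros hij]

instance (nu : YoungDiagram) (n : ℕ) : Fintype (BoundedSSYT nu n) := Fintype.ofFinite _

/-- The Schur polynomial `s_ν(x_1, …, x_n)`. -/
def schur {F : Type u} [Field F] {n : ℕ} (x : Fin n → F) (nu : YoungDiagram) : F :=
  ∑ T : BoundedSSYT nu n, ∏ c : nu.cells, x ⟨T.1 c.1.1 c.1.2, T.2 c.1 c.2⟩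

end LatticeWhittaker

end

noncomputable section

namespace LatticeWhittaker

/-! ### Gaussian binomial coefficients -/

/-! At `u = 0`, `v = 1` the vertex weight is a polynomial in `x` with coefficients in ℕ[q]
(`bigWeight_eq`). Together with the weight `(b choose c)_q` it satisfies a Yang–Baxter relation
whose cross vertex has weight `x^b (β₂ choose b)_q` (`yangBaxter`). Dragging the cross through all
columns exchanges two adjacent rows (`row_exchange`). When the bottom row of the lattice of `𝔾_λ` is
moved up through `n` coefficient rows, it turns into one more coefficient row, and the crosses
collected at the right edge form exactly one branching step of the `q`-Whittaker polynomials, read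
in the multiplicities of the column sizes (`rowSum_cRows`). Row by row, the lattice of `𝔾_λ` becomes
the lattice of `c_{λ,μ}` with its right labels weighted by `W_μ` (`gRows_eq_cRows`,
`whit_eq_whittakerSeq`). Positivity of the coefficients holds because that lattice can be evaluated
in ℕ[X], with Gaussian binomials defined by Pascal's rule.

Schur positivity then reduces to that of `W_μ`, for which two descriptions of adding a column of
size `m` to a partition with at most `m` parts are compared. Algebraically, the column is added by a
`q`-difference operator, `raise` (`whittakerRaising`). The proof is by induction on the number of
variables. Splitting off one variable from the operator (`raise_insert`) reproduces the branching
rule, provided that operators of neighbouring orders commute up to `q` (`raise_comm`, a consequence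
of the symmetry `crossSum_symm`) and that an interpolation property is preserved. Combinatorially,
lists of subsets of `{0, …, n-1}` are weighted by `q^energy`, where the energy counts the customers
left overnight in a system of cyclic queues. Crystal operators preserve the energy (`energy_lower`),
so the generating function `genZ` is symmetric. After multiplication by the Vandermonde determinant,
reflections cancel every list whose last column is not an initial segment, and a rotation of the
clock turns the energy of the surviving lists into a `q`-shift of variables (`energy_append_range`).
The resulting recursion `genZ_append` is the one given by `raise`, whence `W_μ` is a `genZ`
(`exists_columns`).

The same cancellation, carried out for all columns, leaves only highest-weight lists
(`altern_mul_genZ_eq_sum_highest`), and `W_μ` becomes a sum of `q^energy` times quotients of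
alternants. These quotients are the `q = 0` Whittaker polynomials, because exactly one
highest-weight list has energy zero (`filter_highest_energy`). They are Schur polynomials, because
the branching rule at `q = 0` strips the largest entry from tableaux (`sum_tabs_eq_wRows`).
Arguments with denominators are made at a generic point over ℤ and then specialised. -/

/-- The Gaussian binomial coefficient, defined by its Pascal recursion over any semiring. -/
def gauss {R : Type*} [CommSemiring R] (q : R) : ℕ → ℕ → R
  | _, 0 => 1
  | 0, _ + 1 => 0
  | a + 1, b + 1 => gauss q a b + q ^ (b + 1) * gauss q a (b + 1)

section Semiring
variable {R : Type*} [CommSemiring R] (q : R)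

@[simp] theorem gauss_zero_right (a : ℕ) : gauss q a 0 = 1 := by cases a <;> rfl
@[simp] theorem gauss_zero_succ (b : ℕ) : gauss q 0 (b + 1) = 0 := rfl
theorem gauss_succ_succ (a b : ℕ) :
    gauss q (a + 1) (b + 1) = gauss q a b + q ^ (b + 1) * gauss q a (b + 1) := rfl

theorem gauss_eq_zero {a b : ℕ} (h : a < b) : gauss q a b = 0 := by
  induction a generalizing b with
  | zero => obtain ⟨b, rfl⟩ := Nat.exists_eq_succ_of_ne_zero (by omega : b ≠ 0); rfl
  | succ a ih =>
    obtain ⟨b, rfl⟩ := Nat.exists_eq_succ_of_ne_zero (by omega : b ≠ 0)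
    rw [Nat.succ_eq_add_one, gauss_succ_succ, ih (by omega), ih (by omega)]; simp

@[simp] theorem gauss_self (a : ℕ) : gauss q a a = 1 := by
  induction a with
  | zero => rfl
  | succ a ih => rw [gauss_succ_succ, ih, gauss_eq_zero q (by omega)]; simp

/-- The mirror Pascal rule. Over a semiring it cannot be deduced from the symmetry of the quotient
formula, so it is proved by induction. The truncation in `a - b` is harmless because the coefficient
next to it vanishes for `a < b`. -/
theorem gauss_succ_succ' (a b : ℕ) :
    gauss q (a + 1) (b + 1) = q ^ (a - b) * gauss q a b + gauss q a (b + 1) := by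
  induction a generalizing b with
  | zero => cases b <;> simp [gauss_succ_succ]
  | succ a ih =>
    cases b with
    | zero =>
      have h1 := ih 0
      have h2 := gauss_succ_succ q a 0
      simp only [gauss_zero_right, Nat.sub_zero, mul_one, zero_add, pow_one] at h1 h2
      rw [gauss_succ_succ]
      conv_lhs => rw [h1]
      conv_rhs => rw [h2]
      simp only [gauss_zero_right, Nat.sub_zero]
      ring
    | succ b =>
      rw [gauss_succ_succ]
      conv_lhs => rw [ih b, ih (b + 1)]
      conv_rhs => rw [gauss_succ_succ q a b, gauss_succ_succ q a (b + 1)]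
      rcases Nat.lt_or_ge a (b + 1) with h | h
      · rw [gauss_eq_zero q h, gauss_eq_zero q (by omega : a < b + 1 + 1)]
        rw [show a + 1 - (b + 1) = a - b by omega]; ring
      · obtain ⟨c, rfl⟩ := Nat.exists_eq_add_of_le h
        rw [show b + 1 + c - b = c + 1 by omega, show b + 1 + c - (b + 1) = c by omega,
          show b + 1 + c + 1 - (b + 1) = c + 1 by omega]
        ring

theorem gauss_map {S : Type*} [CommSemiring S] (φ : R →+* S) (a b : ℕ) :
    φ (gauss q a b) = gauss (φ q) a b := by
  induction a generalizing b with
  | zero => cases b <;> simp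
  | succ a ih => cases b <;> simp [gauss_succ_succ, ih]

/-- The `q`-Vandermonde convolution. -/
theorem gauss_add (A B r N : ℕ) (hN : r < N) :
    gauss q (A + B) r =
      ∑ s ∈ range N, if s ≤ r then q ^ (s * (B + s - r)) * gauss q A s * gauss q B (r - s) else 0 := by
  -- `N` is an arbitrary bound above `r`, so the Pascal step may shift the summation index without
  -- adjusting the range.
  induction A generalizing r N with
  | zero =>
    rw [Finset.sum_eq_single_of_mem 0 (by simp; omega)]
    · simp
    · intro s _ hs
      obtain ⟨s, rfl⟩ := Nat.exists_eq_succ_of_ne_zero hs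
      simp
  | succ A ih =>
    cases r with
    | zero =>
      rw [Finset.sum_eq_single_of_mem 0 (by simp; omega)]
      · simp
      · intro s _ hs; rw [if_neg (by omega)]
    | succ r =>
      obtain ⟨N, rfl⟩ := Nat.exists_eq_succ_of_ne_zero (by omega : N ≠ 0)
      rw [show A + 1 + B = (A + B) + 1 by ring, gauss_succ_succ', ih r N (by omega),
        ih (r + 1) (N + 1) hN, Finset.sum_range_succ', Finset.sum_range_succ', Finset.mul_sum,
        ← add_assoc, ← Finset.sum_add_distrib]
      congr 1
      · apply Finset.sum_congr rfl
        intro s _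
        simp only [Nat.add_le_add_iff_right, Nat.add_sub_add_right]
        split_ifs with h
        · rw [gauss_succ_succ' q A s]
          rcases Nat.lt_or_ge A s with h1 | h1
          · rw [gauss_eq_zero q h1, gauss_eq_zero q (by omega : A < s + 1)]; simp
          rcases Nat.lt_or_ge B (r - s) with h2 | h2
          · rw [gauss_eq_zero q h2]; simp
          -- Once both coefficients are known not to vanish trivially, `s ≤ A` and `r - s ≤ B` make
          -- all truncated subtractions genuine.
          have e : A + B - r + s * (B + s - r) = (s + 1) * (B + s - r) + (A - s) := by
            obtain ⟨d, hd⟩ := Nat.exists_eq_add_of_le (show r ≤ B + s by omega)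
            rw [hd, show A + B - r = d + (A - s) by omega]
            simp only [Nat.add_sub_cancel_left]; ring
          rw [show B + (s + 1) - (r + 1) = B + s - r by omega]
          calc _ = q ^ (A + B - r + s * (B + s - r)) * gauss q A s * gauss q B (r - s) +
                q ^ ((s + 1) * (B + s - r)) * gauss q A (s + 1) * gauss q B (r - s) := by ring
            _ = _ := by rw [e]; ring
        · simp
      · simp

/-- Newton's expansion of a power at the nodes `1, q, q², …`. The induction writes `x` as `(x - q^p)
+ q^p` and matches the second part with Pascal's rule. -/
theorem sum_gauss_mul_prod {F : Type*} [CommRing F] (q x : F) (b N : ℕ) (hN : b < N) :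
    ∑ p ∈ range N, (∏ i ∈ range p, (x - q ^ i)) * gauss q b p = x ^ b := by
  induction b generalizing N with
  | zero =>
    rw [Finset.sum_eq_single_of_mem 0 (by simp; omega)]
    · simp
    · intro s _ hs
      obtain ⟨s, rfl⟩ := Nat.exists_eq_succ_of_ne_zero hs
      simp
  | succ b ih =>
    obtain ⟨N, rfl⟩ := Nat.exists_eq_succ_of_ne_zero (by omega : N ≠ 0)
    have h1 := ih N (by omega)
    have h2 := ih (N + 1) (by omega)
    rw [pow_succ', ← h1, Finset.sum_range_succ'] 
    rw [Finset.sum_range_succ'] at h2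
    simp only [range_zero, prod_empty, gauss_zero_right, mul_one] at h2 ⊢
    simp only [gauss_succ_succ, Finset.prod_range_succ, mul_add, Finset.sum_add_distrib]
    -- The top summand vanishes because `b < N`, so a shift of the index absorbs the constant term.
    have h3 : ∑ p ∈ range N, (∏ i ∈ range p, (x - q ^ i)) * (x - q ^ p) * (q ^ (p + 1) * gauss q b (p + 1))
        + 1 = ∑ p ∈ range N, (∏ i ∈ range p, (x - q ^ i)) * (q ^ p * gauss q b p) := by
      have := Finset.sum_range_succ (fun p => (∏ i ∈ range p, (x - q ^ i)) * (q ^ p * gauss q b p)) N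
      rw [gauss_eq_zero q (by omega : b < N)] at this
      simp only [mul_zero, add_zero] at this
      rw [← this, Finset.sum_range_succ']
      simp [Finset.prod_range_succ]
    rw [add_assoc, h3, ← Finset.sum_add_distrib, Finset.mul_sum]
    apply Finset.sum_congr rfl
    intro p _
    ring

end Semiring

/-! ### Gaussian binomials as quotients of `q`-Pochhammer symbols -/

section Field
variable {F : Type u} [Field F] {q : F}

theorem qPoch_succ (a : F) (k : ℕ) : qPoch q a (k + 1) = qPoch q a k * (1 - a * q ^ k) :=
  Finset.prod_range_succ _ _

theorem qPoch_ne_zero (hq : ∀ k : ℕ, 1 ≤ k → q ^ k ≠ 1) (k : ℕ) : qPoch q q k ≠ 0 := by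
  refine Finset.prod_ne_zero_iff.mpr fun i _ h => hq (i + 1) (by omega) ?_
  rw [pow_succ']; exact (sub_eq_zero.mp h).symm

theorem gauss_eq_div (hq : ∀ k : ℕ, 1 ≤ k → q ^ k ≠ 1) (a b : ℕ) :
    gauss q (a + b) b = qPoch q q (a + b) / (qPoch q q a * qPoch q q b) := by
  have h0 := qPoch_ne_zero hq
  obtain ⟨n, hn⟩ : ∃ n, n = a + b := ⟨_, rfl⟩
  induction n generalizing a b with
  | zero =>
    obtain ⟨rfl, rfl⟩ : a = 0 ∧ b = 0 := by omega
    simp [qPoch]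
  | succ n ih =>
    rcases a with _ | a
    · have := h0 b
      simp [show qPoch q q 0 = 1 from rfl, this]
    rcases b with _ | b
    · have := h0 (a + 1)
      simp [show qPoch q q 0 = 1 from rfl, this]
    rw [show a + 1 + (b + 1) = (a + b + 1) + 1 by ring, gauss_succ_succ]
    have h1 := ih (a + 1) b (by omega)
    have h2 := ih a (b + 1) (by omega)
    rw [show a + 1 + b = a + b + 1 by ring] at h1
    rw [show a + (b + 1) = a + b + 1 by ring] at h2
    rw [h1, h2, qPoch_succ _ (a + b + 1), qPoch_succ _ a, qPoch_succ _ b]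
    have ha := h0 (a + 1)
    have hb := h0 (b + 1)
    rw [qPoch_succ] at ha hb
    have ha' := right_ne_zero_of_mul ha
    have hb' := right_ne_zero_of_mul hb
    have := h0 a
    have := h0 b
    field_simp
    ring

theorem qBinom_eq_gauss (hq : ∀ k : ℕ, 1 ≤ k → q ^ k ≠ 1) (a b : ℕ) :
    qBinom q a b = gauss q a b := by
  unfold qBinom
  split_ifs with h
  · obtain ⟨c, rfl⟩ := Nat.exists_eq_add_of_le h
    rw [add_comm b c, gauss_eq_div hq, Nat.add_sub_cancel]
  · exact (gauss_eq_zero q (by omega)).symm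

theorem gauss_symm (hq : ∀ k : ℕ, 1 ≤ k → q ^ k ≠ 1) (a b : ℕ) :
    gauss q (a + b) b = gauss q (a + b) a := by
  rw [gauss_eq_div hq, add_comm a b, gauss_eq_div hq, mul_comm]

theorem gauss_mul_gauss (hq : ∀ k : ℕ, 1 ≤ k → q ^ k ≠ 1) (a b c : ℕ) (hc : c ≤ b) :
    gauss q a b * gauss q b c = gauss q a c * gauss q (a - c) (b - c) := by
  have h0 := qPoch_ne_zero hq
  rcases Nat.lt_or_ge a b with h | h
  · rcases Nat.lt_or_ge a c with h' | h'
    · rw [gauss_eq_zero q h, gauss_eq_zero q h']; simp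
    · rw [gauss_eq_zero q h, gauss_eq_zero q (by omega : a - c < b - c)]; simp
  · obtain ⟨d, rfl⟩ := Nat.exists_eq_add_of_le hc
    obtain ⟨e, rfl⟩ := Nat.exists_eq_add_of_le h
    have h1 := gauss_eq_div hq e (c + d)
    have h2 := gauss_eq_div hq d c
    have h3 := gauss_eq_div hq (d + e) c
    have h4 := gauss_eq_div hq e d
    rw [show e + (c + d) = c + d + e by ring] at h1
    rw [show d + c = c + d by ring] at h2
    rw [show d + e + c = c + d + e by ring] at h3
    rw [show c + d + e - c = e + d by omega, show c + d - c = d by omega, h1, h2, h3, h4,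
      add_comm e d]
    have := h0 e
    have := h0 (c + d)
    have := h0 (d + e)
    have := h0 c
    have := h0 d
    field_simp

end Field

/-! ### The local Yang–Baxter relation -/

section YangBaxter
variable {F : Type u} [Field F] {q : F}

theorem gauss_add_antidiagonal {R : Type*} [CommSemiring R] (q : R) (A B r : ℕ) :
    gauss q (A + B) r =
      ∑ p ∈ antidiagonal r, q ^ (p.1 * (B - p.2)) * gauss q A p.1 * gauss q B p.2 := by
  rw [gauss_add q A B r (r + 1) (by omega), Finset.Nat.sum_antidiagonal_eq_sum_range_succ
    (fun s e => q ^ (s * (B - e)) * gauss q A s * gauss q B e)]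
  refine Finset.sum_congr rfl fun s hs => ?_
  have hs' : s ≤ r := by simpa [Nat.lt_succ_iff] using hs
  rw [if_pos hs', show B + s - r = B - (r - s) by omega]

/-- Both sides are the `q`-multinomial coefficient for disjoint blocks of sizes `p` and `s`, reached
through trinomial revision at `p + s`. -/
theorem gauss_mul_gauss_comm (hq : ∀ k : ℕ, 1 ≤ k → q ^ k ≠ 1) (n p s : ℕ) :
    gauss q n p * gauss q (n - p) s = gauss q n s * gauss q (n - s) p := by
  have h1 := gauss_mul_gauss hq n (p + s) p (by omega)
  have h2 := gauss_mul_gauss hq n (p + s) s (by omega)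
  rw [Nat.add_sub_cancel_left] at h1
  rw [Nat.add_sub_cancel] at h2
  rw [← h1, ← h2, gauss_symm hq]

/-- The substitution `b = f + s` in a `q`-trinomial coefficient. The terms by which the two ranges
differ contain a vanishing coefficient. -/
theorem sum_gauss_mul_gauss (hq : ∀ k : ℕ, 1 ≤ k → q ^ k ≠ 1) (n s : ℕ) (ψ : ℕ → F) :
    ∑ b ∈ range (n + 1), gauss q n b * gauss q b s * ψ b =
      ∑ f ∈ range (n + 1), gauss q n f * gauss q (n - f) s * ψ (f + s) := by
  rcases Nat.lt_or_ge n s with h | h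
  · rw [Finset.sum_eq_zero, Finset.sum_eq_zero]
    · intro f _; rw [gauss_eq_zero q (by omega : n - f < s)]; simp
    · intro b hb
      have := Finset.mem_range.mp hb
      rw [gauss_eq_zero q (by omega : b < s)]; simp
  obtain ⟨m, rfl⟩ := Nat.exists_eq_add_of_le h
  have h1 : ∑ b ∈ range s, gauss q (s + m) b * gauss q b s * ψ b = 0 := by
    refine Finset.sum_eq_zero fun b hb => ?_
    rw [gauss_eq_zero q (Finset.mem_range.mp hb)]; simp
  have h2 : ∑ f ∈ range s, gauss q (s + m) (m + 1 + f) * gauss q (s + m - (m + 1 + f)) s *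
      ψ (m + 1 + f + s) = 0 := by
    refine Finset.sum_eq_zero fun f hf => ?_
    have hf := Finset.mem_range.mp hf
    rw [gauss_eq_zero q (by omega : s + m - (m + 1 + f) < s)]; simp
  conv_lhs => rw [show s + m + 1 = s + (m + 1) by ring, Finset.sum_range_add, h1, zero_add]
  conv_rhs => rw [show s + m + 1 = (m + 1) + s by ring, Finset.sum_range_add, h2, add_zero]
  refine Finset.sum_congr rfl fun f _ => ?_
  rw [gauss_mul_gauss hq _ _ _ (by omega : s ≤ s + f), add_comm f s,
    ← gauss_mul_gauss_comm hq]
  simp only [Nat.add_sub_cancel_left]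

theorem qPoch_inv_mul_pow {x : F} (hx : x ≠ 0) (p : ℕ) :
    qPoch q (1 / x) p * x ^ p = ∏ i ∈ range p, (x - q ^ i) := by
  rw [qPoch, ← Finset.card_range p, ← Finset.prod_const, Finset.card_range, ← Finset.prod_mul_distrib]
  refine Finset.prod_congr rfl fun i _ => ?_
  field_simp

/-- After multiplication by `x^b`, the weight is a sum over `p` of Newton products times `(b - p + a
choose d)_q (b choose p)_q`. Vandermonde splits the first coefficient into parts from `a` and `b -
p`, and the sum over `p` then collapses by `sum_gauss_mul_prod` to the power `x^(b - s)`. This form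
has no signs and no negative powers of `x`. -/
theorem bigWeight_eq (hq : ∀ k : ℕ, 1 ≤ k → q ^ k ≠ 1) {x : F} (hx : x ≠ 0) {a b c d : ℕ}
    (h : a + b = c + d) :
    bigWeight q x 0 1 a b c d =
      ∑ p ∈ antidiagonal d, q ^ (p.1 * (a - p.2)) * gauss q a p.2 * gauss q b p.1 * x ^ p.2 := by
  have h1 : bigWeight q x 0 1 a b c d * x ^ b =
      x ^ d * ∑ p ∈ range (b + 1),
        (∏ i ∈ range p, (x - q ^ i)) * (gauss q (b - p + a) d * gauss q b p) := by
    rw [bigWeight, if_pos h, mul_assoc, Finset.sum_mul]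
    congr 1
    -- For `c < p ≤ b` the coefficient with lower entry `d` vanishes, so the limit `min b c` may be
    -- raised to `b`.
    refine Finset.sum_subset_zero_on_sdiff ?_ ?_ fun p hp => ?_
    rotate_left 2
    · have hp' : p ≤ min b c := by simpa [Nat.lt_succ_iff] using hp
      have hpb : p ≤ b := hp'.trans (min_le_left _ _)
      have hpc : p ≤ c := hp'.trans (min_le_right _ _)
      rw [qBinom_eq_gauss hq, qBinom_eq_gauss hq, show c + d - p = d + (c - p) by omega,
        gauss_symm hq, show b - p + a = d + (c - p) by omega, ← qPoch_inv_mul_pow hx]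
      have : (1 / x) ^ (b - p) * x ^ b = x ^ p := by
        obtain ⟨e, rfl⟩ := Nat.exists_eq_add_of_le hpb
        rw [Nat.add_sub_cancel_left, pow_add, one_div, inv_pow]
        field_simp
      rw [← this]
      have h0 : qPoch q (0 * x) (c - p) = 1 := by simp [qPoch]
      rw [h0]; ring
    · intro p hp
      simp only [Finset.mem_range, Nat.lt_succ_iff] at hp ⊢
      exact hp.trans (min_le_left _ _)
    · intro p hp
      simp only [Finset.mem_sdiff, Finset.mem_range] at hp
      rw [gauss_eq_zero q (by omega : b - p + a < d)]; simp
  have h2 : (∑ p ∈ antidiagonal d,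
      q ^ (p.1 * (a - p.2)) * gauss q a p.2 * gauss q b p.1 * x ^ p.2) * x ^ b =
      x ^ d * ∑ p ∈ range (b + 1),
        (∏ i ∈ range p, (x - q ^ i)) * (gauss q (b - p + a) d * gauss q b p) := by
    simp only [gauss_add_antidiagonal, Finset.sum_mul, Finset.mul_sum]
    rw [Finset.sum_comm]
    refine Finset.sum_congr rfl fun y hy => ?_
    rw [Finset.HasAntidiagonal.mem_antidiagonal] at hy
    obtain ⟨s, e⟩ := y
    dsimp only at hy ⊢
    rcases Nat.lt_or_ge b s with hs | hs
    · rw [gauss_eq_zero q hs, Finset.sum_eq_zero]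
      · simp
      · intro p _; rw [gauss_eq_zero q (by omega : b - p < s)]; simp
    have h3 := sum_gauss_mul_prod q x (b - s) (b + 1) (by omega)
    have : ∀ p ∈ range (b + 1), x ^ d * ((∏ i ∈ range p, (x - q ^ i)) *
        (q ^ (s * (a - e)) * gauss q (b - p) s * gauss q a e * gauss q b p)) =
        x ^ d * (q ^ (s * (a - e)) * gauss q a e * gauss q b s) *
          ((∏ i ∈ range p, (x - q ^ i)) * gauss q (b - s) p) := by
      intro p _
      have := gauss_mul_gauss_comm hq b p s
      linear_combination (x ^ d * (∏ i ∈ range p, (x - q ^ i)) *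
        (q ^ (s * (a - e)) * gauss q a e)) * this
    rw [Finset.sum_congr rfl this, ← Finset.mul_sum, h3, ← hy]
    obtain ⟨f, rfl⟩ := Nat.exists_eq_add_of_le hs
    rw [Nat.add_sub_cancel_left]
    ring
  exact mul_right_cancel₀ (pow_ne_zero b hx) (h1.trans h2.symm)

theorem coeffWeight_eq (hq : ∀ k : ℕ, 1 ≤ k → q ^ k ≠ 1) {a b c d : ℕ} (h : a + b = c + d) :
    coeffWeight q a b c d = gauss q b c := by
  unfold coeffWeight
  split_ifs with h'
  · exact qBinom_eq_gauss hq _ _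
  · exact (gauss_eq_zero q (by omega)).symm

/-- Expanding the remaining coefficient by Vandermonde gives a double sum that is symmetric under
exchange of `(a, e)` with `(b, t)`, up to `gauss_mul_gauss_comm`. -/
theorem yangBaxter_core (hq : ∀ k : ℕ, 1 ≤ k → q ^ k ≠ 1) (a b M t e : ℕ) :
    ∑ p ∈ antidiagonal e,
        gauss q M p.1 * gauss q (b + M - p.1) t * (q ^ (p.1 * (a - p.2)) * gauss q a p.2) =
      ∑ r ∈ antidiagonal t,
        gauss q M r.1 * gauss q (a + M - r.1) e * (q ^ (r.1 * (b - r.2)) * gauss q b r.2) := by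
  have key : ∀ (a b t e : ℕ), ∑ p ∈ antidiagonal e,
        gauss q M p.1 * gauss q (b + M - p.1) t * (q ^ (p.1 * (a - p.2)) * gauss q a p.2) =
      ∑ p ∈ antidiagonal e, ∑ r ∈ antidiagonal t, gauss q M p.1 * gauss q (M - p.1) r.1 *
        (q ^ (r.1 * (b - r.2)) * gauss q b r.2) * (q ^ (p.1 * (a - p.2)) * gauss q a p.2) := by
    intro a b t e
    refine Finset.sum_congr rfl fun p _ => ?_
    rcases Nat.lt_or_ge M p.1 with h | h
    · rw [gauss_eq_zero q h]; simp
    rw [show b + M - p.1 = M - p.1 + b by omega, gauss_add_antidiagonal, Finset.mul_sum,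
      Finset.sum_mul]
    refine Finset.sum_congr rfl fun r _ => ?_
    ring
  rw [key, key, Finset.sum_comm]
  refine Finset.sum_congr rfl fun p _ => Finset.sum_congr rfl fun r _ => ?_
  rw [gauss_mul_gauss_comm hq M p.1 r.1]
  ring

/-- Inserting the positive form of the weight and substituting `b = f + s` isolates the power `x^(f
+ e)`. The inner sum is one side of `yangBaxter_core` with `M = β₂ - f`. -/
theorem yangBaxter_left (hq : ∀ k : ℕ, 1 ≤ k → q ^ k ≠ 1) {x : F} (hx : x ≠ 0)
    (a β₁ β₂ t e : ℕ) :
    ∑ b ∈ range (β₂ + 1), x ^ b * gauss q β₂ b *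
        ((if e ≤ a + b then bigWeight q x 0 1 a b (a + b - e) e else 0) *
          gauss q (β₁ + β₂ - b) t) =
      ∑ f ∈ range (β₂ + 1), x ^ (f + e) * gauss q β₂ f * ∑ p ∈ antidiagonal e,
        gauss q (β₂ - f) p.1 * gauss q (β₁ + (β₂ - f) - p.1) t *
          (q ^ (p.1 * (a - p.2)) * gauss q a p.2) := by
  have h1 : ∀ b, (if e ≤ a + b then bigWeight q x 0 1 a b (a + b - e) e else 0) =
      ∑ p ∈ antidiagonal e, q ^ (p.1 * (a - p.2)) * gauss q a p.2 * gauss q b p.1 * x ^ p.2 := by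
    intro b
    split_ifs with h
    · exact bigWeight_eq hq hx (by omega)
    · rw [Finset.sum_eq_zero]
      intro p hp
      rw [Finset.HasAntidiagonal.mem_antidiagonal] at hp
      rcases Nat.lt_or_ge b p.1 with h' | h'
      · rw [gauss_eq_zero q h']; simp
      · rw [gauss_eq_zero q (by omega : a < p.2)]; simp
  simp only [h1, Finset.sum_mul, Finset.mul_sum]
  rw [Finset.sum_comm, Finset.sum_comm (s := range (β₂ + 1)) (t := antidiagonal e)]
  refine Finset.sum_congr rfl fun p hp => ?_
  rw [Finset.HasAntidiagonal.mem_antidiagonal] at hp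
  have := sum_gauss_mul_gauss hq β₂ p.1 (fun b => x ^ b * (q ^ (p.1 * (a - p.2)) * gauss q a p.2 *
    x ^ p.2) * gauss q (β₁ + β₂ - b) t)
  calc _ = ∑ b ∈ range (β₂ + 1), gauss q β₂ b * gauss q b p.1 *
        (x ^ b * (q ^ (p.1 * (a - p.2)) * gauss q a p.2 * x ^ p.2) * gauss q (β₁ + β₂ - b) t) := by
        refine Finset.sum_congr rfl fun b _ => ?_
        ring
    _ = _ := by
        rw [this]
        refine Finset.sum_congr rfl fun f hf => ?_
        have hf' := Finset.mem_range.mp hf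
        rw [show β₁ + (β₂ - f) - p.1 = β₁ + β₂ - (f + p.1) by omega, ← hp]
        ring

/-- The counterpart of `yangBaxter_left`: here `k` splits as `f + j`, and the inner sum is the other
side of `yangBaxter_core`. -/
theorem yangBaxter_right (hq : ∀ k : ℕ, 1 ≤ k → q ^ k ≠ 1) {x : F} (hx : x ≠ 0)
    (a β₁ β₂ t e : ℕ) :
    ∑ k ∈ range (β₂ + 1), gauss q β₂ k *
        ((if t ≤ k + β₁ then bigWeight q x 0 1 k β₁ t (k + β₁ - t) else 0) *
          (x ^ e * gauss q (a + β₂ - k) e)) =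
      ∑ f ∈ range (β₂ + 1), x ^ (f + e) * gauss q β₂ f * ∑ r ∈ antidiagonal t,
        gauss q (β₂ - f) r.1 * gauss q (a + (β₂ - f) - r.1) e *
          (q ^ (r.1 * (β₁ - r.2)) * gauss q β₁ r.2) := by
  have h1 : ∀ k ∈ range (β₂ + 1),
      (if t ≤ k + β₁ then bigWeight q x 0 1 k β₁ t (k + β₁ - t) else 0) =
      ∑ f ∈ range (β₂ + 1), if f + t ≤ k + β₁ then
        q ^ ((k + β₁ - t - f) * (k - f)) * gauss q k f * gauss q β₁ (k + β₁ - t - f) * x ^ f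
        else 0 := by
    intro k hk
    have hk := Finset.mem_range.mp hk
    split_ifs with h
    · rw [bigWeight_eq hq hx (by omega), ← Finset.Nat.sum_antidiagonal_swap]
      simp only [Prod.fst_swap, Prod.snd_swap]
      rw [Finset.Nat.sum_antidiagonal_eq_sum_range_succ (fun f s =>
        q ^ (s * (k - f)) * gauss q k f * gauss q β₁ s * x ^ f)]
      rw [← Finset.sum_filter]
      refine (Finset.sum_subset_zero_on_sdiff (s₁ := (range (β₂ + 1)).filter (fun f => f + t ≤ k + β₁)) 
        (s₂ := range (k + β₁ - t + 1)) ?_ ?_ (fun _ _ => rfl)).symm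
      · intro f; simp only [Finset.mem_filter, Finset.mem_range]; omega
      · intro f
        simp only [Finset.mem_sdiff, Finset.mem_filter, Finset.mem_range, not_and]
        rintro ⟨h2, h3⟩
        rw [gauss_eq_zero q (by by_contra h4; exact h3 (by omega) (by omega) : k < f)]; simp
    · rw [Finset.sum_eq_zero]
      intro f _; rw [if_neg (by omega)]
  rw [Finset.sum_congr rfl fun k hk => by rw [h1 k hk]]
  simp only [Finset.sum_mul, Finset.mul_sum]
  rw [Finset.sum_comm]
  refine Finset.sum_congr rfl fun f hf => ?_
  have hf := Finset.mem_range.mp hf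
  have := sum_gauss_mul_gauss hq β₂ f (fun k => if f + t ≤ k + β₁ then
    q ^ ((k + β₁ - t - f) * (k - f)) * gauss q β₁ (k + β₁ - t - f) * x ^ f * (x ^ e *
      gauss q (a + β₂ - k) e) else 0)
  calc _ = ∑ k ∈ range (β₂ + 1), gauss q β₂ k * gauss q k f * (if f + t ≤ k + β₁ then
    q ^ ((k + β₁ - t - f) * (k - f)) * gauss q β₁ (k + β₁ - t - f) * x ^ f * (x ^ e *
      gauss q (a + β₂ - k) e) else 0) := by
        refine Finset.sum_congr rfl fun k _ => ?_
        split_ifs <;> ring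
    _ = _ := by
        rw [this, Finset.Nat.sum_antidiagonal_eq_sum_range_succ (fun j h =>
          x ^ (f + e) * gauss q β₂ f * (gauss q (β₂ - f) j * gauss q (a + (β₂ - f) - j) e *
          (q ^ (j * (β₁ - h)) * gauss q β₁ h)))]
        -- This range contains both the support of `(β₂ choose j)_q` and all `j ≤ t`, so the two
        -- index sets can be compared inside it.
        have h2 : ∀ j ∈ range (β₂ + t + 1), (gauss q β₂ j * gauss q (β₂ - j) f *
            if f + t ≤ j + f + β₁ then q ^ ((j + f + β₁ - t - f) * (j + f - f)) *
              gauss q β₁ (j + f + β₁ - t - f) * x ^ f * (x ^ e * gauss q (a + β₂ - (j + f)) e) else 0) =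
            if j ≤ t then x ^ (f + e) * gauss q β₂ f * (gauss q (β₂ - f) j *
              gauss q (a + (β₂ - f) - j) e * (q ^ (j * (β₁ - (t - j))) * gauss q β₁ (t - j)))
            else 0 := by
          intro j _
          rw [gauss_mul_gauss_comm hq]
          by_cases hj : j ≤ t
          · rw [if_pos hj]
            by_cases hj' : t ≤ j + β₁
            · rw [if_pos (by omega)]
              obtain ⟨c, hc⟩ := Nat.exists_eq_add_of_le (show t - j ≤ β₁ by omega)
              rw [show j + f + β₁ - t - f = c by omega, show β₁ - (t - j) = c by omega,
                Nat.add_sub_cancel, show a + β₂ - (j + f) = a + (β₂ - f) - j by omega]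
              have := gauss_symm hq (t - j) c
              rw [← hc] at this
              rw [this]; ring
            · rw [if_neg (by omega), gauss_eq_zero q (by omega : β₁ < t - j)]; simp
          · rw [if_neg hj]
            split_ifs with h3
            · rw [gauss_eq_zero q (by omega : β₁ < j + f + β₁ - t - f)]; simp
            · simp
        have h3 := Finset.sum_subset (s₁ := range (β₂ + 1)) (s₂ := range (β₂ + t + 1))
          (f := fun j => gauss q β₂ j * gauss q (β₂ - j) f *
            if f + t ≤ j + f + β₁ then q ^ ((j + f + β₁ - t - f) * (j + f - f)) *
              gauss q β₁ (j + f + β₁ - t - f) * x ^ f * (x ^ e * gauss q (a + β₂ - (j + f)) e) else 0)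
          (by intro j; simp only [Finset.mem_range]; omega)
          (by
            intro j _ hj
            simp only [Finset.mem_range] at hj
            rw [gauss_eq_zero q (by omega : β₂ < j)]; simp)
        rw [h3, Finset.sum_congr rfl h2, ← Finset.sum_filter]
        refine Finset.sum_congr ?_ fun _ _ => rfl
        ext j; simp only [Finset.mem_filter, Finset.mem_range]; omega

/-- The power of `x` is `f + e` on both sides, so the relation follows coefficient by coefficient
from the core identity. On the left the cross precedes the column and the `𝕎`-vertex is the lower
one; on the right the cross follows the column and the order of the vertices is reversed. The labels
`t` and `e` are the top label and the right label of the `𝕎`-row (left side) or of the cross (right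
side). -/
theorem yangBaxter (hq : ∀ k : ℕ, 1 ≤ k → q ^ k ≠ 1) {x : F} (hx : x ≠ 0)
    (a β₁ β₂ t e : ℕ) :
    ∑ b ∈ range (β₂ + 1), x ^ b * gauss q β₂ b *
        ((if e ≤ a + b then bigWeight q x 0 1 a b (a + b - e) e else 0) *
          gauss q (β₁ + β₂ - b) t) =
    ∑ k ∈ range (β₂ + 1), gauss q β₂ k *
        ((if t ≤ k + β₁ then bigWeight q x 0 1 k β₁ t (k + β₁ - t) else 0) *
          (x ^ e * gauss q (a + β₂ - k) e)) := by
  rw [yangBaxter_left hq hx, yangBaxter_right hq hx]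
  refine Finset.sum_congr rfl fun f _ => ?_
  rw [yangBaxter_core hq]

end YangBaxter

/-! ### Row-to-row operators -/

section Rows
variable {R : Type*} [CommSemiring R]

/-- The sum over all configurations of one row with bottom labels `a` and left label `b`, weighted
by the vertex weights and by a function of the top labels and the right label. -/
def rowSum (w : ℕ → ℕ → ℕ → ℕ → R) :
    (C : ℕ) → (Fin C → ℕ) → ℕ → ((Fin C → ℕ) → ℕ → R) → R
  | 0, _, b, F => F ![] b
  | C + 1, a, b, F => ∑ p ∈ antidiagonal (a 0 + b), w (a 0) b p.1 p.2 *
      rowSum w C (Fin.tail a) p.2 (fun c d => F (Fin.cons p.1 c) d)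

theorem rowSum_sum (w : ℕ → ℕ → ℕ → ℕ → R) {ι : Type*} (s : Finset ι) (C : ℕ) (a : Fin C → ℕ)
    (b : ℕ) (F : ι → (Fin C → ℕ) → ℕ → R) :
    rowSum w C a b (fun c d => ∑ i ∈ s, F i c d) = ∑ i ∈ s, rowSum w C a b (F i) := by
  induction C generalizing b with
  | zero => rfl
  | succ C ih =>
    simp only [rowSum]
    rw [Finset.sum_comm]
    refine Finset.sum_congr rfl fun p _ => ?_
    rw [ih, Finset.mul_sum]

theorem rowSum_mul (w : ℕ → ℕ → ℕ → ℕ → R) (k : R) (C : ℕ) (a : Fin C → ℕ)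
    (b : ℕ) (F : (Fin C → ℕ) → ℕ → R) :
    rowSum w C a b (fun c d => k * F c d) = k * rowSum w C a b F := by
  induction C generalizing b with
  | zero => rfl
  | succ C ih =>
    simp only [rowSum]
    rw [Finset.mul_sum]
    refine Finset.sum_congr rfl fun p _ => ?_
    rw [ih]; ring

/-- The weight `gauss q b c`, to be used when `a + b = c + d`. -/
def cWeight (q : R) (_ b c _ : ℕ) : R := gauss q b c

/-- Antidiagonal sums are put on a fixed range with an indicator, so that nested ones can be
interchanged. -/
theorem sum_antidiagonal_snd {M : Type*} [AddCommMonoid M] {n N : ℕ} (h : n ≤ N) (f : ℕ → ℕ → M) :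
    ∑ p ∈ antidiagonal n, f p.1 p.2 =
      ∑ e ∈ range (N + 1), if e ≤ n then f (n - e) e else 0 := by
  rw [← Finset.Nat.sum_antidiagonal_swap]
  simp only [Prod.fst_swap, Prod.snd_swap]
  rw [Finset.Nat.sum_antidiagonal_eq_sum_range_succ (fun e c => f c e), ← Finset.sum_filter]
  refine Finset.sum_congr ?_ fun _ _ => rfl
  ext j; simp only [Finset.mem_filter, Finset.mem_range]; omega

theorem sum_antidiagonal_fst {M : Type*} [AddCommMonoid M] {n N : ℕ} (h : n ≤ N) (f : ℕ → ℕ → M) :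
    ∑ p ∈ antidiagonal n, f p.1 p.2 =
      ∑ t ∈ range (N + 1), if t ≤ n then f t (n - t) else 0 := by
  rw [Finset.Nat.sum_antidiagonal_eq_sum_range_succ f, ← Finset.sum_filter]
  refine Finset.sum_congr ?_ fun _ _ => rfl
  ext j; simp only [Finset.mem_filter, Finset.mem_range]; omega

end Rows

/-! ### Exchange of a `𝕎`-row with a coefficient row -/

section Exchange
variable {F : Type u} [Field F] {q : F}

/-- The cross is dragged through one column at a time by `yangBaxter`. The left labels `β₁`, `β₂`
must stay general, since after the first column arbitrary labels enter the remaining ones. -/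
theorem row_exchange (hq : ∀ k : ℕ, 1 ≤ k → q ^ k ≠ 1) {x : F} (hx : x ≠ 0) (C : ℕ)
    (a : Fin C → ℕ) (β₁ β₂ : ℕ) (Φ : (Fin C → ℕ) → ℕ → ℕ → F) :
    ∑ b ∈ range (β₂ + 1), x ^ b * gauss q β₂ b *
        rowSum (bigWeight q x 0 1) C a b (fun c r =>
          rowSum (cWeight q) C c (β₁ + β₂ - b) (fun c' m => Φ c' r m)) =
      rowSum (cWeight q) C a β₂ (fun c m =>
        rowSum (bigWeight q x 0 1) C c β₁ (fun c' r₂ =>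
          ∑ r ∈ range (m + 1), x ^ r * gauss q m r * Φ c' r (m + r₂ - r))) := by
  induction C generalizing β₁ β₂ with
  | zero =>
    simp only [rowSum]
    refine Finset.sum_congr rfl fun b _ => ?_
    rw [add_comm β₁]
  | succ C ih =>
    -- `Ψ t e₁ e₂` is the contribution of the columns after the first, when `t` leaves the first
    -- column at the top and `e₁`, `e₂` enter the lower and upper row. Both sides become sums of
    -- local coefficients times the same values of `Ψ`.
    set Ψ : ℕ → ℕ → ℕ → F := fun t e₁ e₂ =>
      rowSum (bigWeight q x 0 1) C (Fin.tail a) e₁ (fun c r =>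
          rowSum (cWeight q) C c e₂ (fun c' m => Φ (Fin.cons t c') r m)) with hΨ
    set S := a 0 + β₁ + β₂ with hS
    have hL : ∑ b ∈ range (β₂ + 1), x ^ b * gauss q β₂ b *
        rowSum (bigWeight q x 0 1) (C + 1) a b (fun c r =>
          rowSum (cWeight q) (C + 1) c (β₁ + β₂ - b) (fun c' m => Φ c' r m)) =
        ∑ e ∈ range (S + 1), ∑ t ∈ range (S + 1), if t + e ≤ S then
          (∑ b ∈ range (β₂ + 1), x ^ b * gauss q β₂ b *
        ((if e ≤ a 0 + b then bigWeight q x 0 1 (a 0) b (a 0 + b - e) e else 0) *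
          gauss q (β₁ + β₂ - b) t)) * Ψ t e (S - t - e) else 0 := by
      have h1 : ∀ b ∈ range (β₂ + 1), x ^ b * gauss q β₂ b *
        rowSum (bigWeight q x 0 1) (C + 1) a b (fun c r =>
          rowSum (cWeight q) (C + 1) c (β₁ + β₂ - b) (fun c' m => Φ c' r m)) =
          ∑ e ∈ range (S + 1), ∑ t ∈ range (S + 1), if t + e ≤ S then
          (x ^ b * gauss q β₂ b *
        ((if e ≤ a 0 + b then bigWeight q x 0 1 (a 0) b (a 0 + b - e) e else 0) *
          gauss q (β₁ + β₂ - b) t)) * Ψ t e (S - t - e) else 0 := by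
        intro b hb
        have hb := Finset.mem_range.mp hb
        rw [rowSum]
        simp only [rowSum.eq_2 (cWeight q), Fin.cons_zero, Fin.tail_cons, rowSum_sum, rowSum_mul]
        rw [sum_antidiagonal_snd (N := S) (by omega) (fun c e => bigWeight q x 0 1 (a 0) b c e *
          ∑ i ∈ antidiagonal (c + (β₁ + β₂ - b)), cWeight q c (β₁ + β₂ - b) i.1 i.2 *
            Ψ i.1 e i.2), Finset.mul_sum]
        refine Finset.sum_congr rfl fun e _ => ?_
        by_cases he : e ≤ a 0 + b
        · rw [if_pos he, if_pos he, sum_antidiagonal_fst (N := S) (by omega)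
            (fun t d => cWeight q (a 0 + b - e) (β₁ + β₂ - b) t d * Ψ t e d),
            Finset.mul_sum, Finset.mul_sum]
          refine Finset.sum_congr rfl fun t _ => ?_
          by_cases ht : t + e ≤ S
          · rw [if_pos ht, if_pos (by omega), cWeight,
              show a 0 + b - e + (β₁ + β₂ - b) - t = S - t - e by omega]; ring
          · rw [if_neg ht, if_neg (by omega)]; ring
        · simp [he]
      rw [Finset.sum_congr rfl h1, Finset.sum_comm]
      refine Finset.sum_congr rfl fun e _ => ?_
      rw [Finset.sum_comm]
      refine Finset.sum_congr rfl fun t _ => ?_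
      split_ifs with h
      · rw [Finset.sum_mul]
      · simp
    have hR : rowSum (cWeight q) (C + 1) a β₂ (fun c m =>
        rowSum (bigWeight q x 0 1) (C + 1) c β₁ (fun c' r₂ =>
          ∑ r ∈ range (m + 1), x ^ r * gauss q m r * Φ c' r (m + r₂ - r))) =
        ∑ e ∈ range (S + 1), ∑ t ∈ range (S + 1), if t + e ≤ S then
          (∑ k ∈ range (β₂ + 1), gauss q β₂ k *
        ((if t ≤ k + β₁ then bigWeight q x 0 1 k β₁ t (k + β₁ - t) else 0) *
          (x ^ e * gauss q (a 0 + β₂ - k) e))) * Ψ t e (S - t - e) else 0 := by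
      -- `Θ` hides the sum over the final cross, which linearity would otherwise pull apart before
      -- the induction hypothesis applies.
      obtain ⟨Θ, hΘ⟩ : ∃ Θ : ℕ → ℕ → (Fin (C + 1) → ℕ) → F, ∀ m r₂ c', Θ m r₂ c' =
        ∑ r ∈ range (m + 1), x ^ r * gauss q m r * Φ c' r (m + r₂ - r) :=
        ⟨_, fun _ _ _ => rfl⟩
      -- The induction hypothesis is read backwards: the cross returns from the right edge to the
      -- place just after the first column.
      have h0 : ∀ t f m, rowSum (cWeight q) C (Fin.tail a) m (fun c m =>
          rowSum (bigWeight q x 0 1) C c f (fun c' r₂ => Θ m r₂ (Fin.cons t c'))) =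
          ∑ b ∈ range (m + 1), x ^ b * gauss q m b * Ψ t b (f + m - b) := by
        intro t f m
        simp only [hΘ]
        exact (ih (Fin.tail a) f m (fun c' => Φ (Fin.cons t c'))).symm
      simp only [← hΘ]
      rw [rowSum]
      simp only [rowSum.eq_2 (bigWeight q x 0 1), Fin.cons_zero, Fin.tail_cons, rowSum_sum,
        rowSum_mul, h0]
      rw [sum_antidiagonal_fst (N := a 0 + β₂) le_rfl (fun k m => cWeight q (a 0) β₂ k m *
        ∑ i ∈ antidiagonal (k + β₁), bigWeight q x 0 1 k β₁ i.1 i.2 *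
          ∑ b ∈ range (m + 1), x ^ b * gauss q m b * Ψ i.1 b (i.2 + m - b))]
      have h1 : ∀ k ∈ range (a 0 + β₂ + 1), (if k ≤ a 0 + β₂ then
          cWeight q (a 0) β₂ k (a 0 + β₂ - k) * ∑ i ∈ antidiagonal (k + β₁),
            bigWeight q x 0 1 k β₁ i.1 i.2 * ∑ b ∈ range (a 0 + β₂ - k + 1),
              x ^ b * gauss q (a 0 + β₂ - k) b * Ψ i.1 b (i.2 + (a 0 + β₂ - k) - b) else 0) =
          ∑ e ∈ range (S + 1), ∑ t ∈ range (S + 1), if t + e ≤ S then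
          (gauss q β₂ k *
        ((if t ≤ k + β₁ then bigWeight q x 0 1 k β₁ t (k + β₁ - t) else 0) *
          (x ^ e * gauss q (a 0 + β₂ - k) e))) * Ψ t e (S - t - e) else 0 := by
        intro k hk
        have hk := Finset.mem_range.mp hk
        rw [if_pos (by omega), sum_antidiagonal_fst (N := S) (by omega) (fun t d =>
          bigWeight q x 0 1 k β₁ t d * ∑ b ∈ range (a 0 + β₂ - k + 1),
              x ^ b * gauss q (a 0 + β₂ - k) b * Ψ t b (d + (a 0 + β₂ - k) - b)),
          Finset.mul_sum, Finset.sum_comm]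
        refine Finset.sum_congr rfl fun t _ => ?_
        by_cases ht : t ≤ k + β₁
        · rw [if_pos ht, if_pos ht, Finset.mul_sum, Finset.mul_sum]
          refine (Finset.sum_subset (s₁ := range (a 0 + β₂ - k + 1)) (s₂ := range (S + 1))
            ?_ ?_).symm.trans ?_ |>.symm
          · intro j; simp only [Finset.mem_range]; omega
          · intro e _ he
            simp only [Finset.mem_range] at he
            rw [gauss_eq_zero q (by omega : a 0 + β₂ - k < e)]; simp
          · refine Finset.sum_congr rfl fun e he => ?_
            have he := Finset.mem_range.mp he
            rw [if_pos (by omega), cWeight, show k + β₁ - t + (a 0 + β₂ - k) - e = S - t - e by omega]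
            ring
        · simp [ht]
      rw [Finset.sum_congr rfl h1]
      rw [← Finset.sum_subset (s₁ := range (β₂ + 1)) (s₂ := range (a 0 + β₂ + 1))
        (by intro j; simp only [Finset.mem_range]; omega)
        (by
          intro k _ hk
          simp only [Finset.mem_range] at hk
          rw [gauss_eq_zero q (by omega : β₂ < k)]; simp), Finset.sum_comm]
      refine Finset.sum_congr rfl fun e _ => ?_
      rw [Finset.sum_comm]
      refine Finset.sum_congr rfl fun t _ => ?_
      split_ifs with h
      · rw [Finset.sum_mul]
      · simp
    rw [hL, hR]
    refine Finset.sum_congr rfl fun e _ => Finset.sum_congr rfl fun t _ => ?_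
    rw [yangBaxter hq hx]

end Exchange

theorem sum_piFinset_succ {n : ℕ} {M : Type*} [AddCommMonoid M] (s : Fin (n + 1) → Finset ℕ)
    (f : (Fin (n + 1) → ℕ) → M) :
    ∑ r ∈ Fintype.piFinset s, f r =
      ∑ a ∈ s 0, ∑ r ∈ Fintype.piFinset (Fin.tail s), f (Fin.cons a r) := by
  rw [← Finset.sum_product']
  refine Finset.sum_bij' (fun r _ => (r 0, Fin.tail r)) (fun p _ => Fin.cons p.1 p.2) ?_ ?_ ?_ ?_ ?_
  · intro r hr
    rw [Fintype.mem_piFinset] at hr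
    simp only [Finset.mem_product, Fintype.mem_piFinset]
    exact ⟨hr 0, fun i => hr i.succ⟩
  · intro p hp
    simp only [Finset.mem_product, Fintype.mem_piFinset] at hp
    rw [Fintype.mem_piFinset]
    exact Fin.cases hp.1 hp.2
  · intro r _; exact Fin.cons_self_tail r
  · intro p _; simp
  · intro r _; rw [Fin.cons_self_tail]

/-! ### Stacks of coefficient rows -/

section CRows
variable {R : Type*} [CommSemiring R]

/-- The partition function of `n` rows with the weights `cWeight`, bottom labels `a`, left and top
labels `0`, weighted by a function of the right labels. -/
def cRows (q : R) {C : ℕ} : (n : ℕ) → (Fin C → ℕ) → ((Fin n → ℕ) → R) → R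
  | 0, a, F => if a = 0 then F ![] else 0
  | n + 1, a, F => rowSum (cWeight q) C a 0 (fun c m => cRows q n c (fun ms => F (Fin.cons m ms)))

theorem cRows_sum (q : R) {ι : Type*} (s : Finset ι) {C : ℕ} (n : ℕ) (a : Fin C → ℕ)
    (F : ι → (Fin n → ℕ) → R) :
    cRows q n a (fun ms => ∑ i ∈ s, F i ms) = ∑ i ∈ s, cRows q n a (F i) := by
  induction n generalizing a with
  | zero => simp only [cRows]; split_ifs <;> simp
  | succ n ih => simp only [cRows, ih, rowSum_sum]

theorem cRows_mul (q k : R) {C : ℕ} (n : ℕ) (a : Fin C → ℕ) (F : (Fin n → ℕ) → R) :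
    cRows q n a (fun ms => k * F ms) = k * cRows q n a F := by
  induction n generalizing a with
  | zero => simp only [cRows]; split_ifs <;> simp
  | succ n ih => simp only [cRows, ih, rowSum_mul]

end CRows

/-! ### From stacks of `𝕎`-rows to the branching rule -/

section GRows
variable {F : Type u} [Field F] {q : F}

/-- Zero top labels send every particle to the right, which leaves one configuration. The parameter
`y` serves both kinds of rows: it is `x` for `𝕎` and `1` for the coefficient weight. -/
theorem rowSum_top_zero (w : ℕ → ℕ → ℕ → ℕ → F) (y : F) (hw : ∀ a b, w a b 0 (a + b) = y ^ a)
    (C : ℕ) (a : Fin C → ℕ) (b : ℕ) (f : ℕ → F) :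
    rowSum w C a b (fun c d => if c = 0 then f d else 0) = y ^ (∑ i, a i) * f (b + ∑ i, a i) := by
  induction C generalizing b with
  | zero => simp [rowSum]
  | succ C ih =>
    rw [rowSum, Finset.sum_eq_single_of_mem (0, a 0 + b)
      (by rw [Finset.HasAntidiagonal.mem_antidiagonal]; simp)]
    · have : (fun (c : Fin C → ℕ) d => if (Fin.cons 0 c : Fin (C + 1) → ℕ) = 0 then f d else 0) =
          fun c d => if c = 0 then f d else 0 := by
        funext c d
        congr 1
        rw [eq_iff_iff]
        constructor
        · intro h; funext i; exact congrFun h i.succ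
        · rintro rfl; funext i; exact Fin.cases rfl (fun _ => rfl) i
      dsimp only
      rw [this, ih, hw, Fin.sum_univ_succ, pow_add]
      simp only [Fin.tail]
      rw [show a 0 + b + ∑ i : Fin C, a i.succ = b + (a 0 + ∑ i : Fin C, a i.succ) by ring]
      ring
    · intro p hp hne
      rw [Finset.HasAntidiagonal.mem_antidiagonal] at hp
      have h1 : p.1 ≠ 0 := fun h => hne (Prod.ext h (by simp; omega))
      have : (fun (c : Fin C → ℕ) d => if (Fin.cons p.1 c : Fin (C + 1) → ℕ) = 0 then f d else 0) =
          fun c d => 0 * 0 := by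
        funext c d
        rw [if_neg fun h => h1 (congrFun h 0)]; simp
      rw [this, rowSum_mul]; simp

theorem bigWeight_top_zero (hq : ∀ k : ℕ, 1 ≤ k → q ^ k ≠ 1) {x : F} (hx : x ≠ 0) (a b : ℕ) :
    bigWeight q x 0 1 a b 0 (a + b) = x ^ a := by
  rw [bigWeight_eq hq hx (by omega), Finset.sum_eq_single_of_mem (b, a)
    (by rw [Finset.HasAntidiagonal.mem_antidiagonal]; simp [add_comm])]
  · simp
  · rintro ⟨s, e⟩ hp hne
    rw [Finset.HasAntidiagonal.mem_antidiagonal] at hp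
    dsimp only at hp ⊢
    rcases Nat.lt_or_ge b s with h | h
    · rw [gauss_eq_zero q h]; simp
    · rw [gauss_eq_zero q (by
        by_contra h'; exact hne (Prod.ext (by simp; omega) (by simp; omega)) : a < e)]; simp

/-- The partition function of `n` rows with parameters `x 0, …, x (n - 1)` from bottom to top,
bottom labels `a`, left and top labels `0` and free right labels. -/
def gRows (q : F) {C : ℕ} : (n : ℕ) → (Fin n → F) → (Fin C → ℕ) → F
  | 0, _, a => if a = 0 then 1 else 0
  | n + 1, x, a => rowSum (bigWeight q (x 0) 0 1) C a 0 (fun c _ => gRows q n (Fin.tail x) c)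

/-- One branching step, in terms of the multiplicities of the columns. -/
def layer (q x : F) : (n : ℕ) → (Fin (n + 1) → ℕ) → (ℕ → (Fin n → ℕ) → F) → F
  | 0, ms, H => x ^ ms 0 * H (ms 0) ![]
  | n + 1, ms, H => layer q x n (Fin.tail ms) (fun r₂ ms'' => ∑ r ∈ range (ms 0 + 1),
      x ^ r * gauss q (ms 0) r * H r (Fin.cons (ms 0 + r₂ - r) ms''))

/-- Each exchange moves the `𝕎`-row above one coefficient row and leaves a factor on the right edge;
these factors are what `layer` records. Above the last coefficient row the top labels are zero, and
there a `𝕎`-row differs from a coefficient row only by a power of `x`. -/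
theorem rowSum_cRows (hq : ∀ k : ℕ, 1 ≤ k → q ^ k ≠ 1) {x : F} (hx : x ≠ 0) {C : ℕ} (n : ℕ)
    (a : Fin C → ℕ) (H : ℕ → (Fin n → ℕ) → F) :
    rowSum (bigWeight q x 0 1) C a 0 (fun c r => cRows q n c (H r)) =
      cRows q (n + 1) a (fun ms => layer q x n ms H) := by
  induction n generalizing a with
  | zero =>
    simp only [cRows]
    rw [rowSum_top_zero _ x (bigWeight_top_zero hq hx) C a 0 (fun r => H r ![]),
      rowSum_top_zero _ 1 (by simp [cWeight]) C a 0 (fun r => layer q x 0 (Fin.cons r ![]) H)]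
    simp [layer]
  | succ n ih =>
    -- With both left labels zero, the cross at the left edge is trivial.
    have h := row_exchange hq hx C a 0 0
      (fun c' r m => cRows q n c' (fun ms'' => H r (Fin.cons m ms'')))
    simp only [zero_add, Finset.sum_range_one, pow_zero, gauss_zero_right, one_mul,
      Nat.sub_zero] at h
    refine h.trans ?_
    rw [cRows]
    congr 1
    funext c m
    simp only [← cRows_mul, ← cRows_sum]
    exact ih c fun r₂ ms'' => ∑ r ∈ range (m + 1), x ^ r * gauss q m r *
      H r (Fin.cons (m + r₂ - r) ms'')

/-- The `q`-Whittaker polynomial in terms of the multiplicities of the columns; the variables are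
added in the order `x (n - 1), …, x 0`. -/
def whit (q : F) : (n : ℕ) → (Fin n → F) → (Fin n → ℕ) → F
  | 0, _, _ => 1
  | n + 1, x, ms => layer q (x 0) n ms (fun _ ms' => whit q n (Fin.tail x) ms')

/-- By induction the rows above the bottom one are already coefficient rows weighted by `whit`.
Passing the bottom row through them adds a layer, which is the recursion defining `whit`. -/
theorem gRows_eq_cRows (hq : ∀ k : ℕ, 1 ≤ k → q ^ k ≠ 1) {C : ℕ} (n : ℕ) (x : Fin n → F)
    (hx : ∀ i, x i ≠ 0) (a : Fin C → ℕ) : gRows q n x a = cRows q n a (whit q n x) := by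
  induction n generalizing a with
  | zero => rfl
  | succ n ih =>
    simp only [gRows, ih (Fin.tail x) (fun i => hx i.succ)]
    exact rowSum_cRows hq (hx 0) n a (fun _ => whit q n (Fin.tail x))

/-- Here `r i` counts the columns of size `i + 1` that lose their lowest box. Columns of full size
lose it without choice, because a variable disappears; this is why `r` is extended by the last
multiplicity. -/
theorem layer_eq (x : F) (n : ℕ) (ms : Fin (n + 1) → ℕ) (H : ℕ → (Fin n → ℕ) → F) :
    layer q x n ms H =
      ∑ r ∈ Fintype.piFinset (fun i : Fin n => range (ms i.castSucc + 1)),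
        (∏ i : Fin n, x ^ r i * gauss q (ms i.castSucc) (r i)) * x ^ ms (Fin.last n) *
        H ((Fin.snoc r (ms (Fin.last n)) : Fin (n + 1) → ℕ) 0) (fun i => ms i.castSucc +
          (Fin.snoc r (ms (Fin.last n)) : Fin (n + 1) → ℕ) i.succ - r i) := by
  induction n with
  | zero =>
    rw [layer, Fintype.piFinset_of_isEmpty, Fintype.sum_unique]
    simp only [Finset.univ_eq_empty, Finset.prod_empty, one_mul, Fin.last_zero]
    congr 2
    exact Subsingleton.elim _ _
  | succ n ih =>
    rw [layer, ih, sum_piFinset_succ, Finset.sum_comm]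
    refine Finset.sum_congr rfl fun r _ => ?_
    rw [Finset.mul_sum]
    refine Finset.sum_congr rfl fun r₀ _ => ?_
    rw [Fin.prod_univ_succ, ← Fin.cons_snoc_eq_snoc_cons]
    simp only [Fin.cons_zero, Fin.cons_succ, Fin.tail, Fin.castSucc_zero, Fin.succ_last,
      Fin.succ_castSucc]
    have : (Fin.cons (ms 0 + (Fin.snoc r (ms (Fin.last (n + 1))) : Fin (n + 1) → ℕ) 0 - r₀)
        (fun i : Fin n => ms i.succ.castSucc +
          (Fin.snoc r (ms (Fin.last (n + 1))) : Fin (n + 1) → ℕ) i.succ - r i) : Fin (n + 1) → ℕ) =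
        fun i => ms i.castSucc + (Fin.snoc r (ms (Fin.last (n + 1))) : Fin (n + 1) → ℕ) i -
          (Fin.cons r₀ r : Fin (n + 1) → ℕ) i := by
      funext i
      refine Fin.cases ?_ (fun i => ?_) i <;> simp
    rw [this]
    ring

/-- In the branching rule, `r i = l i - m i` boxes are removed from row `i`. This substitution
matches the summation ranges, the exponents and the `q`-binomial factors. The reversal of the
variables comes from rows being read from the bottom. -/
theorem whit_eq_whittakerSeq (hq : ∀ k : ℕ, 1 ≤ k → q ^ k ≠ 1) (n : ℕ) (x : Fin n → F)
    (ms l : Fin n → ℕ)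
    (h : ∀ i : Fin n, l i = ms i + if hi : (i : ℕ) + 1 < n then l ⟨i + 1, hi⟩ else 0) :
    whit q n x ms = whittakerSeq q n (fun i => x i.rev) l := by
  induction n with
  | zero => rfl
  | succ n ih =>
    have h1 : ∀ i : Fin n, l i.castSucc = ms i.castSucc + l i.succ := by
      intro i
      rw [h i.castSucc, dif_pos (by simp)]; rfl
    have h2 : l (Fin.last n) = ms (Fin.last n) := by
      rw [h (Fin.last n), dif_neg (by simp)]; rfl
    rw [whit, layer_eq, whittakerSeq]
    refine Finset.sum_bij' (fun r _ i => l i.castSucc - r i) (fun m _ i => l i.castSucc - m i)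
      ?_ ?_ ?_ ?_ ?_
    · intro r hr
      simp only [Fintype.mem_piFinset, Finset.mem_range, Finset.mem_Icc] at hr ⊢
      intro i
      have := hr i
      have := h1 i
      omega
    · intro m hm
      simp only [Fintype.mem_piFinset, Finset.mem_range, Finset.mem_Icc] at hm ⊢
      intro i
      have := hm i
      have := h1 i
      omega
    · intro r hr
      simp only [Fintype.mem_piFinset, Finset.mem_range] at hr
      funext i
      have := hr i
      have := h1 i
      dsimp only
      omega
    · intro m hm
      simp only [Fintype.mem_piFinset, Finset.mem_Icc] at hm
      funext i
      have := hm i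
      dsimp only
      omega
    · intro r hr
      simp only [Fintype.mem_piFinset, Finset.mem_range] at hr
      have e1 : ∑ i, l i - ∑ i : Fin n, (l i.castSucc - r i) = ms (Fin.last n) + ∑ i, r i := by
        have : ∑ i : Fin n, l i.castSucc = ∑ i : Fin n, (l i.castSucc - r i) + ∑ i, r i := by
          rw [← Finset.sum_add_distrib]
          refine Finset.sum_congr rfl fun i _ => ?_
          have := hr i
          have := h1 i
          omega
        rw [Fin.sum_univ_castSucc, this, h2]
        omega
      have e2 : ∀ i : Fin n, qPoch q q (l i.castSucc - l i.succ) /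
          (qPoch q q (l i.castSucc - (l i.castSucc - r i)) *
            qPoch q q (l i.castSucc - r i - l i.succ)) = gauss q (ms i.castSucc) (r i) := by
        intro i
        have h3 := hr i
        have h4 := h1 i
        obtain ⟨d, hd⟩ := Nat.exists_eq_add_of_le (show r i ≤ ms i.castSucc by omega)
        rw [show l i.castSucc - (l i.castSucc - r i) = r i by omega,
          show l i.castSucc - r i - l i.succ = d by omega,
          show l i.castSucc - l i.succ = d + r i by omega, hd, add_comm (r i) d, gauss_eq_div hq,
          mul_comm (qPoch q q d)]
      rw [e1, Finset.prod_congr rfl fun i _ => e2 i, Finset.prod_mul_distrib,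
        Finset.prod_pow_eq_pow_sum, pow_add]
      have e3 := ih (Fin.tail x) (fun i => ms i.castSucc +
          (Fin.snoc r (ms (Fin.last n)) : Fin (n + 1) → ℕ) i.succ - r i)
          (fun i => l i.castSucc - r i) (by
        intro i
        have h3 := hr i
        have h4 := h1 i
        split_ifs with hi
        · have e : i.succ = Fin.castSucc (⟨i + 1, hi⟩ : Fin n) := rfl
          rw [e] at h4 ⊢
          rw [Fin.snoc_castSucc]
          have h5 := hr ⟨i + 1, hi⟩
          have h6 := h1 ⟨i + 1, hi⟩
          omega
        · have e : i.succ = Fin.last n := by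
            ext; simp; omega
          rw [e] at h4 ⊢
          rw [Fin.snoc_last]
          omega)
      rw [e3]
      have e4 : (fun i : Fin n => Fin.tail x i.rev) = fun i : Fin n => x i.castSucc.rev := by
        funext i
        rw [Fin.rev_castSucc]; rfl
      rw [e4]
      simp only [Fin.rev_last]
      ring

end GRows

/-! ### Partition functions as iterated row operators -/

section Lattice

theorem sum_fin_succ_fun {α M : Type*} [Fintype α] [AddCommMonoid M] {n : ℕ}
    (f : (Fin (n + 1) → α) → M) :
    ∑ g, f g = ∑ a : α, ∑ g : Fin n → α, f (Fin.cons a g) := by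
  rw [← Fintype.sum_prod_type']
  exact (Fintype.sum_equiv (Fin.consEquiv fun _ => α) _ _ fun p => rfl).symm

theorem of_ite_ne_zero {M : Type*} [Zero M] {p : Prop} {d : Decidable p} {a : M}
    (h : ite p a 0 ≠ 0) : p ∧ a ≠ 0 := by
  by_cases hp : p
  · exact ⟨hp, by rwa [if_pos hp] at h⟩
  · exact absurd (if_neg hp) h

variable {F : Type u} [Field F]

/-- Particle conservation: only outputs with the right total are ever reached. -/
theorem rowSum_congr (w : ℕ → ℕ → ℕ → ℕ → F) (C : ℕ) (a : Fin C → ℕ) (b : ℕ)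
    (Φ Ψ : (Fin C → ℕ) → ℕ → F)
    (h : ∀ c d, ∑ i, c i + d = ∑ i, a i + b → Φ c d = Ψ c d) :
    rowSum w C a b Φ = rowSum w C a b Ψ := by
  induction C generalizing b with
  | zero => exact h _ _ (by simp)
  | succ C ih =>
    simp only [rowSum]
    refine Finset.sum_congr rfl fun p hp => ?_
    rw [Finset.HasAntidiagonal.mem_antidiagonal] at hp
    rw [ih]
    intro c d hc
    apply h
    rw [Fin.sum_univ_succ, Fin.sum_univ_succ]
    simp only [Fin.cons_zero, Fin.cons_succ]
    simp only [Fin.tail] at hc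
    omega

/-- The bound `M` exceeds the number of particles in the row, so labels in `Fin M` exhaust the
antidiagonals; all other labellings violate conservation and have weight zero. -/
theorem sum_row_eq (w : ℕ → ℕ → ℕ → ℕ → F) (hw : ∀ a b c d, a + b ≠ c + d → w a b c d = 0)
    (M C : ℕ) (a : Fin C → Fin M) (b : Fin M) (hM : ∑ i, (a i : ℕ) + b < M)
    (Φ : (Fin C → ℕ) → ℕ → F) :
    ∑ h : Fin C → Fin M, ∑ c : Fin C → Fin M,
      (∏ j : Fin C, w (a j) ((Fin.cons b h : Fin (C + 1) → Fin M) j.castSucc) (c j) (h j)) *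
        Φ (fun j => c j) ((Fin.cons b h : Fin (C + 1) → Fin M) (Fin.last C)) =
      rowSum w C (fun j => a j) b Φ := by
  induction C generalizing b with
  | zero =>
    rw [rowSum, Fintype.sum_unique, Fintype.sum_unique]
    simp only [Finset.univ_eq_empty, Finset.prod_empty, one_mul]
    congr 1
    exact Subsingleton.elim _ _
  | succ C ih =>
    rw [Fin.sum_univ_succ] at hM
    have h1 : ∀ e c₀ : Fin M, ∑ h : Fin C → Fin M, ∑ c : Fin C → Fin M,
        (∏ j : Fin (C + 1), w (a j) ((Fin.cons b (Fin.cons e h : Fin (C + 1) → Fin M) :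
          Fin (C + 2) → Fin M) j.castSucc) ((Fin.cons c₀ c : Fin (C + 1) → Fin M) j)
          ((Fin.cons e h : Fin (C + 1) → Fin M) j)) *
          Φ (fun j => (Fin.cons c₀ c : Fin (C + 1) → Fin M) j)
            ((Fin.cons b (Fin.cons e h : Fin (C + 1) → Fin M) :
              Fin (C + 2) → Fin M) (Fin.last (C + 1))) =
        if (a 0 : ℕ) + b = c₀ + e then w (a 0) b c₀ e * rowSum w C (Fin.tail fun j => (a j : ℕ)) e
          (fun c d => Φ (Fin.cons (c₀ : ℕ) c) d) else 0 := by
      intro e c₀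
      split_ifs with h
      · rw [show (Fin.tail fun j => (a j : ℕ)) = fun j => ((Fin.tail a) j : ℕ) from rfl,
          ← ih (Fin.tail a) e (by simp only [Fin.tail]; omega), Finset.mul_sum]
        refine Finset.sum_congr rfl fun h _ => ?_
        rw [Finset.mul_sum]
        refine Finset.sum_congr rfl fun c _ => ?_
        rw [Fin.prod_univ_succ]
        simp only [Fin.cons_zero, Fin.cons_succ, Fin.castSucc_zero, ← Fin.succ_castSucc,
          ← Fin.succ_last, Fin.tail]
        have : (fun j => ((Fin.cons c₀ c : Fin (C + 1) → Fin M) j : ℕ)) =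
            Fin.cons (c₀ : ℕ) (fun j => (c j : ℕ)) := by
          funext j; refine Fin.cases rfl (fun _ => rfl) j
        rw [this]; ring
      · refine Finset.sum_eq_zero fun h' _ => Finset.sum_eq_zero fun c _ => ?_
        rw [Fin.prod_univ_succ]
        simp only [Fin.cons_zero, Fin.castSucc_zero]
        rw [hw _ _ _ _ h]; simp
    rw [sum_fin_succ_fun]
    have h2 : ∀ e : Fin M, (∑ h : Fin C → Fin M, ∑ c : Fin (C + 1) → Fin M,
        (∏ j : Fin (C + 1), w (a j) ((Fin.cons b (Fin.cons e h : Fin (C + 1) → Fin M) :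
          Fin (C + 2) → Fin M) j.castSucc) (c j)
          ((Fin.cons e h : Fin (C + 1) → Fin M) j)) *
          Φ (fun j => c j)
            ((Fin.cons b (Fin.cons e h : Fin (C + 1) → Fin M) :
              Fin (C + 2) → Fin M) (Fin.last (C + 1)))) =
        ∑ c₀ : Fin M, if (a 0 : ℕ) + b = c₀ + e then w (a 0) b c₀ e *
          rowSum w C (Fin.tail fun j => (a j : ℕ)) e (fun c d => Φ (Fin.cons (c₀ : ℕ) c) d) else 0 := by
      intro e
      rw [Finset.sum_comm, sum_fin_succ_fun]
      refine Finset.sum_congr rfl fun c₀ _ => ?_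
      rw [Finset.sum_comm]
      exact h1 e c₀
    rw [Finset.sum_congr rfl fun e _ => h2 e, rowSum]
    rw [Finset.sum_comm, ← Fintype.sum_prod_type', ← Finset.sum_filter]
    refine Finset.sum_bij (fun p _ => ((p.1 : ℕ), (p.2 : ℕ))) ?_ ?_ ?_ ?_
    · intro p hp
      rw [Finset.HasAntidiagonal.mem_antidiagonal]
      exact (Finset.mem_filter.mp hp).2.symm
    · intro p _ p' _ h
      simp only [Prod.mk.injEq] at h
      exact Prod.ext (Fin.ext h.1) (Fin.ext h.2)
    · intro p hp
      rw [Finset.HasAntidiagonal.mem_antidiagonal] at hp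
      refine ⟨(⟨p.1, by omega⟩, ⟨p.2, by omega⟩), ?_, rfl⟩
      simp only [Finset.mem_filter, Finset.mem_univ, true_and]
      omega
    · intro p _; rfl

/-- The partition function of `n` rows with row-dependent weights, bottom labels `a`, left and top
labels `0`, weighted by a function of the right labels. -/
def rowsSum {C : ℕ} : (n : ℕ) → (Fin n → ℕ → ℕ → ℕ → ℕ → F) → (Fin C → ℕ) →
    ((Fin n → ℕ) → F) → F
  | 0, _, a, H => if a = 0 then H ![] else 0
  | n + 1, w, a, H => rowSum (w 0) C a 0
      (fun c m => rowsSum n (Fin.tail w) c (fun ms => H (Fin.cons m ms)))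

theorem sum_rows_eq {C : ℕ} (n M : ℕ) [NeZero M] (w : Fin n → ℕ → ℕ → ℕ → ℕ → F)
    (hw : ∀ r a b c d, a + b ≠ c + d → w r a b c d = 0)
    (a : Fin C → Fin M) (hM : ∑ i, (a i : ℕ) < M) (H : (Fin n → ℕ) → F) :
    ∑ h : Fin n → Fin C → Fin M, ∑ v : Fin n → Fin C → Fin M,
      (if ∀ j, (Fin.cons a v : Fin (n + 1) → Fin C → Fin M) (Fin.last n) j = 0 then
        (∏ r : Fin n, ∏ j : Fin C, w r ((Fin.cons a v : Fin (n + 1) → Fin C → Fin M) r.castSucc j)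
          ((Fin.cons 0 (h r) : Fin (C + 1) → Fin M) j.castSucc) (v r j) (h r j)) *
        H (fun r => (Fin.cons 0 (h r) : Fin (C + 1) → Fin M) (Fin.last C)) else 0) =
      rowsSum n w (fun j => a j) H := by
  induction n generalizing a with
  | zero =>
    rw [rowsSum, Fintype.sum_unique, Fintype.sum_unique]
    simp only [Finset.univ_eq_empty, Finset.prod_empty, one_mul]
    have : ∀ d, (∀ j, (Fin.cons a d : Fin 1 → Fin C → Fin M) (Fin.last 0) j = 0) ↔
        (fun j => (a j : ℕ)) = 0 := by
      intro d
      rw [funext_iff]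
      refine forall_congr' fun j => ?_
      rw [show (Fin.cons a d : Fin 1 → Fin C → Fin M) (Fin.last 0) j = a j from rfl,
        Fin.ext_iff]
      simp
    exact if_congr (this _) (congrArg H (Subsingleton.elim _ _)) rfl
  | succ n ih =>
    rw [rowsSum]
    have := sum_row_eq (w 0) (hw 0) M C a 0 (by simpa using hM)
      (fun c m => rowsSum n (Fin.tail w) c (fun ms => H (Fin.cons m ms)))
    rw [Fin.val_zero] at this
    rw [← this, sum_fin_succ_fun]
    refine Finset.sum_congr rfl fun h₀ _ => ?_
    rw [Finset.sum_comm, sum_fin_succ_fun]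
    refine Finset.sum_congr rfl fun v₀ _ => ?_
    rw [Finset.sum_comm]
    -- If the row conserves particles, the labels above it still total less than `M` and the
    -- induction hypothesis applies. If it does not, some vertex of the row has weight zero.
    by_cases hv : ∑ j, (v₀ j : ℕ) + ((Fin.cons 0 h₀ : Fin (C + 1) → Fin M) (Fin.last C) : ℕ) =
        ∑ j, (a j : ℕ)
    · rw [← ih (Fin.tail w) (fun r => hw r.succ) v₀ (by omega), Finset.mul_sum]
      refine Finset.sum_congr rfl fun h _ => ?_
      rw [Finset.mul_sum]
      refine Finset.sum_congr rfl fun v _ => ?_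
      simp only [← Fin.succ_last, Fin.cons_succ, mul_ite, mul_zero]
      congr 1
      rw [Fin.prod_univ_succ]
      simp only [Fin.castSucc_zero, Fin.cons_zero, Fin.cons_succ, ← Fin.succ_castSucc, Fin.tail]
      have e : (fun r : Fin (n + 1) => ((Fin.cons 0 ((Fin.cons h₀ h : Fin (n + 1) → Fin C → Fin M) r) :
          Fin (C + 1) → Fin M) (Fin.last C) : ℕ)) = Fin.cons
          ((Fin.cons 0 h₀ : Fin (C + 1) → Fin M) (Fin.last C) : ℕ)
          (fun r => ((Fin.cons 0 (h r) : Fin (C + 1) → Fin M) (Fin.last C) : ℕ)) := by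
        funext r; refine Fin.cases rfl (fun _ => rfl) r
      rw [e]; ring
    · have h0 : ∏ j : Fin C, w 0 (a j) ((Fin.cons 0 h₀ : Fin (C + 1) → Fin M) j.castSucc) (v₀ j)
          (h₀ j) = 0 := by
        by_contra hne
        have hne := Finset.prod_ne_zero_iff.mp hne
        apply hv
        have h3 : ∀ j : Fin C, (a j : ℕ) + ((Fin.cons 0 h₀ : Fin (C + 1) → Fin M) j.castSucc : ℕ) =
            v₀ j + h₀ j := by
          intro j
          by_contra hj
          exact hne j (Finset.mem_univ _) (hw _ _ _ _ _ hj)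
        have h4 := Finset.sum_congr (rfl : (univ : Finset (Fin C)) = univ) fun j _ => h3 j
        rw [Finset.sum_add_distrib, Finset.sum_add_distrib] at h4
        have h5 := Fin.sum_univ_castSucc (fun j => ((Fin.cons 0 h₀ : Fin (C + 1) → Fin M) j : ℕ))
        rw [Fin.sum_univ_succ] at h5
        simp only [Fin.cons_zero, Fin.cons_succ, Fin.val_zero] at h5
        omega
      rw [h0, zero_mul]
      refine Finset.sum_eq_zero fun h _ => Finset.sum_eq_zero fun v _ => ?_
      rw [Fin.prod_univ_succ]
      simp only [Fin.castSucc_zero, Fin.cons_zero]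
      rw [h0]; simp

/-- Fixing the left and bottom labels makes them redundant: prepending them to the free labels is a
bijection between the non-zero terms of the two sums. -/
theorem latticeZ_eq_rowsSum {n C : ℕ} (w : Fin n → ℕ → ℕ → ℕ → ℕ → F)
    (hw : ∀ r a b c d, a + b ≠ c + d → w r a b c d = 0) (bottom : Fin C → ℕ)
    (right : (Fin n → ℕ) → Prop) [DecidablePred right] :
    latticeZ n C (fun r _ => w r) (fun _ => 0) bottom (fun _ => 0) right =
      rowsSum n w bottom (fun ms => if right ms then 1 else 0) := by
  unfold latticeZ
  generalize hM : (∑ _r : Fin n, 0 + ∑ j, bottom j + 1) = M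
  simp only [Finset.sum_const_zero, zero_add] at hM
  have : NeZero M := ⟨by omega⟩
  have hb : ∀ j, bottom j < M := fun j => by
    have := Finset.single_le_sum (f := bottom) (fun _ _ => Nat.zero_le _) (Finset.mem_univ j)
    omega
  refine Eq.trans ?_ (sum_rows_eq n M w hw (fun j => (⟨bottom j, hb j⟩ : Fin M))
    (by simp only; omega) _)
  have hz : ∀ z : Fin M, (z : ℕ) = 0 ↔ z = 0 := fun z => by rw [Fin.ext_iff]; simp
  symm
  rw [← Finset.sum_product', ← Finset.sum_product']
  refine Finset.sum_bij_ne_zero (fun p _ _ => ((fun r => Fin.cons (α := fun _ => Fin M) 0 (p.1 r)),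
    (Fin.cons (α := fun _ => Fin C → Fin M) (fun j => (⟨bottom j, hb j⟩ : Fin M)) p.2))) ?_ ?_ ?_ ?_
  · intros; simp
  · intro p _ _ p' _ _ h
    simp only [Prod.mk.injEq] at h
    refine Prod.ext (funext fun r => ?_) (Fin.cons_right_injective _ h.2)
    exact Fin.cons_right_injective _ (congrFun h.1 r)
  · intro p _ hp
    obtain ⟨hc, hp'⟩ := of_ite_ne_zero hp
    refine ⟨(fun r => Fin.tail (p.1 r), Fin.tail p.2), by simp, ?_, ?_⟩
    · have e1 : (fun r => Fin.cons (α := fun _ => Fin M) 0 (Fin.tail (p.1 r))) = p.1 := by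
        funext r
        rw [← (hz _).mp (hc.1 r)]; exact Fin.cons_self_tail _
      have e2 : Fin.cons (α := fun _ => Fin C → Fin M) (fun j => (⟨bottom j, hb j⟩ : Fin M)) (Fin.tail p.2) = p.2 := by
        rw [show (fun j => (⟨bottom j, hb j⟩ : Fin M)) = p.2 0 from
          funext fun j => Fin.ext (hc.2.1 j).symm]
        exact Fin.cons_self_tail _
      have e3 := fun r => congrFun e1 r
      dsimp only at e3 ⊢
      simp only [e2, e3]
      rw [if_pos fun j => (hz _).mp (hc.2.2.1 j)]
      rw [if_pos hc.2.2.2, mul_one]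
      simpa [Fin.tail] using hp'
    · refine Prod.ext ?_ ?_
      · funext r
        dsimp only
        rw [← (hz _).mp (hc.1 r)]; exact Fin.cons_self_tail _
      · dsimp only
        rw [show (fun j => (⟨bottom j, hb j⟩ : Fin M)) = p.2 0 from
          funext fun j => Fin.ext (hc.2.1 j).symm]
        exact Fin.cons_self_tail _
  · intro p _ hp
    have hc := (of_ite_ne_zero hp).1
    have hr := (of_ite_ne_zero (right_ne_zero_of_mul (of_ite_ne_zero hp).2)).1
    rw [if_pos hc, if_pos hr, mul_one, if_pos]
    · simp
    · refine ⟨fun r => rfl, fun j => rfl, fun j => (hz _).mpr (hc j), hr⟩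

theorem rowsSum_eq_cRows {q : F} (hq : ∀ k : ℕ, 1 ≤ k → q ^ k ≠ 1) {C : ℕ} (n : ℕ)
    (a : Fin C → ℕ) (H : (Fin n → ℕ) → F) :
    rowsSum n (fun _ => coeffWeight q) a H = cRows q n a H := by
  have h : ∀ (C : ℕ) (a : Fin C → ℕ) (b : ℕ) (Φ : (Fin C → ℕ) → ℕ → F),
      rowSum (coeffWeight q) C a b Φ = rowSum (cWeight q) C a b Φ := by
    intro C
    induction C with
    | zero => intros; rfl
    | succ C ih =>
      intro a b Φ
      simp only [rowSum, ih]
      refine Finset.sum_congr rfl fun p hp => ?_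
      rw [Finset.HasAntidiagonal.mem_antidiagonal] at hp
      rw [coeffWeight_eq hq (by omega), cWeight]
  induction n generalizing a with
  | zero => rfl
  | succ n ih =>
    rw [rowsSum, cRows, h]
    congr 1
    funext c m
    exact ih c _

theorem rowsSum_eq_gRows {q : F} {C : ℕ} (n : ℕ) (x : Fin n → F) (a : Fin C → ℕ) :
    rowsSum n (fun r => bigWeight q (x r) 0 1) a (fun _ => 1) = gRows q n x a := by
  induction n generalizing a with
  | zero => rfl
  | succ n ih =>
    rw [rowsSum, gRows]
    congr 1
    funext c m
    exact ih (Fin.tail x) c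

/-- An empty column at the left edge receives nothing, so it stays empty and passes the label `0`
on. This makes the choice of `N` immaterial. -/
theorem cRows_cons_zero {R : Type*} [CommSemiring R] (q : R) {C : ℕ} (n : ℕ) (a : Fin C → ℕ)
    (H : (Fin n → ℕ) → R) : cRows q n (Fin.cons 0 a : Fin (C + 1) → ℕ) H = cRows q n a H := by
  induction n generalizing a with
  | zero =>
    simp only [cRows]
    congr 1
    rw [eq_iff_iff]
    constructor
    · intro h; funext i; exact congrFun h i.succ
    · rintro rfl; funext i; exact Fin.cases rfl (fun _ => rfl) i
  | succ n ih =>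
    rw [cRows, cRows, rowSum]
    simp [cWeight, ih]

end Lattice

/-! ### Partitions as sequences -/

section Partitions

/-- The largest Young diagram with at most `n` rows whose rows are bounded by `l`. -/
def diagramOf {n : ℕ} (l : Fin n → ℕ) : YoungDiagram where
  cells := (range n ×ˢ range (∑ i, l i)).filter fun c => ∀ i : Fin n, (i : ℕ) ≤ c.1 → c.2 < l i
  isLowerSet := by
    rintro ⟨i, j⟩ ⟨i', j'⟩ h hm
    obtain ⟨h1, h2⟩ := Prod.mk_le_mk.mp h
    simp only [Finset.coe_filter, Finset.mem_product, Finset.mem_range, Set.mem_ofPred_eq] at hm ⊢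
    refine ⟨⟨by omega, by omega⟩, fun k hk => ?_⟩
    have := hm.2 k (by omega)
    omega

theorem mem_diagramOf {n : ℕ} {l : Fin n → ℕ} {i j : ℕ} :
    (i, j) ∈ diagramOf l ↔ i < n ∧ ∀ k : Fin n, (k : ℕ) ≤ i → j < l k := by
  rw [← YoungDiagram.mem_cells]
  simp only [diagramOf, Finset.mem_filter, Finset.mem_product, Finset.mem_range]
  constructor
  · rintro ⟨⟨h1, _⟩, h2⟩; exact ⟨h1, h2⟩
  · rintro ⟨h1, h2⟩
    refine ⟨⟨h1, ?_⟩, h2⟩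
    exact (h2 ⟨i, h1⟩ le_rfl).trans_le
      (Finset.single_le_sum (f := l) (fun _ _ => Nat.zero_le _) (Finset.mem_univ _))

theorem rowLen_diagramOf {n : ℕ} {l : Fin n → ℕ} (hl : Antitone l) (i : Fin n) :
    (diagramOf l).rowLen i = l i := by
  refine eq_of_forall_lt_iff fun j => ?_
  rw [← YoungDiagram.mem_iff_lt_rowLen, mem_diagramOf]
  constructor
  · rintro ⟨_, h⟩; exact h i le_rfl
  · intro h; exact ⟨i.2, fun k hk => h.trans_le (hl hk)⟩

theorem rowLen_eq_zero_iff {mu : YoungDiagram} {i : ℕ} : mu.rowLen i = 0 ↔ numParts mu ≤ i := by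
  rw [numParts, ← not_lt, ← YoungDiagram.mem_iff_lt_colLen, YoungDiagram.mem_iff_lt_rowLen]
  omega

theorem numParts_diagramOf {n : ℕ} (l : Fin n → ℕ) : numParts (diagramOf l) ≤ n := by
  rw [numParts, ← not_lt, ← YoungDiagram.mem_iff_lt_colLen, mem_diagramOf]
  simp

theorem young_ext {mu nu : YoungDiagram} (h : ∀ i, mu.rowLen i = nu.rowLen i) : mu = nu := by
  apply SetLike.ext
  rintro ⟨i, j⟩
  rw [YoungDiagram.mem_iff_lt_rowLen, YoungDiagram.mem_iff_lt_rowLen, h]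

theorem diagramOf_rowLen {n : ℕ} {mu : YoungDiagram} (h : numParts mu ≤ n) :
    diagramOf (fun i : Fin n => mu.rowLen i) = mu := by
  apply young_ext
  intro i
  by_cases hi : i < n
  · exact rowLen_diagramOf (fun a b hab => mu.rowLen_anti _ _ hab) ⟨i, hi⟩
  · have h1 := numParts_diagramOf (fun i : Fin n => mu.rowLen i)
    rw [rowLen_eq_zero_iff.mpr (h1.trans (by omega)), rowLen_eq_zero_iff.mpr (by omega)]

/-- A column `j` has size `i + 1` exactly when it meets row `i` but not row `i + 1`, so these
columns form an interval. -/
theorem colMult_succ (mu : YoungDiagram) (i : ℕ) :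
    colMult mu (i + 1) = mu.rowLen i - mu.rowLen (i + 1) := by
  have h : mu.transpose.rowLens = (List.range (mu.rowLen 0)).map mu.colLen := by
    rw [YoungDiagram.rowLens, YoungDiagram.colLen_transpose]
    exact List.map_congr_left fun j _ => YoungDiagram.rowLen_transpose _ _
  rw [colMult, h, List.count, List.countP_map, List.countP_eq_length_filter,
    ← Nat.card_Ico, ← List.toFinset_card_of_nodup ((List.nodup_range).filter _)]
  congr 1
  ext j
  have h1 := mu.rowLen_anti 0 i (Nat.zero_le _)
  have h2 : i < mu.colLen j ↔ j < mu.rowLen i := by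
    rw [← YoungDiagram.mem_iff_lt_colLen, YoungDiagram.mem_iff_lt_rowLen]
  have h3 : i + 1 < mu.colLen j ↔ j < mu.rowLen (i + 1) := by
    rw [← YoungDiagram.mem_iff_lt_colLen, YoungDiagram.mem_iff_lt_rowLen]
  simp only [List.mem_toFinset, List.mem_filter, List.mem_range, Function.comp, beq_iff_eq,
    Finset.mem_Ico]
  omega

/-- The partition with `ms i` columns of size `i + 1`. -/
def diagramOfMult {n : ℕ} (ms : Fin n → ℕ) : YoungDiagram :=
  diagramOf fun i => ∑ j ∈ Finset.Ici i, ms j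

theorem numParts_diagramOfMult {n : ℕ} (ms : Fin n → ℕ) : numParts (diagramOfMult ms) ≤ n :=
  numParts_diagramOf _

theorem rowLen_diagramOfMult {n : ℕ} (ms : Fin n → ℕ) (i : Fin n) :
    (diagramOfMult ms).rowLen i = ∑ j ∈ Finset.Ici i, ms j := by
  refine rowLen_diagramOf (l := fun i => ∑ j ∈ Finset.Ici i, ms j) (fun a b hab => ?_) i
  exact Finset.sum_le_sum_of_subset (Finset.Ici_subset_Ici.mpr hab)

theorem sum_Ici_eq {n : ℕ} (ms : Fin n → ℕ) (i : Fin n) :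
    ∑ j ∈ Finset.Ici i, ms j =
      ms i + if hi : (i : ℕ) + 1 < n then ∑ j ∈ Finset.Ici (⟨i + 1, hi⟩ : Fin n), ms j else 0 := by
  rw [Finset.Ici_eq_cons_Ioi, Finset.sum_cons]
  congr 1
  split_ifs with hi
  · refine Finset.sum_congr ?_ fun _ _ => rfl
    ext j
    simp only [Finset.mem_Ioi, Finset.mem_Ici, Fin.lt_def, Fin.le_def]
    omega
  · refine Finset.sum_eq_zero fun j hj => ?_
    simp only [Finset.mem_Ioi, Fin.lt_def] at hj
    have := j.2
    omega

theorem colMult_diagramOfMult {n : ℕ} (ms : Fin n → ℕ) (i : Fin n) :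
    colMult (diagramOfMult ms) (i + 1) = ms i := by
  rw [colMult_succ, rowLen_diagramOfMult, sum_Ici_eq]
  split_ifs with hi
  · have := rowLen_diagramOfMult ms ⟨i + 1, hi⟩
    dsimp only at this
    rw [this]; omega
  · rw [rowLen_eq_zero_iff.mpr ((numParts_diagramOfMult ms).trans (by omega : n ≤ i + 1))]
    omega

theorem rowLen_eq_colMult_add (mu : YoungDiagram) (i : ℕ) :
    mu.rowLen i = colMult mu (i + 1) + mu.rowLen (i + 1) := by
  have := mu.rowLen_anti i (i + 1) (Nat.le_succ _)
  rw [colMult_succ]; omega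

theorem diagramOfMult_colMult {n : ℕ} {mu : YoungDiagram} (h : numParts mu ≤ n) :
    diagramOfMult (fun i : Fin n => colMult mu (i + 1)) = mu := by
  conv_rhs => rw [← diagramOf_rowLen h]
  rw [diagramOfMult]
  congr 1
  funext i
  -- A downward induction on the row, since each partial sum is built from the next one.
  obtain ⟨d, hd⟩ : ∃ d, d = n - i := ⟨_, rfl⟩
  induction d generalizing i with
  | zero => have := i.2; omega
  | succ d ih =>
    rw [sum_Ici_eq, rowLen_eq_colMult_add]
    split_ifs with hi
    · rw [ih ⟨i + 1, hi⟩ (by simp only; omega)]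
    · rw [rowLen_eq_zero_iff.mpr (by omega)]

end Partitions

/-! ### The expansion into `q`-Whittaker polynomials -/

section Expansion

/-- The route to positivity: the lattice evaluated in ℕ[X] specialises to the lattice at any `q`. -/
theorem cRows_map {R S : Type*} [CommSemiring R] [CommSemiring S] (φ : R →+* S) (q : R) {C : ℕ}
    (n : ℕ) (a : Fin C → ℕ) (H : (Fin n → ℕ) → R) :
    φ (cRows q n a H) = cRows (φ q) n a (fun ms => φ (H ms)) := by
  have h : ∀ (C : ℕ) (a : Fin C → ℕ) (b : ℕ) (Φ : (Fin C → ℕ) → ℕ → R),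
      φ (rowSum (cWeight q) C a b Φ) = rowSum (cWeight (φ q)) C a b (fun c d => φ (Φ c d)) := by
    intro C
    induction C with
    | zero => intros; rfl
    | succ C ih =>
      intro a b Φ
      simp only [rowSum, map_sum, map_mul, ih, cWeight, gauss_map]
  induction n generalizing a with
  | zero => simp only [cRows]; split_ifs <;> simp
  | succ n ih => simp only [cRows, h, ih]

variable {F : Type u} [Field F] {q : F}

theorem cRows_congr {C : ℕ} (n : ℕ) (a : Fin C → ℕ) (H H' : (Fin n → ℕ) → F)
    (h : ∀ ms, ∑ i, ms i = ∑ i, a i → H ms = H' ms) : cRows q n a H = cRows q n a H' := by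
  induction n generalizing a with
  | zero =>
    simp only [cRows]
    split_ifs with ha
    · exact h _ (by simp [ha])
    · rfl
  | succ n ih =>
    simp only [cRows]
    refine rowSum_congr _ _ _ _ _ _ fun c d hcd => ih c _ _ fun ms hms => h _ ?_
    rw [Fin.sum_univ_succ]
    simp only [Fin.cons_zero, Fin.cons_succ]
    omega

/-- Linearity, with the weight expanded in indicator functions. By conservation no right label
exceeds the total of the bottom labels, so a finite box suffices. -/
theorem cRows_eq_sum {C : ℕ} (n : ℕ) (a : Fin C → ℕ) (H : (Fin n → ℕ) → F) :
    cRows q n a H = ∑ ms ∈ Fintype.piFinset (fun _ : Fin n => range (∑ i, a i + 1)),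
      cRows q n a (fun ms' => if ∀ r, ms' r = ms r then 1 else 0) * H ms := by
  have h : ∀ ms, cRows q n a (fun ms' => if ∀ r, ms' r = ms r then 1 else 0) * H ms =
      cRows q n a (fun ms' => H ms * if ∀ r, ms' r = ms r then 1 else 0) := by
    intro ms; rw [cRows_mul, mul_comm]
  simp only [h]
  rw [← cRows_sum]
  refine cRows_congr n a _ _ fun ms hms => ?_
  rw [Finset.sum_eq_single_of_mem ms]
  · simp
  · simp only [Fintype.mem_piFinset, Finset.mem_range]
    intro i
    have := Finset.single_le_sum (f := ms) (fun _ _ => Nat.zero_le _) (Finset.mem_univ i)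
    omega
  · intro ms' _ hne
    rw [if_neg fun h => hne (funext fun r => (h r).symm)]; simp

theorem transCoeff_eq (hq : ∀ k : ℕ, 1 ≤ k → q ^ k ≠ 1) (n N : ℕ) (lam mu : YoungDiagram) :
    transCoeff q n N lam mu = cRows q n (fun j : Fin N => colMult lam (N - j))
      (fun ms => if ∀ r : Fin n, ms r = colMult mu (r + 1) then 1 else 0) := by
  rw [← rowsSum_eq_cRows hq]
  refine latticeZ_eq_rowsSum (fun _ => coeffWeight q) ?_ _ _
  intro r a b c d h
  rw [coeffWeight, if_neg fun h' => h h'.1]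

/-- The recursion for `cRows` uses only sums, products and Pascal's rule, so the polynomial is the
same partition function computed over ℕ[X]. -/
theorem transCoeff_eq_aeval (n N : ℕ) (lam mu : YoungDiagram)
    (hq : ∀ k : ℕ, 1 ≤ k → q ^ k ≠ 1) :
    transCoeff q n N lam mu = Polynomial.aeval q
      (cRows (Polynomial.X : Polynomial ℕ) n (fun j : Fin N => colMult lam (N - j))
        (fun ms => if ∀ r : Fin n, ms r = colMult mu (r + 1) then 1 else 0)) := by
  rw [transCoeff_eq hq]
  have := cRows_map ((Polynomial.aeval q : Polynomial ℕ →ₐ[ℕ] F) : Polynomial ℕ →+* F)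
    Polynomial.X n (fun j : Fin N => colMult lam (N - j))
    (fun ms => if ∀ r : Fin n, ms r = colMult mu (r + 1) then 1 else 0)
  simp only [RingHom.coe_coe, Polynomial.aeval_X] at this
  rw [this]
  congr 1
  funext ms
  split_ifs <;> simp

theorem cRows_numParts {R : Type*} [CommSemiring R] (q : R) (n : ℕ) (lam : YoungDiagram) {N : ℕ}
    (hN : numParts lam ≤ N) (H : (Fin n → ℕ) → R) :
    cRows q n (fun j : Fin N => colMult lam (N - j)) H =
      cRows q n (fun j : Fin (numParts lam) => colMult lam (numParts lam - j)) H := by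
  induction N, hN using Nat.le_induction with
  | base => rfl
  | succ N hN ih =>
    rw [← ih, ← cRows_cons_zero q n (fun j : Fin N => colMult lam (N - j))]
    congr 1
    funext j
    refine Fin.cases ?_ (fun j => ?_) j
    · simp only [Fin.val_zero, Nat.sub_zero, Fin.cons_zero]
      rw [colMult_succ, rowLen_eq_zero_iff.mpr hN]; simp
    · simp only [Fin.val_succ, Fin.cons_succ, Nat.add_sub_add_right]

theorem dualInhomWhittaker_eq (hq : ∀ k : ℕ, 1 ≤ k → q ^ k ≠ 1) {n : ℕ} (x : Fin n → F)
    (hx : ∀ i, x i ≠ 0) (lam : YoungDiagram) {N : ℕ} (hN : numParts lam ≤ N) :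
    dualInhomWhittaker q x lam = cRows q n (fun j : Fin N => colMult lam (N - j))
      (fun ms => whittakerSeq q n x fun i => ∑ j ∈ Finset.Ici i, ms j) := by
  have h1 : dualInhomWhittaker q x lam =
      rowsSum n (fun r => bigWeight q (x r.rev) 0 1)
        (fun j : Fin (numParts lam) => colMult lam (numParts lam - j))
        (fun _ => if True then 1 else 0) := by
    refine latticeZ_eq_rowsSum (fun r => bigWeight q (x r.rev) 0 1) ?_ _ (fun _ => True)
    intro r a b c d h
    rw [bigWeight, if_neg h]
  simp only [if_true] at h1
  rw [h1, rowsSum_eq_gRows, gRows_eq_cRows hq n _ (fun i => hx i.rev), cRows_numParts q n lam hN]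
  congr 1
  funext ms
  rw [whit_eq_whittakerSeq hq n _ ms _ (sum_Ici_eq ms)]
  simp only [Fin.rev_rev]

theorem qWhittaker_diagramOfMult {n : ℕ} (x : Fin n → F) (ms : Fin n → ℕ) :
    qWhittaker q x (diagramOfMult ms) =
      whittakerSeq q n x fun i => ∑ j ∈ Finset.Ici i, ms j := by
  rw [qWhittaker, if_pos (numParts_diagramOfMult _)]
  congr 1
  funext i
  exact rowLen_diagramOfMult ms i

/-- The partitions that may occur in the expansion of `𝔾_λ` into `q`-Whittaker polynomials. -/
def expansionSupport (n N : ℕ) (lam : YoungDiagram) : Finset YoungDiagram :=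
  open scoped Classical in
  (Fintype.piFinset fun _ : Fin n => range (∑ j : Fin N, colMult lam (N - j) + 1)).image
    diagramOfMult

theorem diagramOfMult_injective (n : ℕ) :
    Function.Injective (diagramOfMult : (Fin n → ℕ) → YoungDiagram) := by
  intro ms ms' h
  funext i
  rw [← colMult_diagramOfMult ms i, h, colMult_diagramOfMult]

theorem dualInhomWhittaker_eq_sum (hq : ∀ k : ℕ, 1 ≤ k → q ^ k ≠ 1) {n : ℕ} (x : Fin n → F)
    (hx : ∀ i, x i ≠ 0) (lam : YoungDiagram) {N : ℕ} (hN : numParts lam ≤ N) :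
    dualInhomWhittaker q x lam = ∑ mu ∈ expansionSupport n N lam,
      transCoeff q n N lam mu * qWhittaker q x mu := by
  classical
  rw [expansionSupport, Finset.sum_image fun _ _ _ _ h => diagramOfMult_injective n h,
    dualInhomWhittaker_eq hq x hx lam hN, cRows_eq_sum]
  refine Finset.sum_congr rfl fun ms _ => ?_
  rw [transCoeff_eq hq, qWhittaker_diagramOfMult]
  simp only [colMult_diagramOfMult]

/-- A partition with more than `n` parts kills `W_μ`, and a multiplicity larger than the number of
particles kills the lattice. -/
theorem support_subset_expansionSupport (hq : ∀ k : ℕ, 1 ≤ k → q ^ k ≠ 1) {n : ℕ} (x : Fin n → F)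
    (lam : YoungDiagram) (N : ℕ) :
    (Function.support fun mu : YoungDiagram => transCoeff q n N lam mu * qWhittaker q x mu) ⊆
      expansionSupport n N lam := by
  classical
  intro mu hmu
  rw [Function.mem_support] at hmu
  have h1 : numParts mu ≤ n := by
    by_contra h
    exact right_ne_zero_of_mul hmu (if_neg h)
  have h2 := left_ne_zero_of_mul hmu
  rw [expansionSupport, Finset.mem_coe, Finset.mem_image]
  refine ⟨fun i => colMult mu (i + 1), ?_, diagramOfMult_colMult h1⟩
  by_contra h3
  apply h2
  rw [transCoeff_eq hq, cRows_congr n _ _ (fun _ => 0 * 0), cRows_mul, zero_mul]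
  intro ms hms
  rw [if_neg, zero_mul]
  intro h4
  apply h3
  rw [Fintype.mem_piFinset]
  intro i
  have := Finset.single_le_sum (f := ms) (fun _ _ => Nat.zero_le _) (Finset.mem_univ i)
  rw [Finset.mem_range, ← h4]
  omega

end Expansion

/-! ### A symmetric rational function identity -/

section CrossSum
variable {K : Type*} [Field K]

/-- Partial fractions of a product in which each factor has two simple poles, indexed by `Bool`, and
different factors share no pole. The induction multiplies by one factor and uses the two-pole
identity for `1 / ((t - u) (t - v))`. -/
theorem prod_partial_fractions {ι : Type*} [DecidableEq ι] (A u : ι → Bool → K) (S : Finset ι)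
    (hS : S.Nonempty) (t : K) (ht : ∀ b ∈ S, ∀ k, t ≠ u b k)
    (hu : ∀ b ∈ S, ∀ c ∈ S, b ≠ c → ∀ k k', u b k ≠ u c k') :
    ∏ b ∈ S, ∑ k, A b k / (t - u b k) =
      ∑ c ∈ S, ∑ k, A c k / (t - u c k) * ∏ b ∈ S.erase c, ∑ k', A b k' / (u c k - u b k') := by
  induction hS using Finset.Nonempty.cons_induction generalizing t with
  | singleton a => simp
  | cons a S ha hS ih =>
    have hu' : ∀ b ∈ S, ∀ c ∈ S, b ≠ c → ∀ k k', u b k ≠ u c k' := fun b hb c hc =>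
      hu b (Finset.mem_cons_of_mem hb) c (Finset.mem_cons_of_mem hc)
    have hab : ∀ c ∈ S, a ≠ c := fun c hc h => ha (h ▸ hc)
    have key : ∀ c ∈ S, ∀ k, (∑ k', A a k' / (t - u a k')) * (A c k / (t - u c k)) =
        A c k / (t - u c k) * (∑ k', A a k' / (u c k - u a k')) +
          ∑ k', A a k' / (t - u a k') * (A c k / (u a k' - u c k)) := by
      intro c hc k
      rw [Finset.sum_mul, Finset.mul_sum, ← Finset.sum_add_distrib]
      refine Finset.sum_congr rfl fun k' _ => ?_
      have h1 := sub_ne_zero.mpr (ht a (Finset.mem_cons_self _ _) k')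
      have h2 := sub_ne_zero.mpr (ht c (Finset.mem_cons_of_mem hc) k)
      have h3 := sub_ne_zero.mpr
        (hu c (Finset.mem_cons_of_mem hc) a (Finset.mem_cons_self _ _) (hab c hc).symm k k')
      have h4 := sub_ne_zero.mpr
        (hu a (Finset.mem_cons_self _ _) c (Finset.mem_cons_of_mem hc) (hab c hc) k' k)
      field_simp
      ring
    rw [Finset.prod_cons, ih t (fun b hb => ht b (Finset.mem_cons_of_mem hb)) hu', Finset.sum_cons,
      Finset.erase_cons, Finset.mul_sum]
    simp only [Finset.mul_sum, ← mul_assoc]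
    rw [Finset.sum_congr rfl fun c hc => Finset.sum_congr rfl fun k _ => by rw [key c hc k, add_mul]]
    simp only [Finset.sum_add_distrib]
    rw [add_comm]
    congr 1
    · simp only [Finset.sum_mul]
      have : ∀ k', ∏ b ∈ S, ∑ k, A b k / (u a k' - u b k) =
          ∑ c ∈ S, ∑ k, A c k / (u a k' - u c k) *
            ∏ b ∈ S.erase c, ∑ k'', A b k'' / (u c k - u b k'') := fun k' =>
        ih (u a k') (fun b hb k => hu a (Finset.mem_cons_self _ _) b (Finset.mem_cons_of_mem hb)
          (hab b hb) k' k) hu'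
      simp only [this, Finset.mul_sum]
      rw [Finset.sum_comm]
      rw [Finset.sum_congr rfl fun k _ => Finset.sum_comm, Finset.sum_comm]
      refine Finset.sum_congr rfl fun k' _ => ?_
      rw [Finset.sum_comm]
      refine Finset.sum_congr rfl fun c _ => Finset.sum_congr rfl fun k _ => ?_
      ring
    · refine Finset.sum_congr rfl fun c hc => Finset.sum_congr rfl fun k _ => ?_
      have : (Finset.cons a S ha).erase c = Finset.cons a (S.erase c) (by simp [ha]) := by
        ext j
        simp only [Finset.mem_erase, Finset.mem_cons]
        constructor
        · tauto
        · rintro (rfl | h)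
          · exact ⟨hab c hc, Or.inl rfl⟩
          · exact ⟨h.1, Or.inr h.2⟩
      rw [this, Finset.prod_cons]; ring

theorem sum_powersetCard_succ_mem {ι M : Type*} [DecidableEq ι] [AddCommMonoid M] (r : ℕ)
    (B : Finset ι) (g : Finset ι → ι → M) :
    ∑ P ∈ powersetCard (r + 1) B, ∑ c ∈ P, g P c =
      ∑ c ∈ B, ∑ P ∈ powersetCard r (B.erase c), g (insert c P) c := by
  rw [Finset.sum_sigma', Finset.sum_sigma']
  refine Finset.sum_bij' (fun y _ => ⟨y.2, y.1.erase y.2⟩) (fun y _ => ⟨insert y.1 y.2, y.1⟩)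
    ?_ ?_ ?_ ?_ ?_
  · rintro ⟨P, c⟩ h
    simp only [Finset.mem_sigma, Finset.mem_powersetCard] at h ⊢
    exact ⟨h.1.1 h.2, Finset.erase_subset_erase _ h.1.1, by
      rw [Finset.card_erase_of_mem h.2, h.1.2]; rfl⟩
  · rintro ⟨c, P⟩ h
    simp only [Finset.mem_sigma, Finset.mem_powersetCard] at h ⊢
    have hc : c ∉ P := fun hc => by simpa using h.2.1 hc
    refine ⟨⟨?_, by rw [Finset.card_insert_of_notMem hc, h.2.2]⟩, Finset.mem_insert_self _ _⟩
    exact Finset.insert_subset h.1 (h.2.1.trans (Finset.erase_subset _ _))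
  · rintro ⟨P, c⟩ h
    simp only [Finset.mem_sigma] at h
    simp [Finset.insert_erase h.2]
  · rintro ⟨c, P⟩ h
    simp only [Finset.mem_sigma, Finset.mem_powersetCard] at h
    have hc : c ∉ P := fun hc => by simpa using h.2.1 hc
    simp [Finset.erase_insert hc]
  · rintro ⟨P, c⟩ h
    simp only [Finset.mem_sigma] at h
    simp [Finset.insert_erase h.2]

theorem sum_powersetCard_notMem {ι M : Type*} [DecidableEq ι] [AddCommMonoid M] (r : ℕ)
    (B : Finset ι) (g : Finset ι → ι → M) :
    ∑ P ∈ powersetCard r B, ∑ c ∈ B \ P, g P c =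
      ∑ c ∈ B, ∑ P ∈ powersetCard r (B.erase c), g P c := by
  refine Finset.sum_comm' fun P c => ?_
  simp only [Finset.mem_powersetCard, Finset.mem_sdiff, Finset.subset_erase]
  tauto

/-- The sum over `r`-element subsets `P` of `B` of the products of `w p b` over `p ∈ P` and
`b ∈ B \ P`. -/
def crossSum {ι : Type*} [DecidableEq ι] (w : ι → ι → K) (B : Finset ι) (r : ℕ) : K :=
  ∑ P ∈ powersetCard r B, ∏ p ∈ P, ∏ b ∈ B \ P, w p b

theorem crossSum_insert {ι : Type*} [DecidableEq ι] (w : ι → ι → K) {B : Finset ι} {e : ι}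
    (he : e ∉ B) (r : ℕ) :
    crossSum w (insert e B) (r + 1) =
      ∑ P ∈ powersetCard (r + 1) B, (∏ p ∈ P, ∏ b ∈ B \ P, w p b) * ∏ p ∈ P, w p e +
      ∑ P ∈ powersetCard r B, (∏ p ∈ P, ∏ b ∈ B \ P, w p b) * ∏ b ∈ B \ P, w e b := by
  rw [crossSum, Finset.powersetCard_succ_insert he, Finset.sum_union, Finset.sum_image]
  · congr 1
    · refine Finset.sum_congr rfl fun P hP => ?_
      have hP := (Finset.mem_powersetCard.mp hP).1
      rw [Finset.insert_sdiff_of_notMem _ (fun h => he (hP h)), ← Finset.prod_mul_distrib]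
      refine Finset.prod_congr rfl fun p _ => ?_
      rw [Finset.prod_insert (by simp [he]), mul_comm]
    · refine Finset.sum_congr rfl fun P hP => ?_
      have hP := (Finset.mem_powersetCard.mp hP).1
      have he' : e ∉ P := fun h => he (hP h)
      have : insert e B \ insert e P = B \ P := by
        ext j; simp only [Finset.mem_sdiff, Finset.mem_insert]
        constructor
        · tauto
        · rintro ⟨h1, h2⟩
          exact ⟨Or.inr h1, by rintro (rfl | h); exacts [he h1, h2 h]⟩
      rw [this, Finset.prod_insert he', mul_comm]
  · intro P hP Q hQ h
    have hP := (Finset.mem_powersetCard.mp hP).1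
    have hQ := (Finset.mem_powersetCard.mp hQ).1
    rw [← Finset.erase_insert (fun h => he (hP h) : e ∉ P), h,
      Finset.erase_insert (fun h => he (hQ h) : e ∉ Q)]
  · rw [Finset.disjoint_left]
    intro P hP hP'
    obtain ⟨Q, _, rfl⟩ := Finset.mem_image.mp hP'
    exact he ((Finset.mem_powersetCard.mp hP).1 (Finset.mem_insert_self _ _))

/-- The weight `quv / ((v - u) (qu - v))`. -/
def exWeight (q u v : K) : K := q * u * v / ((v - u) * (q * u - v))

/-- Conditions under which the rational functions of `q` and `x` below have no poles. -/
structure Generic (q : K) (x : ℕ → K) : Prop where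
  q_ne_zero : q ≠ 0
  q_pow : ∀ k : ℕ, 1 ≤ k → q ^ k ≠ 1
  ne_zero : ∀ i, x i ≠ 0
  sep : ∀ i j, i ≠ j → ∀ k l : ℕ, q ^ k * x i ≠ q ^ l * x j

theorem Generic.ne {q : K} {x : ℕ → K} (h : Generic q x) {i j : ℕ} (hij : i ≠ j) : x i ≠ x j := by
  simpa using h.sep i j hij 0 0

theorem Generic.ne' {q : K} {x : ℕ → K} (h : Generic q x) {i j : ℕ} (hij : i ≠ j) :
    q * x i ≠ x j := by
  simpa using h.sep i j hij 1 0

theorem Generic.q_ne_one {q : K} {x : ℕ → K} (h : Generic q x) : q ≠ 1 := by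
  simpa using h.q_pow 1 le_rfl

variable {q : K} {x : ℕ → K}

/-- As a function of its second argument, the weight has simple poles at `x p` and `q * x p`. At the
pole `q * x c` of one factor, the others become weights with their arguments exchanged, which
accounts for the two kinds of products. -/
theorem prod_exWeight_left (h : Generic q x) {S : Finset ℕ} (hS : S.Nonempty) {e : ℕ} (he : e ∉ S) :
    ∏ p ∈ S, exWeight q (x p) (x e) = ∑ c ∈ S,
      (q * x c / (q - 1) / (x e - x c) * ∏ p ∈ S.erase c, exWeight q (x p) (x c) +
        -(q ^ 2 * x c / (q - 1)) / (x e - q * x c) * ∏ p ∈ S.erase c, exWeight q (x c) (x p)) := by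
  have hq1 := sub_ne_zero.mpr h.q_ne_one
  have e1 : ∀ p t, t ≠ x p → t ≠ q * x p → exWeight q (x p) t =
      ∑ k, (bif k then -(q ^ 2 * x p / (q - 1)) else q * x p / (q - 1)) /
        (t - bif k then q * x p else x p) := by
    intro p t h1 h2
    rw [Fintype.sum_bool, exWeight]
    dsimp only [cond_true, cond_false]
    have h1 := sub_ne_zero.mpr h1
    have h2' := sub_ne_zero.mpr h2.symm
    have h2 := sub_ne_zero.mpr h2
    have h3 := h.ne_zero p
    field_simp
    ring
  have hne : ∀ c ∈ S, e ≠ c := fun c hc h => he (h ▸ hc)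
  rw [Finset.prod_congr rfl fun p hp => e1 p (x e) (h.ne (hne p hp)) (h.ne' (hne p hp).symm).symm]
  rw [prod_partial_fractions (fun p k => bif k then -(q ^ 2 * x p / (q - 1)) else q * x p / (q - 1))
    (fun p k => bif k then q * x p else x p) S hS]
  · refine Finset.sum_congr rfl fun c hc => ?_
    rw [Fintype.sum_bool, add_comm]
    dsimp only [cond_true, cond_false]
    congr 2
    · refine Finset.prod_congr rfl fun p hp => ?_
      have hpc := (Finset.mem_erase.mp hp).1
      exact (e1 p (x c) (h.ne hpc.symm) (h.ne' hpc).symm).symm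
    · refine Finset.prod_congr rfl fun p hp => ?_
      have hpc := (Finset.mem_erase.mp hp).1
      have h1 := h.ne' (Ne.symm hpc)
      have h2 := sub_ne_zero.mpr h1
      have h3 := sub_ne_zero.mpr (h.ne hpc)
      have h4 : q * x c ≠ q * x p := fun h' => h.ne (Ne.symm hpc) (mul_left_cancel₀ h.q_ne_zero h')
      rw [← e1 p (q * x c) h1 h4, exWeight, exWeight]
      have h5 : q * x p - q * x c ≠ 0 := sub_ne_zero.mpr h4.symm
      have := h.q_ne_zero
      rw [div_eq_div_iff (mul_ne_zero h2 h5) (mul_ne_zero h3 h2)]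
      ring
  · intro b hb k
    cases k
    · exact h.ne (hne b hb)
    · exact (h.ne' (hne b hb).symm).symm
  · intro b _ c _ hbc k k'
    cases k <;> cases k'
    · exact h.ne hbc
    · exact (h.ne' hbc.symm).symm
    · exact h.ne' hbc
    · exact fun h' => h.ne hbc (mul_left_cancel₀ h.q_ne_zero h')

/-- The same decomposition in the first argument, with poles at `x b` and `x b / q`. The residues at
`x c` are opposite to those of `prod_exWeight_left`, which is what lets them cancel. -/
theorem prod_exWeight_right (h : Generic q x) {S : Finset ℕ} (hS : S.Nonempty) {e : ℕ}
    (he : e ∉ S) :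
    ∏ b ∈ S, exWeight q (x e) (x b) = ∑ c ∈ S,
      (-(q * x c / (q - 1) / (x e - x c) * ∏ b ∈ S.erase c, exWeight q (x c) (x b)) +
        x c / (q - 1) / (x e - x c / q) * ∏ b ∈ S.erase c, exWeight q (x b) (x c)) := by
  have hq1 := sub_ne_zero.mpr h.q_ne_one
  have hq0 := h.q_ne_zero
  have hdiv : ∀ b t, t ≠ x b / q ↔ q * t ≠ x b := by
    intro b t; rw [Ne, Ne, eq_div_iff hq0, mul_comm]
  have e1 : ∀ b t, t ≠ x b → t ≠ x b / q → exWeight q t (x b) =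
      ∑ k, (bif k then x b / (q - 1) else -(q * x b / (q - 1))) /
        (t - bif k then x b / q else x b) := by
    intro p t h1 h2
    rw [Fintype.sum_bool, exWeight]
    dsimp only [cond_true, cond_false]
    have h1' := sub_ne_zero.mpr h1.symm
    have h1 := sub_ne_zero.mpr h1
    have h2' := sub_ne_zero.mpr ((hdiv _ _).mp h2)
    have h2 : t - x p / q = (q * t - x p) / q := by field_simp
    rw [h2]
    field_simp
    ring
  have hne : ∀ c ∈ S, e ≠ c := fun c hc h => he (h ▸ hc)
  rw [Finset.prod_congr rfl fun p hp => e1 p (x e) (h.ne (hne p hp))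
    ((hdiv _ _).mpr (h.ne' (hne p hp)))]
  rw [prod_partial_fractions (fun p k => bif k then x p / (q - 1) else -(q * x p / (q - 1)))
    (fun p k => bif k then x p / q else x p) S hS]
  · refine Finset.sum_congr rfl fun c hc => ?_
    rw [Fintype.sum_bool, add_comm]
    dsimp only [cond_true, cond_false]
    congr 1
    · rw [neg_div, neg_mul]
      congr 2
      refine Finset.prod_congr rfl fun p hp => ?_
      have hpc := (Finset.mem_erase.mp hp).1
      exact (e1 p (x c) (h.ne hpc.symm) ((hdiv _ _).mpr (h.ne' hpc.symm))).symm
    · congr 1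
      refine Finset.prod_congr rfl fun p hp => ?_
      have hpc := (Finset.mem_erase.mp hp).1
      have h1 := sub_ne_zero.mpr (h.ne' hpc)
      have h2 := sub_ne_zero.mpr (h.ne (Ne.symm hpc))
      rw [← e1 p (x c / q) (fun h' => h.ne' hpc (by rw [← h']; field_simp))
        (fun h' => h.ne hpc (by field_simp at h'; exact h'.symm)), exWeight, exWeight]
      have h5 : x p - x c / q = (q * x p - x c) / q := by field_simp
      have h6 : q * (x c / q) - x p = x c - x p := by field_simp
      rw [h5, h6]
      field_simp
  · intro b hb k
    cases k
    · exact h.ne (hne b hb)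
    · exact (hdiv _ _).mpr (h.ne' (hne b hb))
  · intro b _ c _ hbc k k'
    cases k <;> cases k'
    · exact h.ne hbc
    · exact (hdiv _ _).mpr (h.ne' hbc)
    · exact ((hdiv _ _).mpr (h.ne' hbc.symm)).symm
    · exact fun h' => h.ne hbc ((div_left_inj' hq0).mp h')

/-- The coefficients of the recursion for `crossSum`. -/
def crossCoeff (q : K) (x : ℕ → K) (B : Finset ℕ) (e c : ℕ) : K :=
  -(q ^ 2 * x c / (q - 1)) / (x e - q * x c) * (∏ b ∈ B.erase c, exWeight q (x c) (x b)) +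
    x c / (q - 1) / (x e - x c / q) * ∏ b ∈ B.erase c, exWeight q (x b) (x c)

/-- Partial fractions in `x e`: the poles at `x e = x c` coming from `e ∉ P` and `e ∈ P` cancel.
What remains has a coefficient that does not depend on `r`, since the products over `P` and over its
complement recombine into products over all of `B.erase c`. -/
theorem crossSum_rec (h : Generic q x) {B : Finset ℕ} {e : ℕ} (he : e ∉ B) {r : ℕ}
    (hr : r < B.card) :
    crossSum (fun i j => exWeight q (x i) (x j)) (insert e B) (r + 1) =
      ∑ c ∈ B, crossCoeff q x B e c *
        crossSum (fun i j => exWeight q (x i) (x j)) (B.erase c) r := by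
  rw [crossSum_insert _ he]
  have e1 : ∀ P ∈ powersetCard (r + 1) B, ∏ p ∈ P, exWeight q (x p) (x e) = ∑ c ∈ P,
      (q * x c / (q - 1) / (x e - x c) * ∏ p ∈ P.erase c, exWeight q (x p) (x c) +
        -(q ^ 2 * x c / (q - 1)) / (x e - q * x c) *
          ∏ p ∈ P.erase c, exWeight q (x c) (x p)) := by
    intro P hP
    obtain ⟨h1, h2⟩ := Finset.mem_powersetCard.mp hP
    exact prod_exWeight_left h (Finset.card_pos.mp (by omega)) fun h' => he (h1 h')
  have e2 : ∀ P ∈ powersetCard r B, ∏ b ∈ B \ P, exWeight q (x e) (x b) = ∑ c ∈ B \ P,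
      (-(q * x c / (q - 1) / (x e - x c) * ∏ b ∈ (B \ P).erase c, exWeight q (x c) (x b)) +
        x c / (q - 1) / (x e - x c / q) * ∏ b ∈ (B \ P).erase c, exWeight q (x b) (x c)) := by
    intro P hP
    obtain ⟨h1, h2⟩ := Finset.mem_powersetCard.mp hP
    refine prod_exWeight_right h (Finset.card_pos.mp ?_) fun h' => he (Finset.mem_sdiff.mp h').1
    rw [Finset.card_sdiff_of_subset h1]; omega
  rw [Finset.sum_congr rfl fun P hP => by rw [e1 P hP, Finset.mul_sum],
    Finset.sum_congr (rfl : powersetCard r B = _) fun P hP => by rw [e2 P hP, Finset.mul_sum],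
    sum_powersetCard_succ_mem, sum_powersetCard_notMem, ← Finset.sum_add_distrib]
  refine Finset.sum_congr rfl fun c hc => ?_
  rw [← Finset.sum_add_distrib, crossSum, Finset.mul_sum]
  refine Finset.sum_congr rfl fun P hP => ?_
  obtain ⟨h1, h2⟩ := Finset.mem_powersetCard.mp hP
  have hcP : c ∉ P := fun h' => by simpa using h1 h'
  set S := B.erase c with hS
  have hcS : c ∉ S := by simp [hS]
  have f1 : B \ insert c P = S \ P := by
    ext j; simp only [hS, Finset.mem_sdiff, Finset.mem_insert, Finset.mem_erase]; tauto
  have f2 : B \ P = insert c (S \ P) := by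
    ext j
    simp only [hS, Finset.mem_sdiff, Finset.mem_insert, Finset.mem_erase]
    by_cases hj : j = c
    · subst hj; simp [hc, hcP]
    · tauto
  have f3 : c ∉ S \ P := by simp [hcS]
  rw [f1, f2, Finset.prod_insert hcP, Finset.erase_insert hcP, Finset.erase_insert f3]
  simp only [Finset.prod_insert f3, Finset.prod_mul_distrib]
  have g1 := Finset.prod_sdiff (f := fun j => exWeight q (x c) (x j)) h1
  have g2 := Finset.prod_sdiff (f := fun j => exWeight q (x j) (x c)) h1
  rw [crossCoeff, ← hS, ← g1, ← g2]
  ring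

/-- Removing two elements by `crossSum_rec` lowers both orders by one with the same coefficients, so
the two middle sums stay equal from size one upwards. -/
theorem crossSum_symm (h : Generic q x) (s : ℕ) (B : Finset ℕ) (hB : B.card = 2 * s + 1) :
    crossSum (fun i j => exWeight q (x i) (x j)) B s =
      crossSum (fun i j => exWeight q (x i) (x j)) B (s + 1) := by
  induction s generalizing B with
  | zero =>
    have h2 : powersetCard (0 + 1) B = {B} := by
      rw [show 0 + 1 = B.card by omega, Finset.powersetCard_self]
    rw [crossSum, crossSum, h2, Finset.powersetCard_zero]
    simp
  | succ s ih =>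
    obtain ⟨e, he⟩ : B.Nonempty := Finset.card_pos.mp (by omega)
    have hc := Finset.card_erase_of_mem he
    rw [← Finset.insert_erase he, crossSum_rec h (Finset.notMem_erase _ _) (by omega),
      crossSum_rec h (Finset.notMem_erase _ _) (by omega)]
    refine Finset.sum_congr rfl fun c hc' => ?_
    rw [ih]
    rw [Finset.card_erase_of_mem hc']
    omega

end CrossSum

/-! ### Raising operators -/

section Raise
variable {K : Type*} [Field K]

/-- Multiplication by `q` of the coordinates in `S`. -/
def shift (q : K) (S : Finset ℕ) (x : ℕ → K) (i : ℕ) : K := if i ∈ S then q * x i else x i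

/-- Separation is required for all powers of `q` precisely so that genericity survives repeated
shifts. -/
theorem Generic.shift {q : K} {x : ℕ → K} (h : Generic q x) (S : Finset ℕ) :
    Generic q (shift q S x) := by
  refine ⟨h.q_ne_zero, h.q_pow, fun i => ?_, fun i j hij k l => ?_⟩
  · unfold LatticeWhittaker.shift
    split_ifs
    · exact mul_ne_zero h.q_ne_zero (h.ne_zero i)
    · exact h.ne_zero i
  · unfold LatticeWhittaker.shift
    split_ifs
    · simpa [pow_succ, mul_assoc] using h.sep i j hij (k + 1) (l + 1)
    · simpa [pow_succ, mul_assoc] using h.sep i j hij (k + 1) l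
    · simpa [pow_succ, mul_assoc] using h.sep i j hij k (l + 1)
    · exact h.sep i j hij k l

/-- The coefficients of the raising operators. -/
def raiseCoeff (V I : Finset ℕ) (x : ℕ → K) : K :=
  (∏ i ∈ I, x i) * ∏ i ∈ I, ∏ j ∈ V \ I, x i / (x i - x j)

/-- The raising operator of order `m` in the variables `V`. -/
def raise (q : K) (V : Finset ℕ) (m : ℕ) (f : (ℕ → K) → K) (x : ℕ → K) : K :=
  ∑ I ∈ powersetCard m V, raiseCoeff V I x * f (shift q (V \ I) x)

/-- A pair `(I, J)` is encoded by `A = I ∩ J`, the symmetric difference `B`, and `P = I \ J`. -/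
theorem sum_powersetCard_pair {M : Type*} [AddCommMonoid M] (V : Finset ℕ) (a b : ℕ)
    (g : Finset ℕ → Finset ℕ → M) :
    ∑ I ∈ powersetCard a V, ∑ J ∈ powersetCard b V, g I J =
      ∑ A ∈ V.powerset, ∑ B ∈ (V \ A).powerset,
        ∑ P ∈ B.powerset with A.card + P.card = a ∧ A.card + (B \ P).card = b,
          g (A ∪ P) (A ∪ (B \ P)) := by
  rw [Finset.sum_sigma', Finset.sum_sigma', Finset.sum_sigma']
  refine Finset.sum_bij' (fun y _ => ⟨⟨y.1 ∩ y.2, (y.1 \ y.2) ∪ (y.2 \ y.1)⟩, y.1 \ y.2⟩)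
    (fun y _ => ⟨y.1.1 ∪ y.2, y.1.1 ∪ (y.1.2 \ y.2)⟩) ?_ ?_ ?_ ?_ ?_
  · rintro ⟨I, J⟩ h
    simp only [Finset.mem_sigma, Finset.mem_powersetCard, Finset.mem_powerset,
      Finset.mem_filter] at h ⊢
    obtain ⟨⟨hI, rfl⟩, hJ, rfl⟩ := h
    have h1 : (I \ J ∪ J \ I) \ (I \ J) = J \ I := by
      ext j; simp only [Finset.mem_sdiff, Finset.mem_union]; tauto
    refine ⟨⟨Finset.inter_subset_left.trans hI, ?_⟩, Finset.subset_union_left, ?_, ?_⟩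
    · intro j
      simp only [Finset.mem_sdiff, Finset.mem_union, Finset.mem_inter]
      rintro (h | h)
      · exact ⟨hI h.1, fun h' => h.2 h'.2⟩
      · exact ⟨hJ h.1, fun h' => h.2 h'.1⟩
    · exact Finset.card_inter_add_card_sdiff I J
    · rw [h1, Finset.inter_comm]; exact Finset.card_inter_add_card_sdiff J I
  · rintro ⟨⟨A, B⟩, P⟩ h
    simp only [Finset.mem_sigma, Finset.mem_powersetCard, Finset.mem_powerset,
      Finset.mem_filter] at h ⊢
    obtain ⟨⟨hA, hB⟩, hP, h1, h2⟩ := h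
    have hd : Disjoint A B := Finset.disjoint_of_subset_right hB Finset.disjoint_sdiff
    have hBV := hB.trans Finset.sdiff_subset
    refine ⟨⟨Finset.union_subset hA (hP.trans hBV), ?_⟩,
      Finset.union_subset hA (Finset.sdiff_subset.trans hBV), ?_⟩
    · rw [Finset.card_union_of_disjoint (Finset.disjoint_of_subset_right hP hd), h1]
    · rw [Finset.card_union_of_disjoint (Finset.disjoint_of_subset_right Finset.sdiff_subset hd), h2]
  · rintro ⟨I, J⟩ h
    simp only [Sigma.mk.injEq, heq_eq_eq]
    constructor
    · ext j; simp only [Finset.mem_sdiff, Finset.mem_union, Finset.mem_inter]; tauto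
    · ext j; simp only [Finset.mem_sdiff, Finset.mem_union, Finset.mem_inter]; tauto
  · rintro ⟨⟨A, B⟩, P⟩ h
    simp only [Finset.mem_sigma, Finset.mem_powerset, Finset.mem_filter] at h
    obtain ⟨⟨hA, hB⟩, hP, h1, h2⟩ := h
    have hd : ∀ j ∈ B, j ∉ A := fun j hj => (Finset.mem_sdiff.mp (hB hj)).2
    have e1 : (A ∪ P) ∩ (A ∪ B \ P) = A := by
      ext j; simp only [Finset.mem_sdiff, Finset.mem_union, Finset.mem_inter]; tauto
    have e2 : (A ∪ P) \ (A ∪ B \ P) = P := by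
      ext j; simp only [Finset.mem_sdiff, Finset.mem_union]
      have := hd j; have := @hP j; tauto
    have e3 : (A ∪ B \ P) \ (A ∪ P) = B \ P := by
      ext j; simp only [Finset.mem_sdiff, Finset.mem_union]
      have := hd j; have := @hP j; tauto
    simp only [e1, e2, e3, Finset.union_sdiff_of_subset hP]
  · rintro ⟨I, J⟩ h
    have h1 : (I \ J ∪ J \ I) \ (I \ J) = J \ I := by
      ext j; simp only [Finset.mem_sdiff, Finset.mem_union]; tauto
    dsimp only
    rw [h1]
    congr 1
    · ext j; simp only [Finset.mem_sdiff, Finset.mem_union, Finset.mem_inter]; tauto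
    · ext j; simp only [Finset.mem_sdiff, Finset.mem_union, Finset.mem_inter]; tauto

/-- The part of a product of two coefficients of raising operators that depends only on the
intersection and the symmetric difference of the two subsets. -/
def pairCoeff (q : K) (V A B : Finset ℕ) (x : ℕ → K) : K :=
  (∏ i ∈ A, x i) * (∏ i ∈ A, x i) * (∏ i ∈ B, x i) *
    (∏ i ∈ A, ∏ j ∈ B, x i / (x i - x j)) *
    (∏ i ∈ A, ∏ j ∈ V \ (A ∪ B), x i / (x i - x j) * (x i / (x i - q * x j))) *
    (∏ i ∈ B, ∏ j ∈ V \ (A ∪ B), x i / (x i - x j))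

/-- Only factors between `P` and `Q` depend on how `P ∪ Q` is split, and each such pair contributes
one `exWeight`. Factors between `Q` and the outside are unaffected by the common shift, and the
shifted monomial over `Q` yields the power of `q`. -/
theorem raiseCoeff_mul_raiseCoeff {q : K} {x : ℕ → K} (h : Generic q x) {V A P Q : Finset ℕ}
    (hP : P ⊆ V) (hQ : Q ⊆ V) (hAP : Disjoint A P) (hAQ : Disjoint A Q)
    (hPQ : Disjoint P Q) :
    raiseCoeff V (A ∪ P) x * raiseCoeff V (A ∪ Q) (shift q (V \ (A ∪ P)) x) =
      q ^ Q.card * (pairCoeff q V A (P ∪ Q) x * ∏ p ∈ P, ∏ b ∈ Q, exWeight q (x b) (x p)) := by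
  set E := V \ (A ∪ (P ∪ Q)) with hE
  have e1 : V \ (A ∪ P) = Q ∪ E := by
    ext j
    simp only [hE, Finset.mem_sdiff, Finset.mem_union]
    have := @hQ j
    have dhAQ := Finset.disjoint_left.mp hAQ
    have := @dhAQ j
    have dhPQ := Finset.disjoint_left.mp hPQ
    have := @dhPQ j
    tauto
  have e2 : V \ (A ∪ Q) = P ∪ E := by
    ext j
    simp only [hE, Finset.mem_sdiff, Finset.mem_union]
    have := @hP j
    have dhAP := Finset.disjoint_left.mp hAP
    have := @dhAP j
    have dhPQ := Finset.disjoint_left.mp hPQ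
    have := @dhPQ j
    tauto
  have hQE : Disjoint Q E := by
    rw [Finset.disjoint_left]; intro j; simp only [hE, Finset.mem_sdiff, Finset.mem_union]; tauto
  have hPE : Disjoint P E := by
    rw [Finset.disjoint_left]; intro j; simp only [hE, Finset.mem_sdiff, Finset.mem_union]; tauto
  have hAE : Disjoint A E := by
    rw [Finset.disjoint_left]; intro j; simp only [hE, Finset.mem_sdiff, Finset.mem_union]; tauto
  set y := LatticeWhittaker.shift q (V \ (A ∪ P)) x with hy
  have yA : ∀ i ∈ A, y i = x i := fun i hi => by
    rw [hy, e1, LatticeWhittaker.shift, if_neg]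
    rw [Finset.mem_union]; rintro (h' | h')
    · exact Finset.disjoint_left.mp hAQ hi h'
    · exact Finset.disjoint_left.mp hAE hi h'
  have yP : ∀ i ∈ P, y i = x i := fun i hi => by
    rw [hy, e1, LatticeWhittaker.shift, if_neg]
    rw [Finset.mem_union]; rintro (h' | h')
    · exact Finset.disjoint_left.mp hPQ hi h'
    · exact Finset.disjoint_left.mp hPE hi h'
  have yQ : ∀ i ∈ Q, y i = q * x i := fun i hi => by
    rw [hy, e1, LatticeWhittaker.shift, if_pos (Finset.mem_union_left _ hi)]
  have yE : ∀ i ∈ E, y i = q * x i := fun i hi => by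
    rw [hy, e1, LatticeWhittaker.shift, if_pos (Finset.mem_union_right _ hi)]
  have q0 := h.q_ne_zero
  have pA : ∏ i ∈ A, y i = ∏ i ∈ A, x i := Finset.prod_congr rfl yA
  have pQ : ∏ i ∈ Q, y i = q ^ Q.card * ∏ i ∈ Q, x i := by
    rw [Finset.prod_congr rfl yQ, Finset.prod_mul_distrib, Finset.prod_const]
  have dAP : ∏ i ∈ A, ∏ j ∈ P, y i / (y i - y j) = ∏ i ∈ A, ∏ j ∈ P, x i / (x i - x j) :=
    Finset.prod_congr rfl fun i hi => Finset.prod_congr rfl fun j hj => by rw [yA i hi, yP j hj]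
  have dAE : ∏ i ∈ A, ∏ j ∈ E, y i / (y i - y j) = ∏ i ∈ A, ∏ j ∈ E, x i / (x i - q * x j) :=
    Finset.prod_congr rfl fun i hi => Finset.prod_congr rfl fun j hj => by rw [yA i hi, yE j hj]
  have dQE : ∏ i ∈ Q, ∏ j ∈ E, y i / (y i - y j) = ∏ i ∈ Q, ∏ j ∈ E, x i / (x i - x j) :=
    Finset.prod_congr rfl fun i hi => Finset.prod_congr rfl fun j hj => by
      rw [yQ i hi, yE j hj, ← mul_sub, mul_div_mul_left _ _ q0]
  have dPQ : (∏ i ∈ P, ∏ j ∈ Q, x i / (x i - x j)) * ∏ i ∈ Q, ∏ j ∈ P, y i / (y i - y j) =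
      ∏ p ∈ P, ∏ b ∈ Q, exWeight q (x b) (x p) := by
    rw [Finset.prod_comm (s := Q), ← Finset.prod_mul_distrib]
    refine Finset.prod_congr rfl fun i hi => ?_
    rw [← Finset.prod_mul_distrib]
    refine Finset.prod_congr rfl fun j hj => ?_
    rw [yQ j hj, yP i hi, exWeight, div_mul_div_comm]
    ring
  rw [raiseCoeff, raiseCoeff, e1, e2, pairCoeff, ← hE, Finset.prod_union hAP, Finset.prod_union hAQ,
    pA, pQ, Finset.prod_union hAP, Finset.prod_union hAQ, Finset.prod_union hPQ,
    Finset.prod_union hPQ, ← dPQ]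
  simp only [Finset.prod_union hQE, Finset.prod_union hPE, Finset.prod_union hPQ,
    Finset.prod_mul_distrib]
  rw [dAP, dAE, dQE]
  ring

/-- Coordinates in `A` are never shifted, those in `P` or `Q` once and all others in `V` twice, so
the result does not see how `P ∪ Q` is split. -/
theorem shift_shift (q : K) {V A P Q : Finset ℕ} (hAP : Disjoint A P) (hAQ : Disjoint A Q)
    (hPQ : Disjoint P Q) (hP : P ⊆ V) (hQ : Q ⊆ V) (x : ℕ → K) :
    shift q (V \ (A ∪ Q)) (shift q (V \ (A ∪ P)) x) =
      shift q (P ∪ Q) (shift q (V \ (A ∪ (P ∪ Q))) (shift q (V \ (A ∪ (P ∪ Q))) x)) := by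
  funext j
  have dhAP := Finset.disjoint_left.mp hAP
  have := @dhAP j
  have dhAQ := Finset.disjoint_left.mp hAQ
  have := @dhAQ j
  have dhPQ := Finset.disjoint_left.mp hPQ
  have := @dhPQ j
  have := @hP j
  have := @hQ j
  simp only [LatticeWhittaker.shift, Finset.mem_sdiff, Finset.mem_union]
  by_cases h1 : j ∈ A <;> by_cases h2 : j ∈ P <;> by_cases h3 : j ∈ Q <;> by_cases h4 : j ∈ V <;>
    simp_all

theorem raise_raise {q : K} {x : ℕ → K} (h : Generic q x) (V : Finset ℕ) (a b : ℕ)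
    (f : (ℕ → K) → K) :
    raise q V a (raise q V b f) x =
      ∑ A ∈ V.powerset, ∑ B ∈ (V \ A).powerset, pairCoeff q V A B x *
        f (shift q B (shift q (V \ (A ∪ B)) (shift q (V \ (A ∪ B)) x))) * (q ^ (b - A.card) *
        ∑ P ∈ B.powerset with A.card + P.card = a ∧ A.card + (B \ P).card = b,
          ∏ p ∈ P, ∏ b ∈ B \ P, exWeight q (x b) (x p)) := by
  have h1 : raise q V a (raise q V b f) x = ∑ I ∈ powersetCard a V, ∑ J ∈ powersetCard b V,
      raiseCoeff V I x * raiseCoeff V J (shift q (V \ I) x) *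
        f (shift q (V \ J) (shift q (V \ I) x)) := by
    rw [raise]
    refine Finset.sum_congr rfl fun I _ => ?_
    rw [raise, Finset.mul_sum]
    refine Finset.sum_congr rfl fun J _ => ?_
    ring
  rw [h1, sum_powersetCard_pair]
  refine Finset.sum_congr rfl fun A _ => Finset.sum_congr rfl fun B hB => ?_
  rw [Finset.mul_sum, Finset.mul_sum]
  refine Finset.sum_congr rfl fun P hP => ?_
  have hB := Finset.mem_powerset.mp hB
  obtain ⟨hP, h2, h3⟩ := Finset.mem_filter.mp hP
  have hP := Finset.mem_powerset.mp hP
  have hd : Disjoint A B := Finset.disjoint_of_subset_right hB Finset.disjoint_sdiff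
  have hBV := hB.trans Finset.sdiff_subset
  have hAP := Finset.disjoint_of_subset_right hP hd
  have hAQ : Disjoint A (B \ P) := Finset.disjoint_of_subset_right Finset.sdiff_subset hd
  rw [raiseCoeff_mul_raiseCoeff h (hP.trans hBV) (Finset.sdiff_subset.trans hBV) hAP hAQ
    Finset.disjoint_sdiff, shift_shift q hAP hAQ Finset.disjoint_sdiff (hP.trans hBV)
    (Finset.sdiff_subset.trans hBV), Finset.union_sdiff_of_subset hP,
    show b - A.card = (B \ P).card by omega]
  ring

/-- The two cardinality conditions fix the size of `P` and are compatible for only one size of `B`.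
-/
theorem sum_powerset_cross {w : ℕ → ℕ → K} (A B : Finset ℕ) (a b : ℕ) :
    (∑ P ∈ B.powerset with A.card + P.card = a ∧ A.card + (B \ P).card = b,
          ∏ p ∈ P, ∏ b ∈ B \ P, w p b) =
      if A.card ≤ a ∧ A.card ≤ b ∧ B.card = (a - A.card) + (b - A.card) then
        crossSum w B (a - A.card) else 0 := by
  split_ifs with h
  · rw [crossSum]
    refine Finset.sum_congr ?_ fun _ _ => rfl
    ext P
    simp only [Finset.mem_filter, Finset.mem_powerset, Finset.mem_powersetCard]
    refine and_congr_right fun hP => ?_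
    have := Finset.card_sdiff_of_subset hP
    have := Finset.card_le_card hP
    omega
  · refine Finset.sum_eq_zero fun P hP => ?_
    obtain ⟨hP, h2, h3⟩ := Finset.mem_filter.mp hP
    have hP := Finset.mem_powerset.mp hP
    have := Finset.card_sdiff_of_subset hP
    have := Finset.card_le_card hP
    omega

theorem crossSum_swap (w : ℕ → ℕ → K) (B : Finset ℕ) {r s : ℕ} (h : B.card = r + s) :
    crossSum (fun i j => w j i) B r = crossSum w B s := by
  rw [crossSum, crossSum]
  refine Finset.sum_bij' (fun P _ => B \ P) (fun P _ => B \ P) ?_ ?_ ?_ ?_ ?_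
  · intro P hP
    obtain ⟨h1, h2⟩ := Finset.mem_powersetCard.mp hP
    rw [Finset.mem_powersetCard, Finset.card_sdiff_of_subset h1]
    exact ⟨Finset.sdiff_subset, by omega⟩
  · intro P hP
    obtain ⟨h1, h2⟩ := Finset.mem_powersetCard.mp hP
    rw [Finset.mem_powersetCard, Finset.card_sdiff_of_subset h1]
    exact ⟨Finset.sdiff_subset, by omega⟩
  · intro P hP; exact Finset.sdiff_sdiff_eq_self (Finset.mem_powersetCard.mp hP).1
  · intro P hP; exact Finset.sdiff_sdiff_eq_self (Finset.mem_powersetCard.mp hP).1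
  · intro P hP
    rw [Finset.sdiff_sdiff_eq_self (Finset.mem_powersetCard.mp hP).1, Finset.prod_comm]

/-- In both compositions the terms are grouped by the intersection and the symmetric difference of
the two subsets. The group sums are cross sums of the two middle orders on a set of odd size, equal
by `crossSum_symm`, and the powers of `q` differ by one factor. -/
theorem raise_comm {q : K} {x : ℕ → K} (h : Generic q x) (V : Finset ℕ) (m : ℕ)
    (f : (ℕ → K) → K) :
    raise q V m (raise q V (m + 1) f) x = q * raise q V (m + 1) (raise q V m f) x := by
  rw [raise_raise h, raise_raise h, Finset.mul_sum]
  refine Finset.sum_congr rfl fun A _ => ?_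
  rw [Finset.mul_sum]
  refine Finset.sum_congr rfl fun B _ => ?_
  rw [sum_powerset_cross (w := fun i j => exWeight q (x j) (x i)),
    sum_powerset_cross (w := fun i j => exWeight q (x j) (x i))]
  by_cases hc : A.card ≤ m ∧ B.card = 2 * (m - A.card) + 1
  · rw [if_pos (by omega), if_pos (by omega), crossSum_swap (fun i j => exWeight q (x i) (x j)) B
      (r := m - A.card) (s := m - A.card + 1) (by omega),
      crossSum_swap (fun i j => exWeight q (x i) (x j)) B
      (r := m + 1 - A.card) (s := m - A.card) (by omega), crossSum_symm h _ _ hc.2,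
      show m + 1 - A.card = m - A.card + 1 by omega, pow_succ]
    ring
  · rw [if_neg (by omega), if_neg (by omega)]; ring

end Raise

/-! ### Properties of the raising operators -/

section RaiseProps
variable {K : Type*} [Field K] {q : K} {x : ℕ → K}

theorem raise_congr (h : Generic q x) (V : Finset ℕ) (m : ℕ) {f g : (ℕ → K) → K}
    (hfg : ∀ y, Generic q y → f y = g y) : raise q V m f x = raise q V m g x :=
  Finset.sum_congr rfl fun I _ => by rw [hfg _ (h.shift _)]

/-- Invariance under the transpositions of the first `n` variables. -/
def SymmFun (q : K) (n : ℕ) (f : (ℕ → K) → K) : Prop :=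
  ∀ x, Generic q x → ∀ i j, i < n → j < n → f (x ∘ Equiv.swap i j) = f x

theorem Generic.comp (h : Generic q x) (σ : Equiv.Perm ℕ) : Generic q (x ∘ σ) :=
  ⟨h.q_ne_zero, h.q_pow, fun _ => h.ne_zero _, fun _ _ hij => h.sep _ _ (σ.injective.ne hij)⟩

theorem shift_comp (q : K) (S : Finset ℕ) (x : ℕ → K) (σ : Equiv.Perm ℕ) :
    shift q S (x ∘ σ) = shift q (S.map σ.toEmbedding) x ∘ σ := by
  funext i
  simp [shift]

theorem raiseCoeff_comp (V I : Finset ℕ) (x : ℕ → K) (σ : Equiv.Perm ℕ) :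
    raiseCoeff V I (x ∘ σ) = raiseCoeff (V.map σ.toEmbedding) (I.map σ.toEmbedding) x := by
  rw [raiseCoeff, raiseCoeff, ← Finset.map_sdiff, Finset.prod_map, Finset.prod_map]
  simp

theorem map_swap_range {n i j : ℕ} (hi : i < n) (hj : j < n) :
    (range n).map (Equiv.swap i j).toEmbedding = range n := by
  refine Finset.eq_of_subset_of_card_le ?_ (by simp)
  intro k hk
  obtain ⟨l, hl, rfl⟩ := Finset.mem_map.mp hk
  rw [Finset.mem_range] at hl ⊢
  simp only [Equiv.coe_toEmbedding, Equiv.swap_apply_def]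
  split_ifs <;> assumption

/-- A transposition of variables permutes the summands, because it permutes the `m`-subsets of
`range n`. -/
theorem SymmFun.raise {n : ℕ} {f : (ℕ → K) → K} (hf : SymmFun q n f) (m : ℕ) :
    SymmFun q n (raise q (range n) m f) := by
  intro x hx i j hi hj
  have hV := map_swap_range hi hj
  rw [LatticeWhittaker.raise, LatticeWhittaker.raise]
  refine Finset.sum_bij' (fun I _ => I.map (Equiv.swap i j).toEmbedding)
    (fun I _ => I.map (Equiv.swap i j).toEmbedding) ?_ ?_ ?_ ?_ ?_
  · intro I hI
    rw [Finset.mem_powersetCard] at hI ⊢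
    refine ⟨?_, by rw [Finset.card_map, hI.2]⟩
    conv_rhs => rw [← hV]
    exact Finset.map_subset_map.mpr hI.1
  · intro I hI
    rw [Finset.mem_powersetCard] at hI ⊢
    refine ⟨?_, by rw [Finset.card_map, hI.2]⟩
    conv_rhs => rw [← hV]
    exact Finset.map_subset_map.mpr hI.1
  · intro I _; ext k; simp
  · intro I _; ext k; simp
  · intro I _
    rw [raiseCoeff_comp, shift_comp, hV, Finset.map_sdiff, hV, hf _ (hx.shift _) i j hi hj]

/-- The interpolation property: the values `f (shift q {i} x)`, as a function of `x i`, are those of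
a polynomial of degree at most `m` with value `f x` at `0`. -/
def Interpolates (q : K) (V : Finset ℕ) (m : ℕ) (f : (ℕ → K) → K) : Prop :=
  ∀ x, Generic q x → ∀ U ⊆ V, U.card = m + 1 →
    ∑ i ∈ U, (∏ j ∈ U.erase i, x j / (x j - x i)) * f (shift q {i} x) = f x

/-- The Aitken–Neville step: interpolation on `m + 2` nodes is a combination of the interpolations
that omit `a` and `b`, with weights proportional to `-x a` and `x b`. -/
theorem Interpolates.succ {V : Finset ℕ} {m : ℕ} {f : (ℕ → K) → K} (hf : Interpolates q V m f) :
    Interpolates q V (m + 1) f := by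
  intro x hx U hU hc
  obtain ⟨a, ha⟩ : U.Nonempty := Finset.card_pos.mp (by omega)
  obtain ⟨b, hb⟩ : (U.erase a).Nonempty := Finset.card_pos.mp (by
    rw [Finset.card_erase_of_mem ha]; omega)
  obtain ⟨hba, hbU⟩ := Finset.mem_erase.mp hb
  have h1 := hf x hx (U.erase a) ((Finset.erase_subset _ _).trans hU)
    (by rw [Finset.card_erase_of_mem ha]; omega)
  have h2 := hf x hx (U.erase b) ((Finset.erase_subset _ _).trans hU)
    (by rw [Finset.card_erase_of_mem hbU]; omega)
  have hab0 := sub_ne_zero.mpr (hx.ne hba)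
  set S := (U.erase a).erase b with hS
  have haS : a ∉ S := by simp [hS]
  have hbS : b ∉ S := by simp [hS]
  have e1 : U.erase a = insert b S := by rw [hS, Finset.insert_erase hb]
  have e2 : U.erase b = insert a S := by
    rw [hS, Finset.erase_right_comm, Finset.insert_erase (Finset.mem_erase.mpr ⟨hba.symm, ha⟩)]
  have e3 : U = insert a (insert b S) := by rw [← e1, Finset.insert_erase ha]
  have haS' : a ∉ insert b S := by rw [← e1]; simp
  rw [e1, Finset.sum_insert hbS, Finset.erase_insert hbS] at h1
  rw [e2, Finset.sum_insert haS, Finset.erase_insert haS] at h2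
  have e4 : ∀ i ∈ S, (x b - x a) * ∏ j ∈ U.erase i, x j / (x j - x i) =
      x b * (∏ j ∈ (insert a S).erase i, x j / (x j - x i)) -
        x a * ∏ j ∈ (insert b S).erase i, x j / (x j - x i) := by
    intro i hi
    have hai : i ≠ a := fun h => haS (h ▸ hi)
    have hbi : i ≠ b := fun h => hbS (h ▸ hi)
    have hne1 := sub_ne_zero.mpr (hx.ne hai.symm)
    have hne2 := sub_ne_zero.mpr (hx.ne hbi.symm)
    rw [e3, Finset.erase_insert_of_ne hai.symm, Finset.erase_insert_of_ne hbi.symm,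
      Finset.erase_insert_of_ne hai.symm, Finset.prod_insert, Finset.prod_insert,
      Finset.prod_insert]
    · field_simp
      ring
    · simp [haS]
    · simp [hbS]
    · simp [haS, hba.symm]
  have e5 : U.erase b = insert a S := e2
  rw [← mul_right_inj' hab0]
  conv_lhs => rw [Finset.mul_sum, e3, Finset.sum_insert haS', Finset.sum_insert hbS]
  rw [← e3, e1, e2, Finset.prod_insert hbS, Finset.prod_insert haS]
  rw [Finset.sum_congr rfl fun i hi => by rw [← mul_assoc, e4 i hi, sub_mul]]
  rw [Finset.sum_sub_distrib]
  simp only [mul_assoc (x b), mul_assoc (x a), ← Finset.mul_sum]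
  have h1' := hx.ne hba
  have hab0' := sub_ne_zero.mpr (hx.ne hba.symm)
  have t1 : (x b - x a) * (x b / (x b - x a) * (∏ j ∈ S, x j / (x j - x a)) * f (shift q {a} x)) =
      x b * ((∏ j ∈ S, x j / (x j - x a)) * f (shift q {a} x)) := by field_simp
  have t2 : (x b - x a) * (x a / (x a - x b) * (∏ j ∈ S, x j / (x j - x b)) * f (shift q {b} x)) =
      -(x a * ((∏ j ∈ S, x j / (x j - x b)) * f (shift q {b} x))) := by
    rw [← neg_sub (x a) (x b)]; field_simp
  rw [t1, t2]
  linear_combination x b * h2 - x a * h1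

theorem raise_of_card {V : Finset ℕ} {m : ℕ} (hV : V.card = m + 1) (f : (ℕ → K) → K) :
    raise q V m f x = ∑ c ∈ V, (∏ i ∈ V.erase c, x i) * (∏ i ∈ V.erase c, x i / (x i - x c)) *
      f (shift q {c} x) := by
  rw [raise]
  symm
  refine Finset.sum_bij (fun c _ => V.erase c) ?_ ?_ ?_ ?_
  · intro c hc
    rw [Finset.mem_powersetCard, Finset.card_erase_of_mem hc]
    exact ⟨Finset.erase_subset _ _, by omega⟩
  · intro c hc d hd h
    by_contra hne
    have : c ∈ V.erase d := Finset.mem_erase.mpr ⟨hne, hc⟩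
    rw [← h] at this
    simp at this
  · intro I hI
    obtain ⟨h1, h2⟩ := Finset.mem_powersetCard.mp hI
    have h3 := Finset.card_sdiff_of_subset h1
    obtain ⟨c, hc⟩ := Finset.card_eq_one.mp (show (V \ I).card = 1 by omega)
    refine ⟨c, (Finset.mem_sdiff.mp (hc ▸ Finset.mem_singleton_self c : c ∈ V \ I)).1, ?_⟩
    rw [Finset.erase_eq, ← hc, Finset.sdiff_sdiff_eq_self h1]
  · intro c hc
    have : V \ V.erase c = {c} := by
      rw [Finset.erase_eq, Finset.sdiff_sdiff_eq_self (by simpa using hc)]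
    rw [raiseCoeff, this]
    simp

theorem sum_antisymm [CharZero K] (V : Finset ℕ) (g : ℕ → ℕ → K)
    (hg : ∀ c ∈ V, ∀ d ∈ V, g c d + g d c = 0) : ∑ c ∈ V, ∑ d ∈ V, g c d = 0 := by
  have h1 : (2 : K) * ∑ c ∈ V, ∑ d ∈ V, g c d = 0 := by
    rw [two_mul]
    conv_lhs => arg 2; rw [Finset.sum_comm]
    rw [← Finset.sum_add_distrib]
    refine Finset.sum_eq_zero fun c hc => ?_
    rw [← Finset.sum_add_distrib]
    exact Finset.sum_eq_zero fun d hd => hg c hc d hd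
  simpa using h1

/-- When all nodes are used, expanding each value of `f` in the operator by the interpolation
formula makes the difference of the two sides a double sum over `(c, d)`. Its summand is
antisymmetric, since the two shifts commute. -/
theorem Interpolates.raise_of_card [CharZero K] {V : Finset ℕ} {m : ℕ} (hV : V.card = m + 1)
    {f : (ℕ → K) → K} (hf : Interpolates q V m f) : Interpolates q V m (raise q V m f) := by
  intro x hx U hU hc
  obtain rfl : U = V := Finset.eq_of_subset_of_card_le hU (by omega)
  have h0 : ∀ c ∈ U, f (shift q {c} x) = ∑ i ∈ U, (∏ j ∈ U.erase i, shift q {c} x j /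
      (shift q {c} x j - shift q {c} x i)) * f (shift q {i} (shift q {c} x)) :=
    fun c _ => (hf _ (hx.shift _) U hU hc).symm
  simp only [LatticeWhittaker.raise_of_card hV]
  have hR : ∀ c ∈ U, (∏ i ∈ U.erase c, x i) * (∏ i ∈ U.erase c, x i / (x i - x c)) *
      f (shift q {c} x) = ∑ d ∈ U, (∏ i ∈ U.erase c, x i) * (∏ i ∈ U.erase c, x i / (x i - x c)) *
        ((∏ j ∈ U.erase d, shift q {c} x j / (shift q {c} x j - shift q {c} x d)) *
          f (shift q {d} (shift q {c} x))) := fun c hc => by rw [h0 c hc, Finset.mul_sum]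
  rw [Finset.sum_congr rfl hR]
  simp only [Finset.mul_sum (s := U)]
  rw [Finset.sum_comm, ← sub_eq_zero, ← Finset.sum_sub_distrib]
  simp only [← Finset.sum_sub_distrib]
  refine sum_antisymm U _ fun c hc d hd => ?_
  have hs : shift q {d} (shift q {c} x) = shift q {c} (shift q {d} x) := by
    funext i; simp only [shift]; split_ifs <;> rfl
  rcases eq_or_ne c d with rfl | hcd
  · have e1 : ∏ i ∈ U.erase c, shift q {c} x i = ∏ i ∈ U.erase c, x i :=
      Finset.prod_congr rfl fun i hi => by
        rw [shift, if_neg (by simpa using (Finset.mem_erase.mp hi).1)]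
    rw [e1]; ring
  · set S := (U.erase c).erase d with hS
    have hcS : ∀ i ∈ S, i ≠ c := fun i hi => by simp [hS] at hi; tauto
    have hdS : ∀ i ∈ S, i ≠ d := fun i hi => by simp [hS] at hi; tauto
    have e1 : U.erase c = insert d S := by
      rw [hS, Finset.insert_erase (Finset.mem_erase.mpr ⟨hcd.symm, hd⟩)]
    have e2 : U.erase d = insert c S := by
      rw [hS, Finset.erase_right_comm, Finset.insert_erase (Finset.mem_erase.mpr ⟨hcd, hc⟩)]
    have hcS' : c ∉ S := fun h => hcS c h rfl
    have hdS' : d ∉ S := fun h => hdS d h rfl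
    have p1 : ∀ g : ℕ → K → K, ∏ i ∈ S, g i (shift q {c} x i) = ∏ i ∈ S, g i (x i) :=
      fun g => Finset.prod_congr rfl fun i hi => by
        rw [shift, if_neg (by simpa using hcS i hi)]
    have p2 : ∀ g : ℕ → K → K, ∏ i ∈ S, g i (shift q {d} x i) = ∏ i ∈ S, g i (x i) :=
      fun g => Finset.prod_congr rfl fun i hi => by
        rw [shift, if_neg (by simpa using hdS i hi)]
    have s1 : shift q {c} x c = q * x c := by simp [shift]
    have s2 : shift q {c} x d = x d := by simp [shift, hcd.symm]
    have s3 : shift q {d} x d = q * x d := by simp [shift]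
    have s4 : shift q {d} x c = x c := by simp [shift, hcd]
    rw [e1, e2]
    simp only [Finset.prod_insert hcS', Finset.prod_insert hdS', s1, s2, s3, s4]
    have a1 := p1 (fun _ z => z)
    have a2 := p2 (fun _ z => z)
    have a3 := p1 (fun _ z => z / (z - x d))
    have a4 := p2 (fun _ z => z / (z - x c))
    rw [a1, a2, a3, a4, hs]
    have n3 := sub_ne_zero.mpr (hx.ne' hcd)
    have n4 := sub_ne_zero.mpr (hx.ne' hcd.symm)
    -- After the factors over the other nodes are taken out, antisymmetry is this identity in `x c`
    -- and `x d`.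
    have key : x c / (x c - x d) * (q * x d * (q * x d / (q * x d - x c))) -
        x d * (x d / (x d - x c)) * (q * x c / (q * x c - x d)) +
        (x d / (x d - x c) * (q * x c * (q * x c / (q * x c - x d))) -
        x c * (x c / (x c - x d)) * (q * x d / (q * x d - x c))) = 0 := by
      have t3 := mul_inv_cancel₀ n3
      have t4 := mul_inv_cancel₀ n4
      rw [← neg_sub (x c) (x d)]
      simp only [div_eq_mul_inv, inv_neg]
      linear_combination (q * x c * x d * (x c - x d)⁻¹) * t4 -
        (q * x c * x d * (x c - x d)⁻¹) * t3
    linear_combination ((∏ i ∈ S, x i) * (∏ i ∈ S, x i / (x i - x c)) *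
      (∏ i ∈ S, x i / (x i - x d)) * f (shift q {c} (shift q {d} x))) * key

/-- Partial fractions in `t`: the product has value `1` at infinity and simple poles at the `z c`.
-/
theorem prod_sub_sum_eq_one (S : Finset ℕ) (z : ℕ → K) (hz : ∀ i ∈ S, ∀ j ∈ S, i ≠ j → z i ≠ z j)
    (t : K) (ht : ∀ i ∈ S, t ≠ z i) :
    ∏ l ∈ S, t / (t - z l) = 1 + ∑ c ∈ S, z c / (t - z c) * ∏ l ∈ S.erase c, z c / (z c - z l) := by
  induction S using Finset.induction_on generalizing t with
  | empty => simp
  | insert b S hb ih =>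
    have hz' : ∀ i ∈ S, ∀ j ∈ S, i ≠ j → z i ≠ z j := fun i hi j hj =>
      hz i (Finset.mem_insert_of_mem hi) j (Finset.mem_insert_of_mem hj)
    have hbz : ∀ i ∈ S, z b ≠ z i := fun i hi =>
      hz b (Finset.mem_insert_self _ _) i (Finset.mem_insert_of_mem hi) fun h => hb (h ▸ hi)
    have htb := sub_ne_zero.mpr (ht b (Finset.mem_insert_self _ _))
    rw [Finset.prod_insert hb, Finset.sum_insert hb, Finset.erase_insert hb,
      ih hz' t fun i hi => ht i (Finset.mem_insert_of_mem hi), ih hz' (z b) hbz]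
    have : ∀ c ∈ S, z c / (t - z c) * ∏ l ∈ (insert b S).erase c, z c / (z c - z l) =
        t / (t - z b) * (z c / (t - z c) * ∏ l ∈ S.erase c, z c / (z c - z l)) -
        z b / (t - z b) * (z c / (z b - z c) * ∏ l ∈ S.erase c, z c / (z c - z l)) := by
      intro c hc
      have hcb : c ≠ b := fun h => hb (h ▸ hc)
      rw [Finset.erase_insert_of_ne hcb.symm, Finset.prod_insert (by simp [hb])]
      have h1 := sub_ne_zero.mpr (ht c (Finset.mem_insert_of_mem hc))
      have h2 := sub_ne_zero.mpr (hbz c hc)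
      have h3 := sub_ne_zero.mpr (hbz c hc).symm
      field_simp
      ring
    rw [Finset.sum_congr rfl this, Finset.sum_sub_distrib, ← Finset.mul_sum, ← Finset.mul_sum]
    field_simp
    ring

/-- Removal of one variable from a raising operator. -/
theorem raise_insert (hx : Generic q x) {V : Finset ℕ} {a : ℕ} (ha : a ∉ V) (M : ℕ)
    {f : (ℕ → K) → K} (hf : Interpolates q (insert a V) (M + 1) f) :
    raise q (insert a V) (M + 1) f x = raise q V (M + 1) f x + x a * raise q V M f x := by
  have hne : ∀ i ∈ V, a ≠ i := fun i hi h => ha (h ▸ hi)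
  -- For subsets without `a`, interpolation at the nodes `insert a I` replaces the value shifted in
  -- `a` by the unshifted one, at the cost of correction terms indexed by `i ∈ I`.
  have hI : ∀ I ∈ powersetCard (M + 1) V,
      raiseCoeff (insert a V) I x * f (shift q (insert a V \ I) x) =
      raiseCoeff V I x * f (shift q (V \ I) x) - ∑ i ∈ I, raiseCoeff V I x *
        (x a / (x a - x i) * ∏ j ∈ I.erase i, x j / (x j - x i)) *
          f (shift q (V \ I.erase i) x) := by
    intro I hI
    obtain ⟨h1, h2⟩ := Finset.mem_powersetCard.mp hI
    have haI : a ∉ I := fun h => ha (h1 h)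
    have e1 : insert a V \ I = insert a (V \ I) := Finset.insert_sdiff_of_notMem _ haI
    have haVI : a ∉ V \ I := by simp [ha]
    have e2 : raiseCoeff (insert a V) I x = raiseCoeff V I x * ∏ i ∈ I, x i / (x i - x a) := by
      rw [raiseCoeff, raiseCoeff, e1]
      simp only [Finset.prod_insert haVI, Finset.prod_mul_distrib]
      ring
    have hz : ∀ i ∈ insert a I, shift q (V \ I) x i = x i := by
      intro i hi
      rw [shift, if_neg]
      rw [Finset.mem_insert] at hi
      rcases hi with rfl | hi
      · exact haVI
      · simp [hi]
    have hg := hf (shift q (V \ I) x) (hx.shift _) (insert a I)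
      (Finset.insert_subset_insert _ h1) (by rw [Finset.card_insert_of_notMem haI, h2])
    rw [Finset.sum_insert haI, Finset.erase_insert haI] at hg
    have e3 : shift q {a} (shift q (V \ I) x) = shift q (insert a (V \ I)) x := by
      funext j
      simp only [shift, Finset.mem_singleton, Finset.mem_insert]
      by_cases hj : j = a
      · subst hj; simp [haVI]
      · simp [hj]
    have e4 : ∀ i ∈ I, shift q {i} (shift q (V \ I) x) = shift q (V \ I.erase i) x := by
      intro i hi
      funext j
      simp only [shift, Finset.mem_singleton, Finset.mem_sdiff, Finset.mem_erase]
      by_cases hj : j = i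
      · subst hj; simp [hi, h1 hi]
      · simp [hj]
    have e5 : ∏ j ∈ I, shift q (V \ I) x j / (shift q (V \ I) x j - shift q (V \ I) x a) =
        ∏ i ∈ I, x i / (x i - x a) := Finset.prod_congr rfl fun j hj => by
      rw [hz j (Finset.mem_insert_of_mem hj), hz a (Finset.mem_insert_self _ _)]
    have e6 : ∀ i ∈ I, ∏ j ∈ (insert a I).erase i, shift q (V \ I) x j /
        (shift q (V \ I) x j - shift q (V \ I) x i) =
        x a / (x a - x i) * ∏ j ∈ I.erase i, x j / (x j - x i) := by
      intro i hi
      have hai : a ≠ i := fun h => haI (h ▸ hi)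
      rw [Finset.erase_insert_of_ne hai, Finset.prod_insert (by simp [haI]),
        hz i (Finset.mem_insert_of_mem hi), hz a (Finset.mem_insert_self _ _)]
      congr 1
      refine Finset.prod_congr rfl fun j hj => ?_
      rw [hz j (Finset.mem_insert_of_mem (Finset.mem_of_mem_erase hj))]
    rw [e3, e5, Finset.sum_congr rfl fun i hi => by rw [e6 i hi, e4 i hi]] at hg
    rw [e2, e1]
    simp only [mul_assoc (raiseCoeff V I x)]
    rw [← Finset.mul_sum]
    linear_combination raiseCoeff V I x * hg
  -- For subsets containing `a`, partial fractions in `x a` give the wanted term and correction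
  -- terms indexed by `c ∉ J`. With `I = insert c J` they are the corrections in `hI` with opposite
  -- sign.
  have hJ : ∀ J ∈ powersetCard M V,
      raiseCoeff (insert a V) (insert a J) x * f (shift q (insert a V \ insert a J) x) =
      x a * (raiseCoeff V J x * f (shift q (V \ J) x)) + ∑ c ∈ V \ J,
        raiseCoeff V (insert c J) x * (x a / (x a - x c) * ∏ j ∈ (insert c J).erase c,
          x j / (x j - x c)) * f (shift q (V \ (insert c J).erase c) x) := by
    intro J hJ
    obtain ⟨h1, h2⟩ := Finset.mem_powersetCard.mp hJ
    have haJ : a ∉ J := fun h => ha (h1 h)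
    have e1 : insert a V \ insert a J = V \ J := by
      ext j; simp only [Finset.mem_sdiff, Finset.mem_insert]
      constructor
      · tauto
      · rintro ⟨h1, h2⟩
        exact ⟨Or.inr h1, by rintro (rfl | h); exacts [ha h1, h2 h]⟩
    have e2 : raiseCoeff (insert a V) (insert a J) x =
        x a * raiseCoeff V J x * ∏ l ∈ V \ J, x a / (x a - x l) := by
      rw [raiseCoeff, raiseCoeff, e1, Finset.prod_insert haJ, Finset.prod_insert haJ]
      ring
    have e3 : ∀ c ∈ V \ J, raiseCoeff V (insert c J) x * (x a / (x a - x c) *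
        ∏ j ∈ (insert c J).erase c, x j / (x j - x c)) *
        f (shift q (V \ (insert c J).erase c) x) =
        x a * raiseCoeff V J x * (x c / (x a - x c) *
          ∏ l ∈ (V \ J).erase c, x c / (x c - x l)) * f (shift q (V \ J) x) := by
      intro c hc
      obtain ⟨hcV, hcJ⟩ := Finset.mem_sdiff.mp hc
      have e4 : V \ insert c J = (V \ J).erase c := by
        ext j; simp only [Finset.mem_sdiff, Finset.mem_insert, Finset.mem_erase]; tauto
      have e5 : ∏ i ∈ J, ∏ j ∈ V \ J, x i / (x i - x j) = (∏ i ∈ J, x i / (x i - x c)) *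
          ∏ i ∈ J, ∏ j ∈ (V \ J).erase c, x i / (x i - x j) := by
        rw [← Finset.prod_mul_distrib]
        exact Finset.prod_congr rfl fun i _ => (Finset.mul_prod_erase _ _ hc).symm
      rw [Finset.erase_insert hcJ, raiseCoeff, raiseCoeff, e4, e5, Finset.prod_insert hcJ,
        Finset.prod_insert hcJ]
      ring
    have e4 := prod_sub_sum_eq_one (V \ J) x (fun i _ j _ hij => hx.ne hij) (x a)
      (fun i hi => hx.ne (hne i (Finset.mem_sdiff.mp hi).1))
    rw [Finset.sum_congr rfl e3, ← Finset.sum_mul, ← Finset.mul_sum, e1, e2, e4]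
    ring
  have hdisj : Disjoint (powersetCard (M + 1) V) ((powersetCard M V).image (insert a)) := by
    rw [Finset.disjoint_left]
    intro P hP hP'
    obtain ⟨Q, _, rfl⟩ := Finset.mem_image.mp hP'
    exact ha ((Finset.mem_powersetCard.mp hP).1 (Finset.mem_insert_self _ _))
  have hinj : Set.InjOn (insert a) (powersetCard M V : Set (Finset ℕ)) := by
    intro P hP Q hQ h
    have hP := (Finset.mem_powersetCard.mp hP).1
    have hQ := (Finset.mem_powersetCard.mp hQ).1
    rw [← Finset.erase_insert (fun h => ha (hP h) : a ∉ P), h,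
      Finset.erase_insert (fun h => ha (hQ h) : a ∉ Q)]
  rw [raise, Finset.powersetCard_succ_insert ha, Finset.sum_union hdisj, Finset.sum_image hinj,
    Finset.sum_congr rfl hI, Finset.sum_congr rfl hJ, Finset.sum_sub_distrib,
    Finset.sum_add_distrib, sum_powersetCard_succ_mem M V (fun I i => raiseCoeff V I x *
        (x a / (x a - x i) * ∏ j ∈ I.erase i, x j / (x j - x i)) *
          f (shift q (V \ I.erase i) x)),
    sum_powersetCard_notMem M V (fun J c => raiseCoeff V (insert c J) x * (x a / (x a - x c) *
      ∏ j ∈ (insert c J).erase c, x j / (x j - x c)) *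
        f (shift q (V \ (insert c J).erase c) x)), raise, raise, Finset.mul_sum]
  ring

end RaiseProps

/-! ### `q`-Whittaker polynomials with a given number of rows -/

section WRows
variable {R : Type*} [CommSemiring R]

/-- The next part of a partition. -/
def nextPart {m : ℕ} (l : Fin m → ℕ) (i : Fin m) : ℕ :=
  if h : (i : ℕ) + 1 < m then l ⟨i + 1, h⟩ else 0

/-- The `q`-Whittaker polynomial in `n` variables of a partition with `m` parts. -/
def wRows (q : R) {m : ℕ} : (n : ℕ) → (Fin m → ℕ) → (ℕ → R) → R
  | 0, l, _ => if l = 0 then 1 else 0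
  | n + 1, l, x => ∑ κ ∈ Fintype.piFinset (fun i => Icc (nextPart l i) (l i)),
      x n ^ (∑ i, l i - ∑ i, κ i) * (∏ i, gauss q (l i - nextPart l i) (l i - κ i)) * wRows q n κ x

theorem wRows_zero_rows (q : R) (n : ℕ) (l : Fin 0 → ℕ) (x : ℕ → R) : wRows q n l x = 1 := by
  induction n generalizing l with
  | zero => rw [wRows, if_pos (Subsingleton.elim _ _)]
  | succ n ih =>
    rw [wRows, Fintype.piFinset_of_isEmpty, Fintype.sum_unique, ih]
    simp

theorem sum_piFinset_snoc {n : ℕ} {M : Type*} [AddCommMonoid M] (s : Fin (n + 1) → Finset ℕ)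
    (f : (Fin (n + 1) → ℕ) → M) :
    ∑ r ∈ Fintype.piFinset s, f r =
      ∑ r ∈ Fintype.piFinset (fun i : Fin n => s i.castSucc), ∑ a ∈ s (Fin.last n),
        f (Fin.snoc (α := fun _ => ℕ) r a) := by
  rw [← Finset.sum_product']
  refine Finset.sum_bij' (fun r _ => (fun i => r i.castSucc, r (Fin.last n)))
    (fun p _ => Fin.snoc (α := fun _ => ℕ) p.1 p.2) ?_ ?_ ?_ ?_ ?_
  · intro r hr
    rw [Fintype.mem_piFinset] at hr
    simp only [Finset.mem_product, Fintype.mem_piFinset]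
    exact ⟨fun i => hr i.castSucc, hr _⟩
  · intro p hp
    simp only [Finset.mem_product, Fintype.mem_piFinset] at hp
    rw [Fintype.mem_piFinset]
    intro i
    refine Fin.lastCases ?_ (fun i => ?_) i
    · rw [Fin.snoc_last]; exact hp.2
    · rw [Fin.snoc_castSucc]; exact hp.1 i
  · intro r _; exact Fin.snoc_init_self r
  · intro p _; simp
  · intro r _
    exact congrArg f (Fin.snoc_init_self r).symm

theorem nextPart_castSucc {M : ℕ} (l : Fin (M + 1) → ℕ) (i : Fin M) :
    nextPart l i.castSucc = l i.succ := by
  rw [nextPart, dif_pos (by simp)]; rfl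

theorem nextPart_last {M : ℕ} (l : Fin (M + 1) → ℕ) : nextPart l (Fin.last M) = 0 := by
  rw [nextPart, dif_neg (by simp)]

theorem wRows_succ_snoc (q : R) {M : ℕ} (n : ℕ) (l : Fin M → ℕ) (p : ℕ) (x : ℕ → R) :
    wRows q (n + 1) (Fin.snoc (α := fun _ => ℕ) l p) x =
      ∑ κ ∈ Fintype.piFinset (fun i => Icc (Fin.snoc (α := fun _ => ℕ) l p i.succ) (l i)),
        ∑ c ∈ range (p + 1), x n ^ (∑ i, l i - ∑ i, κ i) * x n ^ (p - c) *
          (∏ i, gauss q (l i - Fin.snoc (α := fun _ => ℕ) l p i.succ) (l i - κ i)) *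
          gauss q p (p - c) * wRows q n (Fin.snoc (α := fun _ => ℕ) κ c) x := by
  rw [wRows, sum_piFinset_snoc]
  simp only [nextPart_castSucc, nextPart_last, Fin.snoc_castSucc, Fin.snoc_last,
    Fin.sum_univ_castSucc, Fin.prod_univ_castSucc, Nat.sub_zero]
  rw [show Icc 0 p = range (p + 1) by ext; simp]
  refine Finset.sum_congr rfl fun κ hκ => Finset.sum_congr rfl fun c hc => ?_
  have hc := Finset.mem_range.mp hc
  have h1 : ∑ i, κ i ≤ ∑ i, l i := Finset.sum_le_sum fun i _ =>
    (Finset.mem_Icc.mp (Fintype.mem_piFinset.mp hκ i)).2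
  rw [show ∑ i, l i + p - (∑ i, κ i + c) = (∑ i, l i - ∑ i, κ i) + (p - c) by omega, pow_add]
  ring

/-- Trailing zeros are irrelevant, so the number `m` of rows may be chosen independently of the
number `n` of variables. -/
theorem wRows_snoc_zero (q : R) {M : ℕ} (n : ℕ) (l : Fin M → ℕ) (x : ℕ → R) :
    wRows q n (Fin.snoc (α := fun _ => ℕ) l 0) x = wRows q n l x := by
  induction n generalizing l with
  | zero =>
    rw [wRows, wRows]
    congr 1
    rw [eq_iff_iff]
    constructor
    · intro h; funext i
      have := congrFun h i.castSucc
      rwa [Fin.snoc_castSucc] at this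
    · rintro rfl; funext i
      refine Fin.lastCases ?_ (fun i => ?_) i <;> simp
  | succ n ih =>
    have h : ∀ i : Fin M, Fin.snoc (α := fun _ => ℕ) l 0 i.succ = nextPart l i := by
      intro i
      rw [nextPart]
      split_ifs with hi
      · rw [show i.succ = Fin.castSucc (⟨i + 1, hi⟩ : Fin M) from rfl, Fin.snoc_castSucc]
      · rw [show i.succ = Fin.last M by ext; simp; omega, Fin.snoc_last]
    rw [wRows_succ_snoc, wRows]
    simp only [h]
    refine Finset.sum_congr rfl fun κ _ => ?_
    rw [zero_add, Finset.sum_range_one, ih]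
    simp

theorem snoc_add_one {M : ℕ} (l : Fin M → ℕ) (p : ℕ) :
    (fun i => Fin.snoc (α := fun _ => ℕ) l p i + 1) =
      Fin.snoc (α := fun _ => ℕ) (fun i => l i + 1) (p + 1) := by
  funext i
  refine Fin.lastCases ?_ (fun i => ?_) i <;> simp

/-- Pascal's rule for the last part: raising `p` by one splits each term into one with `c` raised
and one with an extra `y * q ^ c`. -/
theorem sum_range_pascal (q y : R) (p : ℕ) (w : ℕ → R) :
    ∑ c ∈ range (p + 2), y ^ (p + 1 - c) * gauss q (p + 1) (p + 1 - c) * w c =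
      ∑ c ∈ range (p + 1), y ^ (p - c) * gauss q p (p - c) * (w (c + 1) + y * q ^ c * w c) := by
  have h : ∀ c ∈ range (p + 2), y ^ (p + 1 - c) * gauss q (p + 1) (p + 1 - c) * w c =
      y ^ (p + 1 - c) * gauss q p (p + 1 - c) * w c +
      if c ≤ p then y ^ (p - c) * gauss q p (p - c) * (y * q ^ c * w c) else 0 := by
    intro c hc
    have hc := Finset.mem_range.mp hc
    split_ifs with h
    · rw [show p + 1 - c = (p - c) + 1 by omega, gauss_succ_succ', show p - (p - c) = c by omega,
        pow_succ]
      ring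
    · rw [show p + 1 - c = 0 by omega]; simp
  rw [Finset.sum_congr rfl h, Finset.sum_add_distrib]
  simp only [mul_add, Finset.sum_add_distrib]
  congr 1
  · rw [Finset.sum_range_succ', gauss_eq_zero q (by omega : p < p + 1 - 0)]
    simp only [Nat.add_sub_add_right, mul_zero, zero_mul, add_zero]
  · rw [Finset.sum_range_succ, if_neg (by omega), add_zero]
    exact Finset.sum_congr rfl fun c hc => if_pos (by have := Finset.mem_range.mp hc; omega)

/-- Adding a full column changes no difference of consecutive parts except that the last part grows.
Only its branching coefficient changes, and `sum_range_pascal` splits it according to whether the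
new column keeps full size or loses a box. -/
theorem wRows_succ_add_one (q : R) {M : ℕ} (n : ℕ) (l : Fin M → ℕ) (p : ℕ) (x : ℕ → R) :
    wRows q (n + 1) (fun i => Fin.snoc (α := fun _ => ℕ) l p i + 1) x =
      ∑ κ ∈ Fintype.piFinset (fun i => Icc (Fin.snoc (α := fun _ => ℕ) l p i.succ) (l i)),
        ∑ c ∈ range (p + 1), x n ^ (∑ i, l i - ∑ i, κ i) * x n ^ (p - c) *
          (∏ i, gauss q (l i - Fin.snoc (α := fun _ => ℕ) l p i.succ) (l i - κ i)) *
          gauss q p (p - c) * (wRows q n (fun i => Fin.snoc (α := fun _ => ℕ) κ c i + 1) x +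
            x n * q ^ c * wRows q n (Fin.snoc (α := fun _ => ℕ) (fun i => κ i + 1) c) x) := by
  rw [snoc_add_one, wRows_succ_snoc, ← snoc_add_one]
  symm
  refine Finset.sum_bij' (fun κ _ i => κ i + 1) (fun κ _ i => κ i - 1) ?_ ?_ ?_ ?_ ?_
  · intro κ hκ
    rw [Fintype.mem_piFinset] at hκ ⊢
    intro i
    have := Finset.mem_Icc.mp (hκ i)
    rw [Finset.mem_Icc]
    dsimp only at this ⊢
    omega
  · intro κ hκ
    rw [Fintype.mem_piFinset] at hκ ⊢
    intro i
    have := Finset.mem_Icc.mp (hκ i)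
    rw [Finset.mem_Icc]
    dsimp only at this ⊢
    omega
  · intro κ _; rfl
  · intro κ hκ
    rw [Fintype.mem_piFinset] at hκ
    funext i
    have := Finset.mem_Icc.mp (hκ i)
    dsimp only at this ⊢
    omega
  · intro κ _
    have e1 : ∑ i, (l i + 1) - ∑ i, (κ i + 1) = ∑ i, l i - ∑ i, κ i := by
      rw [Finset.sum_add_distrib, Finset.sum_add_distrib]; omega
    simp only [e1, Nat.add_sub_add_right]
    have := sum_range_pascal q (x n) p
      (fun c => wRows q n (Fin.snoc (α := fun _ => ℕ) (fun i => κ i + 1) c) x)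
    have h2 : ∀ P E : R, ∑ c ∈ range (p + 2), E * x n ^ (p + 1 - c) * P *
        gauss q (p + 1) (p + 1 - c) * wRows q n (Fin.snoc (α := fun _ => ℕ) (fun i => κ i + 1) c) x =
        E * P * ∑ c ∈ range (p + 2), x n ^ (p + 1 - c) *
        gauss q (p + 1) (p + 1 - c) *
          wRows q n (Fin.snoc (α := fun _ => ℕ) (fun i => κ i + 1) c) x := by
      intro P E
      rw [Finset.mul_sum]
      exact Finset.sum_congr rfl fun c _ => by ring
    rw [h2, this, Finset.mul_sum]
    refine Finset.sum_congr rfl fun c _ => ?_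
    rw [snoc_add_one]
    ring

end WRows

/-! ### Raising operators acting on `q`-Whittaker polynomials -/

section Raising
variable {K : Type*} [Field K] {q : K} {x : ℕ → K}

/-- A variable outside `V` is not shifted, so the branching coefficients pass through the operator.
-/
theorem raise_linear {ι : Type*} (s : Finset ι) (c : ι → K) (e : ι → ℕ) (g : ι → (ℕ → K) → K)
    {V : Finset ℕ} {a : ℕ} (ha : a ∉ V) (m : ℕ) (f : (ℕ → K) → K)
    (hf : ∀ y, f y = ∑ k ∈ s, y a ^ e k * c k * g k y) :
    raise q V m f x = ∑ k ∈ s, x a ^ e k * c k * raise q V m (g k) x := by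
  simp only [raise, hf, Finset.mul_sum]
  rw [Finset.sum_comm]
  refine Finset.sum_congr rfl fun k _ => Finset.sum_congr rfl fun I _ => ?_
  rw [show shift q (V \ I) x a = x a by rw [shift, if_neg (by simp [ha])]]
  ring

theorem antitone_of_interlace {m : ℕ} {l κ : Fin m → ℕ}
    (hκ : κ ∈ Fintype.piFinset (fun i => Icc (nextPart l i) (l i))) : Antitone κ := by
  rw [Fintype.mem_piFinset] at hκ
  cases m with
  | zero => exact fun i => i.elim0
  | succ m =>
    rw [Fin.antitone_iff_succ_le]
    intro i
    have h1 := Finset.mem_Icc.mp (hκ i.castSucc)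
    have h2 := Finset.mem_Icc.mp (hκ i.succ)
    rw [nextPart_castSucc] at h1
    omega

/-- The properties of the `q`-Whittaker polynomials in `n` variables that are proved by induction on
the number of variables. -/
def WhittakerRaising (q : K) (n : ℕ) : Prop :=
  ∀ (m : ℕ) (l : Fin m → ℕ), Antitone l → SymmFun q n (wRows q n l) ∧
    Interpolates q (range n) m (wRows q n l) ∧
    ∀ x, Generic q x → wRows q n (fun i => l i + 1) x = raise q (range n) m (wRows q n l) x

/-- An operator of order `M` on a partition with `M + 1` rows. Its full columns are removed one by
one with order `M + 1`, and each passage through `raise_comm` costs a factor `q`, whence `q ^ p`. -/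
theorem raise_lower (n : ℕ) (hn : WhittakerRaising q n) {M : ℕ} (l : Fin M → ℕ) (hl : Antitone l)
    (p : ℕ) (hx : Generic q x) :
    raise q (range n) M (wRows q n (Fin.snoc (α := fun _ => ℕ) (fun i => l i + p) p)) x =
      q ^ p * wRows q n (Fin.snoc (α := fun _ => ℕ) (fun i => l i + p + 1) p) x := by
  induction p generalizing x with
  | zero =>
    rw [raise_congr hx _ _ fun y _ => wRows_snoc_zero q n _ y, wRows_snoc_zero]
    simp only [add_zero, pow_zero, one_mul]
    exact ((hn M l hl).2.2 x hx).symm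
  | succ p ih =>
    have ha : ∀ d : ℕ, d ≤ 1 →
        Antitone (Fin.snoc (α := fun _ => ℕ) (fun i => l i + p + d) p : Fin (M + 1) → ℕ) := by
      intro d _
      have h0 : (Fin.snoc (α := fun _ => ℕ) (fun i => l i + p + d) p : Fin (M + 1) → ℕ) =
          fun i => (Fin.snoc (α := fun _ => ℕ) (fun i => l i + d) 0 : Fin (M + 1) → ℕ) i + p := by
        funext i
        refine Fin.lastCases ?_ (fun i => ?_) i
        · simp
        · simp only [Fin.snoc_castSucc]; ring
      rw [h0]
      intro i j
      refine Fin.lastCases (fun _ => ?_) (fun j => ?_) j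
      · simp
      · refine Fin.lastCases (fun h => ?_) (fun i h => ?_) i
        · exact absurd h (by simp)
        · have := hl (Fin.castSucc_le_castSucc_iff.mp h)
          simp only [Fin.snoc_castSucc]
          omega
    have h1 := (hn (M + 1) _ (ha 0 (by omega))).2.2
    simp only [add_zero, snoc_add_one] at h1
    have h2 := (hn (M + 1) _ (ha 1 (by omega))).2.2
    simp only [snoc_add_one] at h2
    simp only [← add_assoc]
    rw [raise_congr hx _ _ h1, raise_comm hx, raise_congr hx _ _ fun y hy => ih hy, h2 x hx]
    rw [raise, raise, Finset.mul_sum, Finset.mul_sum]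
    refine Finset.sum_congr rfl fun I _ => ?_
    ring

theorem raise_zero_one (n : ℕ) (l l' : Fin 0 → ℕ) :
    wRows q n l x = raise q (range n) 0 (wRows q n l') x := by
  rw [raise, Finset.powersetCard_zero, Finset.sum_singleton, wRows_zero_rows, wRows_zero_rows,
    raiseCoeff]
  simp

/-- `raise_insert` splits the operator in `n + 1` variables into orders `M + 1` and `M` in `n`
variables. Applied to the branching rule of `l`, these give the two terms of `wRows_succ_add_one`:
the first by the induction hypothesis, the second, with its factor `q ^ c`, by `raise_lower`. -/
theorem raising_of_interpolates (n : ℕ) (hn : WhittakerRaising q n) {M : ℕ} (l : Fin (M + 1) → ℕ)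
    (hl : Antitone l) (hI : Interpolates q (range (n + 1)) (M + 1) (wRows q (n + 1) l))
    (hx : Generic q x) :
    wRows q (n + 1) (fun i => l i + 1) x =
      raise q (range (n + 1)) (M + 1) (wRows q (n + 1) l) x := by
  obtain ⟨l', p, rfl⟩ : ∃ (l' : Fin M → ℕ) (p : ℕ), l = Fin.snoc (α := fun _ => ℕ) l' p :=
    ⟨_, _, (Fin.snoc_init_self l).symm⟩
  rw [Finset.range_add_one] at hI ⊢
  rw [raise_insert hx Finset.notMem_range_self M hI, wRows_succ_add_one]
  have hf : ∀ y : ℕ → K, wRows q (n + 1) (Fin.snoc (α := fun _ => ℕ) l' p) y =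
      ∑ k ∈ (Fintype.piFinset fun i : Fin M => Icc (Fin.snoc (α := fun _ => ℕ) l' p i.succ) (l' i)) ×ˢ
        range (p + 1), y n ^ (∑ i, l' i - ∑ i, k.1 i + (p - k.2)) *
          ((∏ i, gauss q (l' i - Fin.snoc (α := fun _ => ℕ) l' p i.succ) (l' i - k.1 i)) *
          gauss q p (p - k.2)) * wRows q n (Fin.snoc (α := fun _ => ℕ) k.1 k.2) y := by
    intro y
    rw [wRows_succ_snoc, Finset.sum_product]
    refine Finset.sum_congr rfl fun κ _ => Finset.sum_congr rfl fun c _ => ?_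
    rw [pow_add]; ring
  rw [raise_linear _ _ _ _ Finset.notMem_range_self (M + 1) _ hf,
    raise_linear _ _ _ _ Finset.notMem_range_self M _ hf, Finset.mul_sum, ← Finset.sum_add_distrib,
    Finset.sum_product]
  refine Finset.sum_congr rfl fun κ hκ => Finset.sum_congr rfl fun c hc => ?_
  have hc := Nat.lt_succ_iff.mp (Finset.mem_range.mp hc)
  rw [Fintype.mem_piFinset] at hκ
  have hκ' : Antitone (Fin.snoc (α := fun _ => ℕ) κ c : Fin (M + 1) → ℕ) := by
    refine antitone_of_interlace (l := Fin.snoc (α := fun _ => ℕ) l' p) ?_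
    rw [Fintype.mem_piFinset]
    intro i
    refine Fin.lastCases ?_ (fun i => ?_) i
    · rw [nextPart_last, Fin.snoc_last, Fin.snoc_last, Finset.mem_Icc]; omega
    · rw [nextPart_castSucc, Fin.snoc_castSucc, Fin.snoc_castSucc]; exact hκ i
  have hκc : ∀ i, c ≤ κ i := by
    intro i
    have := hκ' (Fin.le_last i.castSucc)
    rwa [Fin.snoc_castSucc, Fin.snoc_last] at this
  have e1 := (hn (M + 1) _ hκ').2.2 x hx
  have e2 := raise_lower n hn (fun i => κ i - c) (fun i j hij => by
    have := hκ' (Fin.castSucc_le_castSucc_iff.mpr hij)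
    rw [Fin.snoc_castSucc, Fin.snoc_castSucc] at this
    dsimp only; omega) c hx
  have e3 : (fun i => κ i - c + c) = κ := funext fun i => Nat.sub_add_cancel (hκc i)
  have e4 : (fun i => κ i - c + c + 1) = fun i => κ i + 1 :=
    funext fun i => by rw [Nat.sub_add_cancel (hκc i)]
  rw [e3, e4] at e2
  rw [e1, e2, pow_add]
  ring

/-- The nodes miss at least one variable. By symmetry it may be taken to be the last, and the
branching rule then reduces the claim to `n` variables. -/
theorem interpolates_of_card_lt (n : ℕ) (hn : WhittakerRaising q n) {m : ℕ} (hm : m < n)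
    (l : Fin m → ℕ) (hS : SymmFun q (n + 1) (wRows q (n + 1) l)) :
    Interpolates q (range (n + 1)) m (wRows q (n + 1) l) := by
  have main : ∀ y, Generic q y → ∀ U ⊆ range n, U.card = m + 1 →
      ∑ i ∈ U, (∏ j ∈ U.erase i, y j / (y j - y i)) * wRows q (n + 1) l (shift q {i} y) =
        wRows q (n + 1) l y := by
    intro y hy U hU hc
    simp only [wRows, Finset.mul_sum]
    rw [Finset.sum_comm]
    refine Finset.sum_congr rfl fun κ hκ => ?_
    rw [← (hn m κ (antitone_of_interlace hκ)).2.1 y hy U hU hc, Finset.mul_sum]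
    refine Finset.sum_congr rfl fun i hi => ?_
    have hin := Finset.mem_range.mp (hU hi)
    rw [show shift q {i} y n = y n by rw [shift, if_neg (by simp; omega)]]
    ring
  intro x hx U hU hc
  obtain ⟨a, haV, haU⟩ : ∃ a ∈ range (n + 1), a ∉ U := by
    by_contra! h
    have := Finset.card_le_card (fun a ha => h a ha : range (n + 1) ⊆ U)
    rw [Finset.card_range] at this
    omega
  have haV := Finset.mem_range.mp haV
  set σ := Equiv.swap a n with hσ
  have hU' : U.map σ.toEmbedding ⊆ range n := by
    intro k hk
    obtain ⟨j, hj, rfl⟩ := Finset.mem_map.mp hk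
    have hjn := Finset.mem_range.mp (hU hj)
    have hja : j ≠ a := fun h => haU (h ▸ hj)
    rw [Finset.mem_range, Equiv.coe_toEmbedding, hσ, Equiv.swap_apply_def, if_neg hja]
    split_ifs with h
    · subst h; omega
    · omega
  have := main (x ∘ σ) (hx.comp σ) _ hU' (by rw [Finset.card_map, hc])
  rw [hS x hx a n haV (Nat.lt_succ_self n), Finset.sum_map] at this
  rw [← this]
  refine Finset.sum_congr rfl fun i _ => ?_
  have e1 : (U.map σ.toEmbedding).erase (σ i) = (U.erase i).map σ.toEmbedding := by
    rw [Finset.map_erase]; rfl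
  rw [Equiv.coe_toEmbedding, e1, Finset.prod_map, shift_comp]
  have e2 : ({σ i} : Finset ℕ).map σ.toEmbedding = {i} := by
    rw [Finset.map_singleton, Equiv.coe_toEmbedding, hσ, Equiv.swap_apply_self]
  rw [e2, hS _ (hx.shift _) a n haV (Nat.lt_succ_self n)]
  simp [hσ]

/-- Inside the induction on variables, the partition is built by adding full columns. The raising
formula follows once symmetry and interpolation are known for the smaller partition, and in turn
supplies both for the larger one. -/
theorem whittakerRaising [CharZero K] (q : K) (n : ℕ) : WhittakerRaising q n := by
  induction n with
  | zero =>
    intro m l _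
    refine ⟨fun x _ i j hi => absurd hi (by omega), fun x _ U hU hc => ?_, fun x _ => ?_⟩
    · have := Finset.card_le_card hU
      rw [hc, Finset.range_zero, Finset.card_empty] at this
      omega
    · cases m with
      | zero => exact raise_zero_one 0 _ _
      | succ m =>
        rw [raise, Finset.range_zero, Finset.powersetCard_eq_empty.mpr (by simp), Finset.sum_empty,
          wRows, if_neg]
        intro h
        have := congrFun h 0
        simp at this
  | succ n ih =>
    intro m
    induction m with
    | zero =>
      intro l _
      refine ⟨fun x _ i j _ _ => by rw [wRows_zero_rows, wRows_zero_rows], fun x _ U hU hc => ?_,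
        fun x _ => raise_zero_one _ _ _⟩
      obtain ⟨a, rfl⟩ := Finset.card_eq_one.mp hc
      simp [wRows_zero_rows]
    | succ M ihM =>
      intro l hl
      obtain ⟨l', hl', p, rfl⟩ : ∃ l' : Fin M → ℕ, Antitone l' ∧
          ∃ p, l = fun i => Fin.snoc (α := fun _ => ℕ) l' 0 i + p := by
        refine ⟨fun i => l i.castSucc - l (Fin.last M), fun i j hij => ?_, l (Fin.last M), ?_⟩
        · have := hl (Fin.castSucc_le_castSucc_iff.mpr hij)
          dsimp only; omega
        · funext i
          refine Fin.lastCases ?_ (fun i => ?_) i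
          · simp
          · have := hl (Fin.le_last i.castSucc)
            simp only [Fin.snoc_castSucc]
            omega
      suffices h : SymmFun q (n + 1) (wRows q (n + 1)
            (fun i => Fin.snoc (α := fun _ => ℕ) l' 0 i + p)) ∧
          Interpolates q (range (n + 1)) (M + 1) (wRows q (n + 1)
            (fun i => Fin.snoc (α := fun _ => ℕ) l' 0 i + p)) from
        ⟨h.1, h.2, fun x hx => raising_of_interpolates n ih _ hl h.2 hx⟩
      clear hl
      induction p with
      | zero =>
        have e : wRows q (n + 1) (fun i => Fin.snoc (α := fun _ => ℕ) l' 0 i + 0) =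
            wRows q (n + 1) l' := funext fun x => wRows_snoc_zero q _ l' x
        rw [e]
        exact ⟨(ihM l' hl').1, (ihM l' hl').2.1.succ⟩
      | succ p ihp =>
        have hl : Antitone fun i => Fin.snoc (α := fun _ => ℕ) l' 0 i + p := by
          intro i j
          refine Fin.lastCases (fun _ => ?_) (fun j => ?_) j
          · simp
          · refine Fin.lastCases (fun h => ?_) (fun i h => ?_) i
            · exact absurd h (by simp)
            · have := hl' (Fin.castSucc_le_castSucc_iff.mp h)
              simp only [Fin.snoc_castSucc]
              omega
        have hr : ∀ y, Generic q y →
            wRows q (n + 1) (fun i => Fin.snoc (α := fun _ => ℕ) l' 0 i + (p + 1)) y =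
            raise q (range (n + 1)) (M + 1)
              (wRows q (n + 1) fun i => Fin.snoc (α := fun _ => ℕ) l' 0 i + p) y :=
          fun y hy => raising_of_interpolates n ih _ hl ihp.2 hy
        have hS : SymmFun q (n + 1)
            (wRows q (n + 1) fun i => Fin.snoc (α := fun _ => ℕ) l' 0 i + (p + 1)) := by
          intro x hx i j hi hj
          rw [hr _ (hx.comp _), hr x hx]
          exact ihp.1.raise _ x hx i j hi hj
        refine ⟨hS, ?_⟩
        -- The nodes number `M + 2` out of `n + 1`: some variable is missed, all are used, or there
        -- are no such node sets.
        rcases lt_trichotomy (M + 1) n with h | h | h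
        · exact interpolates_of_card_lt n ih h _ hS
        · have := ihp.2.raise_of_card (by rw [Finset.card_range]; omega)
          intro x hx U hU hc
          rw [hr x hx, ← this x hx U hU hc]
          exact Finset.sum_congr rfl fun i _ => by rw [hr _ (hx.shift _)]
        · intro x hx U hU hc
          have := Finset.card_le_card hU
          rw [Finset.card_range] at this
          omega

end Raising

/-! ### Lists of columns and their energy -/

section Energy

/-- The indicator of membership. -/
def bit (A : Finset ℕ) (k : ℕ) : ℕ := if k ∈ A then 1 else 0

theorem bit_le (A : Finset ℕ) (k : ℕ) : bit A k ≤ 1 := by unfold bit; split_ifs <;> omega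

theorem bit_eq_one {A : Finset ℕ} {k : ℕ} : bit A k = 1 ↔ k ∈ A := by
  unfold bit; split_ifs with h <;> simp [h]

theorem bit_pos {A : Finset ℕ} {k : ℕ} : 1 ≤ bit A k ↔ k ∈ A := by
  unfold bit; split_ifs with h <;> simp [h]

/-- The number of customers waiting after `k` steps in a queue with `u` customers at time `p`,
arrivals at the times in `A` and services at the times in `C`. -/
def load (A C : Finset ℕ) (u p : ℕ) : ℕ → ℕ
  | 0 => u
  | k + 1 => load A C u p k + bit A (p + k) - bit C (p + k)

/-- The number of customers that stay overnight, the day having length `n`. -/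
def wind (n : ℕ) (A C : Finset ℕ) : ℕ := load A C 0 0 n

/-- The services that are used. -/
def img (n : ℕ) (A C : Finset ℕ) : Finset ℕ :=
  C.filter fun k => 1 ≤ load A C (wind n A C) 0 k + bit A k

/-- The total number of windings of a column that is sent through a list of columns. -/
def pass (n : ℕ) : Finset ℕ → List (Finset ℕ) → ℕ
  | _, [] => 0
  | A, C :: l => wind n A C + pass n (img n A C) l

/-- The energy of a list of columns. -/
def energy (n : ℕ) : List (Finset ℕ) → ℕ
  | [] => 0
  | A :: l => energy n l + pass n A l

theorem load_mono (A C : Finset ℕ) {u v : ℕ} (h : u ≤ v) (p k : ℕ) :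
    load A C u p k ≤ load A C v p k := by
  induction k with
  | zero => exact h
  | succ k ih => simp only [load]; omega

/-- If a change at times `i` and `i + 1` has the same net effect after both steps, the queues can
differ only between them, at time `i + 1`. -/
theorem load_eq_of_local {A A' C C' : Finset ℕ} {i : ℕ}
    (h0 : ∀ k, k ≠ i → k ≠ i + 1 → bit A k = bit A' k ∧ bit C k = bit C' k)
    (h2 : ∀ u, u + bit A i - bit C i + bit A (i + 1) - bit C (i + 1) =
      u + bit A' i - bit C' i + bit A' (i + 1) - bit C' (i + 1)) (u k : ℕ) (hk : k ≠ i + 1) :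
    load A C u 0 k = load A' C' u 0 k := by
  induction k using Nat.strong_induction_on with
  | _ k ih =>
    rcases k with _ | k
    · rfl
    rcases eq_or_ne k (i + 1) with rfl | hk'
    · simp only [load, zero_add]
      rw [ih i (by omega) (by omega)]
      exact h2 _
    · simp only [load, zero_add]
      obtain ⟨h3, h4⟩ := h0 k (by omega) hk'
      rw [ih k (by omega) hk', h3, h4]

end Energy

/-! ### Crystal operators -/

section Crystal
variable (i : ℕ)

/-- Exchange of the letters `i` and `i + 1`. -/
def toggle (A : Finset ℕ) : Finset ℕ := A.map (Equiv.swap i (i + 1)).toEmbedding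

theorem mem_toggle {A : Finset ℕ} {k : ℕ} : k ∈ toggle i A ↔ Equiv.swap i (i + 1) k ∈ A := by
  simp [toggle]

theorem bit_toggle (A : Finset ℕ) (k : ℕ) : bit (toggle i A) k = bit A (Equiv.swap i (i + 1) k) := by
  simp only [bit, mem_toggle]

@[simp] theorem toggle_toggle (A : Finset ℕ) : toggle i (toggle i A) = A := by
  ext k; simp [mem_toggle]

@[simp] theorem card_toggle (A : Finset ℕ) : (toggle i A).card = A.card := Finset.card_map _

theorem bit_toggle_left (A : Finset ℕ) : bit (toggle i A) i = bit A (i + 1) := by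
  rw [bit_toggle, Equiv.swap_apply_left]

theorem bit_toggle_right (A : Finset ℕ) : bit (toggle i A) (i + 1) = bit A i := by
  rw [bit_toggle, Equiv.swap_apply_right]

theorem bit_toggle_of_ne (A : Finset ℕ) {k : ℕ} (h1 : k ≠ i) (h2 : k ≠ i + 1) :
    bit (toggle i A) k = bit A k := by
  rw [bit_toggle, Equiv.swap_apply_of_ne_of_ne h1 h2]

/-- Whether `A` contains `i + 1` but not `i`. -/
def epsOne (A : Finset ℕ) : ℕ := bit A (i + 1) - bit A i

/-- Whether `A` contains `i` but not `i + 1`. -/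
def phiOne (A : Finset ℕ) : ℕ := bit A i - bit A (i + 1)

theorem epsOne_toggle (A : Finset ℕ) : epsOne i (toggle i A) = phiOne i A := by
  rw [epsOne, phiOne, bit_toggle_left, bit_toggle_right]

theorem phiOne_toggle (A : Finset ℕ) : phiOne i (toggle i A) = epsOne i A := by
  rw [epsOne, phiOne, bit_toggle_left, bit_toggle_right]

theorem epsOne_phiOne (A : Finset ℕ) : epsOne i A + phiOne i A ≤ 1 := by
  have := bit_le A i
  have := bit_le A (i + 1)
  unfold epsOne phiOne; omega

/-- The number of times that `lower` can be applied. -/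
def phi : List (Finset ℕ) → ℕ
  | [] => 0
  | A :: l => phi l - epsOne i A + phiOne i A

/-- The number of times that `upper` can be applied. -/
def eps : List (Finset ℕ) → ℕ
  | [] => 0
  | A :: l => eps l + (epsOne i A - phi i l)

/-- The lowering operator. -/
def lower : List (Finset ℕ) → List (Finset ℕ)
  | [] => []
  | A :: l => if epsOne i A < phi i l then A :: lower l else toggle i A :: l

/-- The raising operator. -/
def upper : List (Finset ℕ) → List (Finset ℕ)
  | [] => []
  | A :: l => if phi i l < epsOne i A then toggle i A :: l else A :: upper l

/-- The bracketing rule selects one column, and toggling it exchanges its `ε` and `φ`. The same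
column is then selected by `upper`, which undoes the step. -/
theorem lower_spec {b : List (Finset ℕ)} (h : 0 < phi i b) :
    phi i (lower i b) + 1 = phi i b ∧ eps i (lower i b) = eps i b + 1 ∧
      upper i (lower i b) = b := by
  induction b with
  | nil => simp [phi] at h
  | cons A l ih =>
    have h1 := epsOne_phiOne i A
    rw [phi] at h
    rw [lower]
    split_ifs with h2
    · obtain ⟨h3, h4, h5⟩ := ih (by omega)
      refine ⟨by simp only [phi]; omega, by simp only [eps]; omega, ?_⟩
      rw [upper, if_neg (by omega), h5]
    · have h3 := epsOne_toggle i A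
      have h4 := phiOne_toggle i A
      refine ⟨by simp only [phi]; omega, by simp only [eps]; omega, ?_⟩
      rw [upper, if_pos (by omega), toggle_toggle]

theorem upper_spec {b : List (Finset ℕ)} (h : 0 < eps i b) :
    eps i (upper i b) + 1 = eps i b ∧ phi i (upper i b) = phi i b + 1 ∧
      lower i (upper i b) = b := by
  induction b with
  | nil => simp [eps] at h
  | cons A l ih =>
    have h1 := epsOne_phiOne i A
    rw [eps] at h
    rw [upper]
    split_ifs with h2
    · have h3 := epsOne_toggle i A
      have h4 := phiOne_toggle i A
      refine ⟨by simp only [eps]; omega, by simp only [phi]; omega, ?_⟩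
      rw [lower, if_neg (by omega), toggle_toggle]
    · obtain ⟨h3, h4, h5⟩ := ih (by omega)
      refine ⟨by simp only [eps]; omega, by simp only [phi]; omega, ?_⟩
      rw [lower, if_pos (by omega), h5]

/-- Moving an arrival from `i` to `i + 1` is either hidden by the first queue or handed on as the
same move in its output. The condition on `phi` says that the move cannot change a winding number
and that it is inherited by the rest of the list. -/
theorem pass_toggle {n : ℕ} (hi : i + 1 < n) {A : Finset ℕ} (hA : phiOne i A = 1)
    (l : List (Finset ℕ)) (hl : phi i l = 0) : pass n (toggle i A) l = pass n A l := by
  induction l generalizing A with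
  | nil => rfl
  | cons C l ih =>
    have b1 := bit_le C i
    have b2 := bit_le C (i + 1)
    have b3 := bit_le A i
    have b4 := bit_le A (i + 1)
    rw [phiOne] at hA
    rw [phi, phiOne, epsOne] at hl
    have t1 := bit_toggle_left i A
    have t2 := bit_toggle_right i A
    have h0 : ∀ k, k ≠ i → k ≠ i + 1 →
        bit (toggle i A) k = bit A k ∧ bit C k = bit C k :=
      fun k h1 h2 => ⟨bit_toggle_of_ne i A h1 h2, rfl⟩
    have hload := load_eq_of_local (A := toggle i A) (A' := A) (C := C) (C' := C) h0
      (by intro u; rw [t1, t2]; omega)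
    have hw : wind n (toggle i A) C = wind n A C := hload 0 n (by omega)
    have hli := hload (wind n A C) i (by omega)
    have himg : img n (toggle i A) C = img n A C ∨
        (img n (toggle i A) C = toggle i (img n A C) ∧ phiOne i (img n A C) = 1 ∧ phi i l = 0) := by
      have key : ∀ k, k ≠ i → k ≠ i + 1 → (k ∈ img n (toggle i A) C ↔ k ∈ img n A C) := by
        intro k h1 h2
        simp only [img, Finset.mem_filter, hw, hload _ k h2, bit_toggle_of_ne i A h1 h2]
      have m1 : i ∈ img n A C ↔ i ∈ C ∧ 1 ≤ load A C (wind n A C) 0 i + bit A i := by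
        simp [img]
      have m2 : i + 1 ∈ img n A C ↔ i + 1 ∈ C ∧
          1 ≤ load A C (wind n A C) 0 i + bit A i - bit C i + bit A (i + 1) := by
        simp [img, load]
      have m3 : i ∈ img n (toggle i A) C ↔ i ∈ C ∧
          1 ≤ load A C (wind n A C) 0 i + bit A (i + 1) := by
        simp [img, hw, hli, t1]
      have m4 : i + 1 ∈ img n (toggle i A) C ↔ i + 1 ∈ C ∧
          1 ≤ load A C (wind n A C) 0 i + bit A (i + 1) - bit C i + bit A i := by
        simp [img, load, hw, hli, t1, t2]
      rw [← bit_pos (A := C)] at m1 m2 m3 m4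
      -- The move is visible in the output only if time `i` offers a service and nobody is already
      -- waiting.
      by_cases hc : 1 ≤ bit C i ∧ load A C (wind n A C) 0 i = 0
      · right
        refine ⟨?_, ?_, by omega⟩
        · ext k
          rw [mem_toggle]
          rcases eq_or_ne k i with rfl | h1
          · rw [Equiv.swap_apply_left, m3, m2]; omega
          rcases eq_or_ne k (i + 1) with rfl | h2
          · rw [Equiv.swap_apply_right, m4, m1]; omega
          rw [Equiv.swap_apply_of_ne_of_ne h1 h2, key k h1 h2]
        · have e1 : bit (img n A C) i = 1 := bit_eq_one.mpr (m1.mpr (by omega))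
          have e2 : ¬ 1 ≤ bit (img n A C) (i + 1) := by
            rw [bit_pos, m2]; omega
          rw [phiOne]; omega
      · left
        ext k
        rcases eq_or_ne k i with rfl | h1
        · rw [m1, m3]; omega
        rcases eq_or_ne k (i + 1) with rfl | h2
        · rw [m2, m4]; omega
        exact key k h1 h2
    rw [pass, pass, hw]
    rcases himg with h | ⟨h, h', h''⟩
    · rw [h]
    · rw [h, ih h' h'']

/-- Either the operator acts further down the list and induction applies to the output of the first
queue, or it toggles the first service set. In the latter case the output is unchanged or toggled,
and `pass_toggle` handles the rest. -/
theorem pass_lower {n : ℕ} (hi : i + 1 < n) (A : Finset ℕ) (l : List (Finset ℕ))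
    (hl : epsOne i A < phi i l) : pass n A (lower i l) = pass n A l := by
  induction l generalizing A with
  | nil => rfl
  | cons C l ih =>
    have b1 := bit_le C i
    have b2 := bit_le C (i + 1)
    have b3 := bit_le A i
    have b4 := bit_le A (i + 1)
    rw [phi, phiOne] at hl
    have m1 : i ∈ img n A C ↔ i ∈ C ∧ 1 ≤ load A C (wind n A C) 0 i + bit A i := by
      simp [img]
    have m2 : i + 1 ∈ img n A C ↔ i + 1 ∈ C ∧
        1 ≤ load A C (wind n A C) 0 i + bit A i - bit C i + bit A (i + 1) := by
      simp [img, load]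
    rw [← bit_pos, ← bit_pos (A := C)] at m1 m2
    have b5 := bit_le (img n A C) i
    have b6 := bit_le (img n A C) (i + 1)
    rw [lower]
    split_ifs with h2
    · rw [pass, pass, ih]
      rw [epsOne] at hl h2 ⊢
      unfold epsOne at hl
      omega
    · have hφ : phi i l = 0 ∧ bit C i = 1 ∧ bit C (i + 1) = 0 ∧ bit A (i + 1) ≤ bit A i := by
        unfold epsOne at hl h2
        omega
      obtain ⟨f1, f2, f3, f4⟩ := hφ
      have t1 := bit_toggle_left i C
      have t2 := bit_toggle_right i C
      have h0 : ∀ k, k ≠ i → k ≠ i + 1 →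
          bit A k = bit A k ∧ bit (toggle i C) k = bit C k :=
        fun k h1 h2 => ⟨rfl, bit_toggle_of_ne i C h1 h2⟩
      have hload := load_eq_of_local (A := A) (A' := A) (C := toggle i C) (C' := C) h0
        (by intro u; rw [t1, t2]; omega)
      have hw : wind n A (toggle i C) = wind n A C := hload 0 n (by omega)
      have hli := hload (wind n A C) i (by omega)
      have key : ∀ k, k ≠ i → k ≠ i + 1 → (k ∈ img n A (toggle i C) ↔ k ∈ img n A C) := by
        intro k h1 h2
        simp only [img, Finset.mem_filter, hw, hload _ k h2, mem_toggle,
          Equiv.swap_apply_of_ne_of_ne h1 h2]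
      have m3 : i ∈ img n A (toggle i C) ↔ i + 1 ∈ C ∧
          1 ≤ load A C (wind n A C) 0 i + bit A i := by
        simp [img, hw, hli, mem_toggle]
      have m4 : i + 1 ∈ img n A (toggle i C) ↔ i ∈ C ∧
          1 ≤ load A C (wind n A C) 0 i + bit A i - bit C (i + 1) + bit A (i + 1) := by
        simp [img, load, hw, hli, t1, mem_toggle]
      rw [← bit_pos (A := C)] at m3 m4
      rw [pass, pass, hw]
      congr 1
      by_cases hc : 1 ≤ load A C (wind n A C) 0 i + bit A i
      · have himg : img n A (toggle i C) = toggle i (img n A C) := by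
          ext k
          rw [mem_toggle]
          rcases eq_or_ne k i with rfl | h1
          · rw [Equiv.swap_apply_left, m3, ← bit_pos, m2]; omega
          rcases eq_or_ne k (i + 1) with rfl | h2
          · rw [Equiv.swap_apply_right, m4, ← bit_pos, m1]; omega
          rw [Equiv.swap_apply_of_ne_of_ne h1 h2, key k h1 h2]
        rw [himg, pass_toggle i hi _ l f1]
        rw [phiOne]
        omega
      · have himg : img n A (toggle i C) = img n A C := by
          ext k
          rcases eq_or_ne k i with rfl | h1
          · rw [m3, ← bit_pos, m1]; omega
          rcases eq_or_ne k (i + 1) with rfl | h2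
          · rw [m4, ← bit_pos, m2]; omega
          exact key k h1 h2
        rw [himg]

/-- When the operator acts in the tail, `pass_lower` controls the head's windings; when it acts on
the head, `pass_toggle` does. -/
theorem energy_lower {n : ℕ} (hi : i + 1 < n) {b : List (Finset ℕ)} (h : 0 < phi i b) :
    energy n (lower i b) = energy n b := by
  induction b with
  | nil => rfl
  | cons A l ih =>
    have h1 := epsOne_phiOne i A
    rw [phi] at h
    rw [lower]
    split_ifs with h2
    · rw [energy, energy, ih (by omega), pass_lower i hi A l h2]
    · rw [energy, energy, pass_toggle i hi (by omega) l (by omega)]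

theorem phi_append (b t : List (Finset ℕ)) (ht : phi i t = 0) : phi i (b ++ t) = phi i b := by
  induction b with
  | nil => exact ht
  | cons A l ih => rw [List.cons_append, phi, phi, ih]

theorem lower_append {b t : List (Finset ℕ)} (ht : phi i t = 0) (hb : 0 < phi i b) :
    lower i (b ++ t) = lower i b ++ t := by
  induction b with
  | nil => simp [phi] at hb
  | cons A l ih =>
    rw [List.cons_append, lower, lower, phi_append i l t ht]
    split_ifs with h
    · rw [ih (by omega), List.cons_append]
    · rfl

/-- The reflection of the string of a list of columns. -/
def reflect (b : List (Finset ℕ)) : List (Finset ℕ) :=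
  if eps i b ≤ phi i b then (lower i)^[phi i b - eps i b] b else (upper i)^[eps i b - phi i b] b

theorem lower_iterate_spec (k : ℕ) {b : List (Finset ℕ)} (h : k ≤ phi i b) :
    phi i ((lower i)^[k] b) + k = phi i b ∧ eps i ((lower i)^[k] b) = eps i b + k ∧
      (upper i)^[k] ((lower i)^[k] b) = b := by
  induction k with
  | zero => simp
  | succ k ih =>
    obtain ⟨h1, h2, h3⟩ := ih (by omega)
    obtain ⟨h4, h5, h6⟩ := lower_spec i (b := (lower i)^[k] b) (by omega)
    rw [Function.iterate_succ_apply', Function.iterate_succ_apply, h6]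
    exact ⟨by omega, by omega, h3⟩

theorem upper_iterate_spec (k : ℕ) {b : List (Finset ℕ)} (h : k ≤ eps i b) :
    eps i ((upper i)^[k] b) + k = eps i b ∧ phi i ((upper i)^[k] b) = phi i b + k ∧
      (lower i)^[k] ((upper i)^[k] b) = b := by
  induction k with
  | zero => simp
  | succ k ih =>
    obtain ⟨h1, h2, h3⟩ := ih (by omega)
    obtain ⟨h4, h5, h6⟩ := upper_spec i (b := (upper i)^[k] b) (by omega)
    rw [Function.iterate_succ_apply', Function.iterate_succ_apply, h6]
    exact ⟨by omega, by omega, h3⟩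

/-- A list with given `eps` and `phi` is moved along its string to the mirror position, so that
repeating the construction brings it back. -/
theorem reflect_spec (b : List (Finset ℕ)) :
    phi i (reflect i b) = eps i b ∧ eps i (reflect i b) = phi i b ∧ reflect i (reflect i b) = b := by
  by_cases h : eps i b ≤ phi i b
  · obtain ⟨h1, h2, h3⟩ := lower_iterate_spec i (phi i b - eps i b) (b := b) (by omega)
    have e : reflect i b = (lower i)^[phi i b - eps i b] b := if_pos h
    rw [← e] at h1 h2 h3
    refine ⟨by omega, by omega, ?_⟩
    rcases eq_or_lt_of_le h with h' | h'
    · rw [h', Nat.sub_self] at e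
      have : reflect i b = b := e
      rw [this, this]
    · rw [reflect, if_neg (by omega), show eps i (reflect i b) - phi i (reflect i b) =
        phi i b - eps i b by omega, h3]
  · obtain ⟨h1, h2, h3⟩ := upper_iterate_spec i (eps i b - phi i b) (b := b) (by omega)
    have e : reflect i b = (upper i)^[eps i b - phi i b] b := if_neg h
    rw [← e] at h1 h2 h3
    refine ⟨by omega, by omega, ?_⟩
    rw [reflect, if_pos (by omega), show phi i (reflect i b) - eps i (reflect i b) =
        eps i b - phi i b by omega, h3]

/-- A tail with `phi i t = 0` is invisible to lowering operators in front of it, so `energy_lower`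
applies to the whole list. Raising moves are treated as lowering moves read backwards. -/
theorem energy_reflect_append {n : ℕ} (hi : i + 1 < n) (b t : List (Finset ℕ))
    (ht : phi i t = 0) : energy n (reflect i b ++ t) = energy n (b ++ t) := by
  have h1 : ∀ k b, k ≤ phi i b → energy n ((lower i)^[k] b ++ t) = energy n (b ++ t) := by
    intro k b hk
    induction k with
    | zero => rfl
    | succ k ih =>
      obtain ⟨h1, _, _⟩ := lower_iterate_spec i k (b := b) (by omega)
      rw [Function.iterate_succ_apply', ← lower_append i ht (by omega), energy_lower i hi,
        ih (by omega)]
      rw [phi_append i _ t ht]; omega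
  by_cases h : eps i b ≤ phi i b
  · rw [reflect, if_pos h, h1 _ _ (by omega)]
  · obtain ⟨h2, h3, h4⟩ := upper_iterate_spec i (eps i b - phi i b) (b := b) (by omega)
    have h5 := h1 (eps i b - phi i b) ((upper i)^[eps i b - phi i b] b) (by omega)
    rw [reflect, if_neg h, ← h5, h4]

theorem forall₂_reflect (b : List (Finset ℕ)) :
    List.Forall₂ (fun A A' => A' = A ∨ A' = toggle i A) b (reflect i b) := by
  have hr : ∀ b : List (Finset ℕ), List.Forall₂ (fun A A' => A' = A ∨ A' = toggle i A) b b := by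
    intro b
    induction b with
    | nil => exact List.Forall₂.nil
    | cons A l ih => exact List.Forall₂.cons (Or.inl rfl) ih
  have htr : ∀ b c d : List (Finset ℕ), List.Forall₂ (fun A A' => A' = A ∨ A' = toggle i A) b c →
      List.Forall₂ (fun A A' => A' = A ∨ A' = toggle i A) c d →
      List.Forall₂ (fun A A' => A' = A ∨ A' = toggle i A) b d := by
    intro b
    induction b with
    | nil => rintro c d ⟨⟩ ⟨⟩; exact List.Forall₂.nil
    | cons A l ih =>
      rintro c d (_ | ⟨h1, h2⟩) (_ | ⟨h3, h4⟩)
      refine List.Forall₂.cons ?_ (ih _ _ h2 h4)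
      rcases h1 with rfl | rfl <;> rcases h3 with rfl | rfl <;> simp
  have hl : ∀ b : List (Finset ℕ),
      List.Forall₂ (fun A A' => A' = A ∨ A' = toggle i A) b (lower i b) := by
    intro b
    induction b with
    | nil => exact List.Forall₂.nil
    | cons A l ih =>
      rw [lower]; split_ifs
      · exact List.Forall₂.cons (Or.inl rfl) ih
      · exact List.Forall₂.cons (Or.inr rfl) (hr l)
  have hu : ∀ b : List (Finset ℕ),
      List.Forall₂ (fun A A' => A' = A ∨ A' = toggle i A) b (upper i b) := by
    intro b
    induction b with
    | nil => exact List.Forall₂.nil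
    | cons A l ih =>
      rw [upper]; split_ifs
      · exact List.Forall₂.cons (Or.inr rfl) (hr l)
      · exact List.Forall₂.cons (Or.inl rfl) ih
  have hit : ∀ (g : List (Finset ℕ) → List (Finset ℕ)),
      (∀ b, List.Forall₂ (fun A A' => A' = A ∨ A' = toggle i A) b (g b)) → ∀ k,
      List.Forall₂ (fun A A' => A' = A ∨ A' = toggle i A) b (g^[k] b) := by
    intro g hg k
    induction k with
    | zero => exact hr b
    | succ k ih =>
      rw [Function.iterate_succ_apply']
      exact htr _ _ _ ih (hg _)
  rw [reflect]
  split_ifs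
  · exact hit _ hl _
  · exact hit _ hu _

end Crystal

/-! ### Weights -/

section Weight

/-- The number of columns that contain the letter `j`. -/
def wt : List (Finset ℕ) → ℕ → ℕ
  | [], _ => 0
  | A :: l, j => bit A j + wt l j

theorem wt_append (b t : List (Finset ℕ)) (j : ℕ) : wt (b ++ t) j = wt b j + wt t j := by
  induction b with
  | nil => simp [wt]
  | cons A l ih => rw [List.cons_append, wt, wt, ih]; ring

/-- Cancelling a bracket removes one letter of each kind, so `phi - eps` is the difference of their
multiplicities. -/
theorem phi_add_wt (i : ℕ) (b : List (Finset ℕ)) :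
    phi i b + wt b (i + 1) = eps i b + wt b i := by
  induction b with
  | nil => simp [phi, eps, wt]
  | cons A l ih =>
    have := bit_le A i
    have := bit_le A (i + 1)
    simp only [phi, eps, wt, epsOne, phiOne]
    omega

theorem wt_reflect (i : ℕ) (b : List (Finset ℕ)) (j : ℕ) :
    wt (reflect i b) j = wt b (Equiv.swap i (i + 1) j) := by
  have h1 : ∀ b c : List (Finset ℕ), List.Forall₂ (fun A A' => A' = A ∨ A' = toggle i A) b c →
      wt c i + wt c (i + 1) = wt b i + wt b (i + 1) ∧
      ∀ j, j ≠ i → j ≠ i + 1 → wt c j = wt b j := by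
    intro b c h
    induction h with
    | nil => simp
    | cons h _ ih =>
      obtain ⟨h1, h2⟩ := ih
      rcases h with rfl | rfl
      · refine ⟨by simp only [wt]; omega, fun j hj hj' => by simp only [wt, h2 j hj hj']⟩
      · refine ⟨?_, fun j hj hj' => by simp only [wt, h2 j hj hj', bit_toggle_of_ne i _ hj hj']⟩
        simp only [wt, bit_toggle_left, bit_toggle_right]; omega
  obtain ⟨h2, h3⟩ := h1 _ _ (forall₂_reflect i b)
  obtain ⟨h4, h5, _⟩ := reflect_spec i b
  have h6 := phi_add_wt i b
  have h7 := phi_add_wt i (reflect i b)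
  rcases eq_or_ne j i with rfl | hj
  · rw [Equiv.swap_apply_left]; omega
  rcases eq_or_ne j (i + 1) with rfl | hj'
  · rw [Equiv.swap_apply_right]; omega
  rw [Equiv.swap_apply_of_ne_of_ne hj hj', h3 j hj hj']

end Weight

/-! ### Rotation of the cyclic time -/

section Rotation

/-- The number of elements below `k`. -/
def below (A : Finset ℕ) (k : ℕ) : ℕ := ∑ j ∈ range k, bit A j

theorem below_succ (A : Finset ℕ) (k : ℕ) : below A (k + 1) = below A k + bit A k :=
  sum_range_succ _ _

theorem below_eq_card {n : ℕ} {A : Finset ℕ} (hA : A ⊆ range n) : below A n = A.card := by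
  rw [below, card_eq_sum_ones, ← sum_subset hA]
  · exact sum_congr rfl fun j hj => bit_eq_one.mpr hj
  · intro j _ hj
    exact if_neg hj

theorem load_add (A C : Finset ℕ) (u p j k : ℕ) :
    load A C u p (j + k) = load A C (load A C u p j) (p + j) k := by
  induction k with
  | zero => rfl
  | succ k ih => rw [← add_assoc, load, ih, load, ← add_assoc]

/-- Lindley's formula. -/
theorem load_eq_max (A C : Finset ℕ) (u k : ℕ) :
    load A C u 0 k = max (load A C 0 0 k) (u + below A k - below C k) := by
  induction k with
  | zero => simp [load, below]
  | succ k ih =>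
    simp only [load, below_succ, zero_add]
    have h1 := bit_le A k
    have h2 := bit_le C k
    have h3 : below A k ≤ load A C 0 0 k + below C k := by
      clear ih h1 h2
      induction k with
      | zero => simp [below]
      | succ k ih =>
        simp only [load, below_succ, zero_add]; omega
    omega

/-- When services are at least as numerous as arrivals, Lindley's formula shows that the overnight
queue reproduces itself the next day. -/
theorem load_wind {n : ℕ} {A C : Finset ℕ} (h : below A n ≤ below C n) :
    load A C (wind n A C) 0 n = wind n A C := by
  rw [load_eq_max, ← wind]
  omega

theorem bit_img {n : ℕ} {A C : Finset ℕ} (k : ℕ) :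
    load A C (wind n A C) 0 (k + 1) + bit (img n A C) k =
      load A C (wind n A C) 0 k + bit A k := by
  have h := bit_pos (A := img n A C) (k := k)
  rw [img, mem_filter, ← bit_pos, ← img] at h
  have h1 := bit_le (img n A C) k
  have h2 := bit_le C k
  simp only [load, zero_add]
  omega

theorem load_add_below_img (n : ℕ) (A C : Finset ℕ) (k : ℕ) :
    load A C (wind n A C) 0 k + below (img n A C) k = wind n A C + below A k := by
  induction k with
  | zero => simp [load, below]
  | succ k ih =>
    have := bit_img (n := n) (A := A) (C := C) k
    simp only [below_succ]
    omega

theorem img_subset (n : ℕ) (A C : Finset ℕ) : img n A C ⊆ C := filter_subset _ _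

theorem below_img {n : ℕ} {A C : Finset ℕ} (h : below A n ≤ below C n) :
    below (img n A C) n = below A n := by
  have := load_add_below_img n A C n
  rw [load_wind h] at this
  omega

/-- The set of times, read from a clock that shows `0` at time `m`, in a day of length `n`. -/
def rot (n m : ℕ) (A : Finset ℕ) : Finset ℕ :=
  (range n).filter fun k => (if k + m < n then k + m else k + m - n) ∈ A

theorem rot_subset (n m : ℕ) (A : Finset ℕ) : rot n m A ⊆ range n := filter_subset _ _

variable {n m : ℕ}

theorem bit_rot_left (A : Finset ℕ) {k : ℕ} (hk : k + m < n) :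
    bit (rot n m A) k = bit A (m + k) := by
  rw [add_comm m k]
  unfold bit rot
  simp [hk, show k < n by omega]

theorem bit_rot_right (A : Finset ℕ) {k : ℕ} (hm : m ≤ n) (hk : k < m) :
    bit (rot n m A) (n - m + k) = bit A k := by
  unfold bit rot
  simp [show ¬ (n - m + k + m < n) by omega, show n - m + k < n by omega,
    show n - m + k + m - n = k by omega]

theorem below_rot (hm : m ≤ n) (A : Finset ℕ) : below (rot n m A) n = below A n := by
  obtain ⟨d, rfl⟩ := Nat.exists_eq_add_of_le' hm
  unfold below
  have e : ∑ j ∈ range (d + m), bit A j =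
      ∑ j ∈ range m, bit A j + ∑ j ∈ range d, bit A (m + j) := by
    rw [add_comm d m, sum_range_add]
  rw [e, sum_range_add, add_comm]
  congr 1
  · refine sum_congr rfl fun k hk => ?_
    have := bit_rot_right (n := d + m) (m := m) A (by omega) (mem_range.mp hk)
    rwa [Nat.add_sub_cancel] at this
  · exact sum_congr rfl fun k hk => bit_rot_left A (by have := mem_range.mp hk; omega)

theorem rot_rot (hm : m ≤ n) {A : Finset ℕ} (hA : A ⊆ range n) :
    rot n (n - m) (rot n m A) = A := by
  ext k
  simp only [rot, mem_filter, mem_range]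
  constructor
  · rintro ⟨h1, h2, h3⟩
    split_ifs at h3 <;> first | omega | (convert h3 using 1; omega)
  · intro hk
    have hk' := mem_range.mp (hA hk)
    refine ⟨hk', ?_, ?_⟩
    · split_ifs <;> omega
    · split_ifs <;> first | omega | (convert hk using 1; omega)

theorem card_rot (hm : m ≤ n) {A : Finset ℕ} (hA : A ⊆ range n) :
    (rot n m A).card = A.card := by
  rw [← below_eq_card (rot_subset n m A), below_rot hm, below_eq_card hA]

theorem load_rot_left (A C : Finset ℕ) (u : ℕ) {k : ℕ} (hk : k + m ≤ n) :
    load (rot n m A) (rot n m C) u 0 k = load A C u m k := by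
  induction k with
  | zero => rfl
  | succ k ih =>
    simp only [load, zero_add]
    rw [ih (by omega), bit_rot_left A (by omega), bit_rot_left C (by omega)]

theorem load_rot_right (A C : Finset ℕ) (u : ℕ) (hm : m ≤ n) {k : ℕ} (hk : k ≤ m) :
    load (rot n m A) (rot n m C) u (n - m) k = load A C u 0 k := by
  induction k with
  | zero => rfl
  | succ k ih =>
    simp only [load, zero_add]
    rw [ih (by omega), bit_rot_right A hm (by omega), bit_rot_right C hm (by omega)]

theorem load_rot (A C : Finset ℕ) (u : ℕ) (hm : m ≤ n) :
    load (rot n m A) (rot n m C) u 0 n = load A C (load A C u m (n - m)) 0 m := by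
  obtain ⟨d, rfl⟩ := Nat.exists_eq_add_of_le' hm
  have h := load_rot_right A C (load A C u m d) hm le_rfl
  rw [load_add, load_rot_left A C u le_rfl, zero_add, Nat.add_sub_cancel]
  rwa [Nat.add_sub_cancel] at h

theorem load_split (A C : Finset ℕ) (u : ℕ) (hm : m ≤ n) :
    load A C u 0 n = load A C (load A C u 0 m) m (n - m) := by
  obtain ⟨d, rfl⟩ := Nat.exists_eq_add_of_le hm
  rw [load_add, zero_add, Nat.add_sub_cancel_left]

/-- The overnight load is the least load that reproduces itself after a day. Loads that repeat daily
correspond under a change of the clock's origin, and monotonicity carries minimality over in both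
directions. -/
theorem wind_rot (hm : m ≤ n) {A C : Finset ℕ} (h : below A n ≤ below C n) :
    wind n (rot n m A) (rot n m C) = load A C (wind n A C) 0 m := by
  have h' : below (rot n m A) n ≤ below (rot n m C) n := by rwa [below_rot hm, below_rot hm]
  have hfix := load_wind h
  have hfix' := load_wind h'
  apply le_antisymm
  · have h1 : load (rot n m A) (rot n m C) (load A C (wind n A C) 0 m) 0 n =
        load A C (wind n A C) 0 m := by
      rw [load_rot A C _ hm, ← load_split A C _ hm, hfix]
    rw [← h1]
    exact load_mono _ _ (Nat.zero_le _) _ _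
  · set v := load A C (wind n (rot n m A) (rot n m C)) m (n - m) with hv
    have h1 : load A C v 0 m = wind n (rot n m A) (rot n m C) := by
      rw [hv, ← load_rot A C _ hm, hfix']
    have h2 : load A C v 0 n = v := by rw [load_split A C v hm, h1]
    rw [← h1]
    refine load_mono _ _ ?_ _ _
    rw [← h2]
    exact load_mono _ _ (Nat.zero_le _) _ _

theorem img_rot (hm : m ≤ n) {A C : Finset ℕ} (h : below A n ≤ below C n) :
    img n (rot n m A) (rot n m C) = rot n m (img n A C) := by
  ext k
  by_cases hk : k < n
  swap
  · constructor <;> intro h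
    · exact absurd (mem_range.mp (rot_subset _ _ _ (img_subset _ _ _ h))) hk
    · exact absurd (mem_range.mp (rot_subset _ _ _ h)) hk
  rw [img, mem_filter, wind_rot hm h]
  simp only [← bit_pos]
  by_cases hkm : k + m < n
  · rw [bit_rot_left C hkm, bit_rot_left A hkm, bit_rot_left _ hkm,
      load_rot_left A C _ hkm.le]
    have e : load A C (load A C (wind n A C) 0 m) m k = load A C (wind n A C) 0 (m + k) := by
      rw [load_add, zero_add]
    rw [e, bit_pos, bit_pos, img, mem_filter]
  · obtain ⟨j, rfl⟩ : ∃ j, k = n - m + j := ⟨k - (n - m), by omega⟩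
    have hj : j < m := by omega
    rw [bit_rot_right C hm hj, bit_rot_right A hm hj, bit_rot_right _ hm hj, load_add,
      load_rot_left A C _ (by omega), ← load_split A C _ hm, load_wind h, zero_add,
      load_rot_right A C _ hm hj.le, bit_pos, bit_pos, img, mem_filter]

/-- With services at all times before `m` and none later, nobody waits until `m`, and everyone
arriving afterwards stays overnight. -/
theorem wind_range (hm : m ≤ n) (X : Finset ℕ) :
    wind n X (range m) + below X m = below X n := by
  obtain ⟨d, rfl⟩ := Nat.exists_eq_add_of_le hm
  have h1 : ∀ k, k ≤ m → load X (range m) 0 0 k = 0 := by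
    intro k
    induction k with
    | zero => intro _; rfl
    | succ k ih =>
      intro hk
      have h1 := bit_le X k
      have h2 : bit (range m) k = 1 := bit_eq_one.mpr (mem_range.mpr hk)
      simp only [load, zero_add, ih (by omega)]
      omega
  have h2 : ∀ d, load X (range m) 0 0 (m + d) + below X m = below X (m + d) := by
    intro d
    induction d with
    | zero => rw [add_zero, h1 m le_rfl, zero_add]
    | succ d ih =>
      have h2 : bit (range m) (m + d) = 0 := by simp [bit]
      rw [← add_assoc, below_succ, ← ih]
      simp only [load, zero_add, h2]
      omega
  exact h2 d

/-- Rotating a queue changes its winding number by the difference of the loads at times `0` and `m`.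
By conservation this is the change of `below` between input and output, so the differences telescope
along the list. -/
theorem pass_append_range (hm : m ≤ n) {A : Finset ℕ} {l : List (Finset ℕ)}
    (hl : ∀ C ∈ l, below A n ≤ below C n) :
    pass n A (l ++ [range m]) + below A m =
      pass n (rot n m A) (l.map (rot n m)) + below A n := by
  induction l generalizing A with
  | nil =>
    have := wind_range hm A
    simp only [List.nil_append, pass, List.map_nil]
    omega
  | cons C l ih =>
    have hC := hl C (by simp)
    have h1 := ih (A := img n A C) (by
      intro D hD
      rw [below_img hC]
      exact hl D (by simp [hD]))
    have h2 := load_add_below_img n A C m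
    rw [List.cons_append, List.map_cons, pass, pass, img_rot hm hC, wind_rot hm hC]
    rw [below_img hC] at h1
    omega

theorem below_add_sum_Ico (hm : m ≤ n) (A : Finset ℕ) :
    below A m + ∑ j ∈ Ico m n, bit A j = below A n := by
  unfold below
  exact sum_range_add_sum_Ico _ hm

theorem energy_append_range (hm : m ≤ n) {l : List (Finset ℕ)}
    (hl : l.Pairwise fun A C => below A n ≤ below C n) :
    energy n (l ++ [range m]) =
      energy n (l.map (rot n m)) + ∑ j ∈ Ico m n, wt l j := by
  induction l with
  | nil => simp [energy, pass, wt]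
  | cons A l ih =>
    rw [List.pairwise_cons] at hl
    have h1 := pass_append_range hm hl.1
    have h2 := below_add_sum_Ico hm A
    rw [List.cons_append, energy, ih hl.2, List.map_cons, energy]
    simp only [wt, sum_add_distrib]
    omega

end Rotation

/-! ### Configurations of columns -/

section Configurations
variable {n : ℕ}

/-- The lists of subsets of `range n` with prescribed cardinalities. -/
def cfg (n : ℕ) : List ℕ → Finset (List (Finset ℕ))
  | [] => {[]}
  | h :: hs => (powersetCard h (range n) ×ˢ cfg n hs).image fun p => p.1 :: p.2

theorem mem_cfg {hs : List ℕ} {b : List (Finset ℕ)} :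
    b ∈ cfg n hs ↔ List.Forall₂ (fun A h => A ∈ powersetCard h (range n)) b hs := by
  induction hs generalizing b with
  | nil => simp [cfg]
  | cons h hs ih =>
    simp only [cfg, mem_image, mem_product, Prod.exists, List.forall₂_cons_right_iff]
    constructor
    · rintro ⟨A, l, ⟨h1, h2⟩, rfl⟩
      exact ⟨A, l, h1, ih.mp h2, rfl⟩
    · rintro ⟨A, l, h1, h2, rfl⟩
      exact ⟨A, l, ⟨h1, ih.mpr h2⟩, rfl⟩

theorem sum_cfg_cons {M : Type*} [AddCommMonoid M] (h : ℕ) (hs : List ℕ)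
    (f : List (Finset ℕ) → M) :
    ∑ b ∈ cfg n (h :: hs), f b =
      ∑ A ∈ powersetCard h (range n), ∑ b ∈ cfg n hs, f (A :: b) := by
  rw [cfg, sum_image, sum_product]
  rintro ⟨A, l⟩ _ ⟨A', l'⟩ _ h
  simp only [List.cons.injEq] at h
  exact Prod.ext h.1 h.2

theorem sum_cfg_append {M : Type*} [AddCommMonoid M] (hs hs' : List ℕ)
    (f : List (Finset ℕ) → M) :
    ∑ b ∈ cfg n (hs ++ hs'), f b = ∑ b ∈ cfg n hs, ∑ b' ∈ cfg n hs', f (b ++ b') := by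
  induction hs generalizing f with
  | nil => simp [cfg]
  | cons h hs ih =>
    rw [List.cons_append, sum_cfg_cons, sum_cfg_cons]
    exact sum_congr rfl fun A _ => ih fun b => f (A :: b)

theorem reflect_mem_cfg {i : ℕ} (hi : i + 1 < n) {hs : List ℕ} {b : List (Finset ℕ)}
    (hb : b ∈ cfg n hs) : reflect i b ∈ cfg n hs := by
  have h := forall₂_reflect i b
  generalize reflect i b = c at h
  rw [mem_cfg] at hb ⊢
  induction hb generalizing c with
  | nil => cases h; exact List.Forall₂.nil
  | cons h1 h2 ih =>
    cases h with
    | cons h3 h4 =>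
      refine List.Forall₂.cons ?_ (ih _ h4)
      rcases h3 with rfl | rfl
      · exact h1
      · rw [mem_powersetCard] at h1 ⊢
        refine ⟨fun k hk => ?_, by rw [card_toggle, h1.2]⟩
        rw [mem_toggle] at hk
        have := mem_range.mp (h1.1 hk)
        rw [mem_range]
        rcases eq_or_ne k i with rfl | hk1
        · omega
        rcases eq_or_ne k (i + 1) with rfl | hk2
        · omega
        rwa [Equiv.swap_apply_of_ne_of_ne hk1 hk2] at this

theorem map_rot_mem_cfg {m : ℕ} (hm : m ≤ n) {hs : List ℕ} {b : List (Finset ℕ)}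
    (hb : b ∈ cfg n hs) : b.map (rot n m) ∈ cfg n hs := by
  rw [mem_cfg] at hb ⊢
  induction hb with
  | nil => exact List.Forall₂.nil
  | cons h _ ih =>
    refine List.Forall₂.cons ?_ ih
    rw [mem_powersetCard] at h ⊢
    exact ⟨rot_subset _ _ _, by rw [card_rot hm h.1, h.2]⟩

theorem map_rot_map_rot {m : ℕ} (hm : m ≤ n) {hs : List ℕ} {b : List (Finset ℕ)}
    (hb : b ∈ cfg n hs) : (b.map (rot n m)).map (rot n (n - m)) = b := by
  rw [mem_cfg] at hb
  induction hb with
  | nil => rfl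
  | cons h _ ih =>
    rw [List.map_cons, List.map_cons, ih, rot_rot hm (mem_powersetCard.mp h).1]

theorem pairwise_of_mem_cfg {hs : List ℕ} (hs' : hs.Pairwise (· ≤ ·)) {b : List (Finset ℕ)}
    (hb : b ∈ cfg n hs) : b.Pairwise fun A C => below A n ≤ below C n := by
  rw [mem_cfg] at hb
  induction hb with
  | nil => exact List.Pairwise.nil
  | @cons A h l hs h1 h2 ih =>
    rw [List.pairwise_cons] at hs' ⊢
    refine ⟨fun C hC => ?_, ih hs'.2⟩
    clear ih
    rw [mem_powersetCard] at h1
    rw [below_eq_card h1.1, h1.2]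
    have hs1 := hs'.1
    clear hs'
    induction h2 with
    | nil => simp at hC
    | @cons D h' l hs h3 h4 ih =>
      rcases List.mem_cons.mp hC with rfl | hC
      · rw [mem_powersetCard] at h3
        rw [below_eq_card h3.1, h3.2]
        exact hs1 _ (by simp)
      · exact ih hC fun a ha => hs1 a (by simp [ha])

theorem wt_map_rot_left {m : ℕ} (l : List (Finset ℕ)) {k : ℕ} (hk : k + m < n) :
    wt (l.map (rot n m)) k = wt l (m + k) := by
  induction l with
  | nil => rfl
  | cons A l ih => rw [List.map_cons, wt, wt, ih, bit_rot_left A hk]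

theorem wt_map_rot_right {m : ℕ} (hm : m ≤ n) (l : List (Finset ℕ)) {k : ℕ} (hk : k < m) :
    wt (l.map (rot n m)) (n - m + k) = wt l k := by
  induction l with
  | nil => rfl
  | cons A l ih => rw [List.map_cons, wt, wt, ih, bit_rot_right A hm hk]

end Configurations


/-! ### Alternants -/

section Alternants

variable {R : Type u} [CommRing R] {n : ℕ}

/-- The alternant with exponents `α`. -/
def altern (x : Fin n → R) (α : ℕ → ℕ) : R :=
  Matrix.det (Matrix.of fun i j : Fin n => x i ^ α j)

theorem altern_eq_sum (x : Fin n → R) (α : ℕ → ℕ) :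
    altern x α = ∑ s : Equiv.Perm (Fin n), ((Equiv.Perm.sign s : ℤ) : R) *
      ∏ j : Fin n, x (s j) ^ α j := by
  rw [altern, Matrix.det_apply']
  rfl

theorem altern_congr (x : Fin n → R) {α β : ℕ → ℕ} (h : ∀ j < n, α j = β j) :
    altern x α = altern x β := by
  unfold altern
  congr 1
  ext i j
  simp [h j j.2]

theorem altern_comp (x : Fin n → R) (s : Equiv.Perm (Fin n)) (α : ℕ → ℕ) :
    altern (x ∘ s) α = ((Equiv.Perm.sign s : ℤ) : R) * altern x α :=
  Matrix.det_permute s (Matrix.of fun i j : Fin n => x i ^ α j)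

theorem val_swap {i : ℕ} (hi : i + 1 < n) (j : Fin n) :
    ((Equiv.swap (⟨i, by omega⟩ : Fin n) ⟨i + 1, hi⟩ j : Fin n) : ℕ) =
      Equiv.swap i (i + 1) (j : ℕ) := by
  simp only [Equiv.swap_apply_def, Fin.ext_iff]
  split_ifs <;> rfl

theorem altern_swap (x : Fin n → R) {i : ℕ} (hi : i + 1 < n) (α : ℕ → ℕ) :
    altern x (fun j => α (Equiv.swap i (i + 1) j)) = - altern x α := by
  have h := Matrix.det_permute' (Equiv.swap (⟨i, by omega⟩ : Fin n) ⟨i + 1, hi⟩)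
    (Matrix.of fun i j : Fin n => x i ^ α j)
  rw [Equiv.Perm.sign_swap (by simp [Fin.ext_iff])] at h
  rw [altern, altern]
  simp only [Units.val_neg, Units.val_one, Int.cast_neg, Int.cast_one, neg_mul, one_mul] at h
  rw [← h]
  congr 1
  ext a b
  simp only [Matrix.submatrix_apply, Matrix.of_apply, id, val_swap hi]

/-- The staircase. -/
def rho (n j : ℕ) : ℕ := n - 1 - j

theorem altern_rho (x : Fin n → R) :
    altern x (rho n) = ∏ i : Fin n, ∏ j : Fin n, if i < j then x i - x j else 1 := by
  have h := Matrix.det_projVandermonde (fun _ : Fin n => (1 : R)) x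
  have e : altern x (rho n) = (Matrix.projVandermonde (fun _ : Fin n => (1 : R)) x).det := by
    unfold altern
    congr 1
    ext i j
    rw [Matrix.projVandermonde_apply, Matrix.of_apply, one_pow, one_mul, Fin.val_rev, rho]
    congr 1
    omega
  rw [e, h]
  refine prod_congr rfl fun i _ => ?_
  rw [← prod_filter]
  refine prod_congr ?_ fun j _ => by ring
  ext j
  simp

theorem altern_rho_ne_zero {K : Type u} [Field K] {x : Fin n → K} (hx : Function.Injective x) :
    altern x (rho n) ≠ 0 := by
  rw [altern_rho]
  refine prod_ne_zero_iff.mpr fun i _ => prod_ne_zero_iff.mpr fun j _ => ?_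
  split_ifs with h
  · exact sub_ne_zero.mpr (hx.ne h.ne)
  · exact one_ne_zero

/-- After a power is factored out of the rows, the diagonal blocks are two smaller Vandermonde
matrices. Their product is the full Vandermonde determinant with the differences between the blocks
missing. -/
theorem det_blocks {K : Type u} [Field K] {m k : ℕ} {z : Fin (m + k) → K}
    (hz : Function.Injective z) :
    (Matrix.of fun i j : Fin (m + k) =>
        if ((i : ℕ) < m ↔ (j : ℕ) < m) then z i ^ rho (m + k) j else 0).det =
      altern z (rho (m + k)) * ∏ i : Fin (m + k), ∏ j : Fin (m + k),
        if (i : ℕ) < m ∧ ¬ (j : ℕ) < m then z i / (z i - z j) else 1 := by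
  set M := Matrix.of fun i j : Fin (m + k) =>
        if ((i : ℕ) < m ↔ (j : ℕ) < m) then z i ^ rho (m + k) j else 0 with hM
  have e : M.submatrix finSumFinEquiv finSumFinEquiv = Matrix.fromBlocks
      (Matrix.of fun i j : Fin m => z (Fin.castAdd k i) ^ k * z (Fin.castAdd k i) ^ rho m j) 0 0
      (Matrix.of fun i j : Fin k => z (Fin.natAdd m i) ^ rho k j) := by
    ext (i | i) (j | j)
    · have : rho (m + k) j = k + rho m j := by have := j.2; unfold rho; omega
      simp [hM, this, pow_add]
    · simp [hM]
    · simp [hM]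
    · have : rho (m + k) (m + j) = rho k j := by have := j.2; unfold rho; omega
      simp [hM, this]
  rw [← Matrix.det_submatrix_equiv_self finSumFinEquiv M, e, Matrix.det_fromBlocks_zero₂₁]
  have e1 : (Matrix.of fun i j : Fin m =>
      z (Fin.castAdd k i) ^ k * z (Fin.castAdd k i) ^ rho m j).det =
      (∏ i : Fin m, z (Fin.castAdd k i) ^ k) * altern (fun i => z (Fin.castAdd k i)) (rho m) :=
    Matrix.det_mul_column (fun i : Fin m => z (Fin.castAdd k i) ^ k) _
  have e2 : (Matrix.of fun i j : Fin k => z (Fin.natAdd m i) ^ rho k j).det =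
      altern (fun i => z (Fin.natAdd m i)) (rho k) := rfl
  rw [e1, e2, altern_rho, altern_rho, altern_rho, Fin.prod_univ_add, Fin.prod_univ_add]
  have h1 : ∀ (i : Fin m) (j : Fin k), Fin.castAdd k i < Fin.natAdd m j := by
    intro i j; rw [Fin.lt_def]; simp; omega
  have h2 : ∀ (i : Fin m) (j : Fin k), ¬ Fin.natAdd m j < Fin.castAdd k i := by
    intro i j; rw [Fin.lt_def]; simp; omega
  have h3 : ∀ (i j : Fin m), Fin.castAdd k i < Fin.castAdd k j ↔ i < j :=
    fun i j => Iff.rfl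
  have h4 : ∀ (i j : Fin k), Fin.natAdd m i < Fin.natAdd m j ↔ i < j := by
    intro i j; rw [Fin.lt_def, Fin.lt_def]; simp
  simp only [Fin.prod_univ_add, h1, h2, h3, h4, if_true, if_false, prod_const_one, one_mul,
    mul_one, Fin.val_castAdd, Fin.val_natAdd, Fin.is_lt, not_true, and_false, and_true,
    show ∀ a : Fin k, ¬ (m + (a : ℕ) < m) from fun a => by omega, not_false_iff, false_and]
  rw [prod_mul_distrib]
  have h5 : (∏ i : Fin m, z (Fin.castAdd k i) ^ k) =
      (∏ i : Fin m, ∏ j : Fin k, (z (Fin.castAdd k i) - z (Fin.natAdd m j))) *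
      ∏ i : Fin m, ∏ j : Fin k,
        (z (Fin.castAdd k i) / (z (Fin.castAdd k i) - z (Fin.natAdd m j))) := by
    rw [← prod_mul_distrib]
    refine prod_congr rfl fun i _ => ?_
    rw [← prod_mul_distrib]
    rw [prod_congr rfl fun j _ => mul_div_cancel₀ _
      (sub_ne_zero.mpr (hz.ne (h1 i j).ne))]
    simp
  rw [h5]
  ring

theorem sum_perm_fiber {K : Type u} [Field K] {y : Fin n → K} (hy : Function.Injective y) {m : ℕ}
    (hm : m ≤ n) {I : Finset (Fin n)} (hI : I.card = m) :
    ∑ s : Equiv.Perm (Fin n) with (∀ j : Fin _, s j ∈ I ↔ (j : ℕ) < m),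
        ((Equiv.Perm.sign s : ℤ) : K) * ∏ j : Fin n, y (s j) ^ rho n j =
      altern y (rho n) * ∏ i ∈ I, ∏ j ∈ Iᶜ, y i / (y i - y j) := by
  obtain ⟨k, rfl⟩ := Nat.exists_eq_add_of_le hm
  set M := Matrix.of fun i j : Fin (m + k) =>
    if (i ∈ I ↔ (j : ℕ) < m) then y i ^ rho (m + k) j else 0 with hM
  have e1 : ∑ s : Equiv.Perm (Fin (m + k)) with (∀ j : Fin _, s j ∈ I ↔ (j : ℕ) < m),
        ((Equiv.Perm.sign s : ℤ) : K) * ∏ j, y (s j) ^ rho (m + k) j = M.det := by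
    rw [Matrix.det_apply', sum_filter]
    refine sum_congr rfl fun s _ => ?_
    simp only [hM, Matrix.of_apply]
    rw [prod_ite_zero]
    simp
  -- A permutation carrying the first `m` positions to `I` brings the matrix into block form, up to
  -- its sign.
  obtain ⟨t, ht⟩ : ∃ t : Equiv.Perm (Fin (m + k)), ∀ j, t j ∈ I ↔ (j : ℕ) < m := by
    have hc : Fintype.card {j : Fin (m + k) // (j : ℕ) < m} = Fintype.card {j // j ∈ I} := by
      rw [Fintype.card_coe, hI, Fintype.card_subtype]
      have : (univ.filter fun j : Fin (m + k) => (j : ℕ) < m) =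
          univ.map (Fin.castAddEmb k) := by
        ext j
        simp only [mem_filter, mem_univ, true_and, mem_map, Fin.castAddEmb_apply]
        constructor
        · intro h; exact ⟨⟨j, h⟩, rfl⟩
        · rintro ⟨a, rfl⟩; simp
      rw [this]
      simp
    let e := Fintype.equivOfCardEq hc
    refine ⟨e.extendSubtype, fun j => ⟨fun h => ?_, fun h => e.extendSubtype_mem j h⟩⟩
    by_contra h'
    exact e.extendSubtype_not_mem j h' h
  have hz : Function.Injective (y ∘ t) := hy.comp t.injective
  have e2 := det_blocks hz
  have e3 : M.submatrix t id = Matrix.of fun i j : Fin (m + k) =>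
        if ((i : ℕ) < m ↔ (j : ℕ) < m) then (y ∘ t) i ^ rho (m + k) j else 0 := by
    ext i j
    simp [hM, ht]
  rw [← e3, Matrix.det_permute, altern_comp, mul_assoc] at e2
  have hs : ((Equiv.Perm.sign t : ℤ) : K) ≠ 0 := by
    rcases Int.units_eq_one_or (Equiv.Perm.sign t) with h | h <;> simp [h]
  rw [e1, mul_left_cancel₀ hs e2]
  congr 1
  simp only [← ht, Function.comp]
  rw [Equiv.prod_comp t fun a => ∏ j, if a ∈ I ∧ t j ∉ I then y a / (y a - y (t j)) else 1]
  simp only [fun a => Equiv.prod_comp t fun b => if a ∈ I ∧ b ∉ I then y a / (y a - y b) else 1]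
  rw [← prod_subset (subset_univ I)]
  · refine prod_congr rfl fun i hi => ?_
    rw [← prod_subset (subset_univ Iᶜ)]
    · exact prod_congr rfl fun j hj => if_pos ⟨hi, mem_compl.mp hj⟩
    · intro j _ hj
      exact if_neg fun h => hj (mem_compl.mpr h.2)
  · intro i _ hi
    exact prod_eq_one fun j _ => if_neg fun h => hi h.1

end Alternants

/-! ### The generating function of the energy -/

section GeneratingFunction

variable {R : Type u} [CommRing R] {n : ℕ}

/-- The generating function of the energy of lists of columns. -/
def genZ (q : R) (hs : List ℕ) (x : Fin n → R) : R :=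
  ∑ b ∈ cfg n hs, q ^ energy n b * ∏ j : Fin n, x j ^ wt b j

theorem sum_cfg_reflect {M : Type*} [AddCommMonoid M] {i : ℕ} (hi : i + 1 < n) (hs : List ℕ)
    (f : List (Finset ℕ) → M) : ∑ b ∈ cfg n hs, f (reflect i b) = ∑ b ∈ cfg n hs, f b :=
  sum_nbij' (reflect i) (reflect i) (fun _ hb => reflect_mem_cfg hi hb)
    (fun _ hb => reflect_mem_cfg hi hb) (fun b _ => (reflect_spec i b).2.2)
    (fun b _ => (reflect_spec i b).2.2) fun _ _ => rfl

/-- `reflect` is an involution on configurations that preserves the energy and exchanges two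
multiplicities. -/
theorem genZ_comp_swap (q : R) (hs : List ℕ) (x : Fin n → R) {i : ℕ} (hi : i + 1 < n) :
    genZ q hs (x ∘ Equiv.swap (⟨i, by omega⟩ : Fin n) ⟨i + 1, hi⟩) = genZ q hs x := by
  unfold genZ
  rw [← sum_cfg_reflect hi]
  refine sum_congr rfl fun b _ => ?_
  have h := energy_reflect_append i hi b [] rfl
  rw [List.append_nil, List.append_nil] at h
  rw [h]
  congr 1
  rw [← Equiv.prod_comp (Equiv.swap (⟨i, by omega⟩ : Fin n) ⟨i + 1, hi⟩)]
  refine prod_congr rfl fun j _ => ?_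
  rw [wt_reflect, val_swap hi, Function.comp, Equiv.swap_apply_self, Equiv.swap_apply_self]

theorem genZ_comp (q : R) (hs : List ℕ) (x : Fin n → R) (s : Equiv.Perm (Fin n)) :
    genZ q hs (x ∘ s) = genZ q hs x := by
  obtain _ | n := n
  · congr 1; ext i; exact i.elim0
  have hs' : s ∈ Submonoid.closure
      (Set.range fun i : Fin n => Equiv.swap i.castSucc i.succ) := by
    rw [Equiv.Perm.mclosure_swap_castSucc_succ]; trivial
  induction hs' using Submonoid.closure_induction generalizing x with
  | mem s hs =>
    obtain ⟨i, rfl⟩ := hs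
    exact genZ_comp_swap q _ x (i := i) (by omega)
  | one => rfl
  | mul s t _ _ h1 h2 => rw [Equiv.Perm.coe_mul, ← Function.comp_assoc, h2, h1]

/-- Because `genZ` is symmetric, it can be moved inside the signed sum over permutations and each of
its monomials added to the exponents. -/
theorem altern_mul_genZ (q : R) (hs : List ℕ) (x : Fin n → R) (α : ℕ → ℕ) :
    altern x α * genZ q hs x =
      ∑ b ∈ cfg n hs, q ^ energy n b * altern x fun j => α j + wt b j := by
  have h : altern x α * genZ q hs x = ∑ s : Equiv.Perm (Fin n),
      ((Equiv.Perm.sign s : ℤ) : R) * (∏ j : Fin n, x (s j) ^ α j) * genZ q hs (x ∘ s) := by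
    rw [altern_eq_sum, sum_mul]
    exact sum_congr rfl fun s _ => by rw [genZ_comp]
  rw [h]
  simp only [genZ, mul_sum, altern_eq_sum]
  rw [sum_comm]
  refine sum_congr rfl fun b _ => sum_congr rfl fun s _ => ?_
  simp only [pow_add, prod_mul_distrib, Function.comp]
  ring

/-- The hypotheses on `t` make `rho + wt t` equal at `i` and `i + 1`. Reflecting `b` therefore
exchanges two exponents of the alternant without changing the energy, and the sum equals its
negative. -/
theorem sum_altern_eq_zero {K : Type u} [Field K] [CharZero K] (q : K) (hs : List ℕ)
    (x : Fin n → K) {i : ℕ} (hi : i + 1 < n) {t : List (Finset ℕ)} (h0 : phi i t = 0)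
    (h1 : eps i t = 1) :
    ∑ b ∈ cfg n hs, q ^ energy n (b ++ t) * altern x (fun j => rho n j + wt (b ++ t) j) = 0 := by
  rw [← self_eq_neg, ← sum_neg_distrib]
  conv_lhs => rw [← sum_cfg_reflect hi]
  refine sum_congr rfl fun b _ => ?_
  rw [energy_reflect_append i hi b t h0, ← mul_neg, ← altern_swap x hi]
  congr 1
  apply altern_congr
  intro j hj
  have h2 := phi_add_wt i t
  rw [wt_append, wt_append, wt_reflect]
  rcases eq_or_ne j i with rfl | hji
  · rw [Equiv.swap_apply_left]; unfold rho; omega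
  rcases eq_or_ne j (i + 1) with rfl | hji'
  · rw [Equiv.swap_apply_right]; unfold rho; omega
  rw [Equiv.swap_apply_of_ne_of_ne hji hji']

theorem exists_perm_rot {m : ℕ} (hm : m ≤ n) : ∃ c : Equiv.Perm (Fin n),
    ∀ (l : List (Finset ℕ)) (k : Fin n), wt (l.map (rot n m)) k = wt l (c k) := by
  let f : Fin n → Fin n := fun k =>
    if h : (k : ℕ) + m < n then ⟨k + m, h⟩ else ⟨k + m - n, by omega⟩
  have hf : Function.Injective f := by
    intro a b h
    simp only [f] at h
    split_ifs at h <;> rw [Fin.mk.injEq] at h <;> rw [Fin.ext_iff] <;> omega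
  refine ⟨Equiv.ofBijective f (Finite.injective_iff_bijective.mp hf), fun l k => ?_⟩
  simp only [Equiv.ofBijective_apply, f]
  split_ifs with h
  · rw [wt_map_rot_left l h, add_comm]
  · obtain ⟨j, hj⟩ : ∃ j, (k : ℕ) = n - m + j := ⟨k - (n - m), by omega⟩
    have e : (k : ℕ) + m - n = j := by omega
    simp only [e]
    rw [hj, wt_map_rot_right hm l (by omega)]

/-- Rotating the other columns by `m` trades the energy of the appended initial segment for a factor
`q` for each letter at or above `m`, that is, for a `q`-shift of the corresponding variables.
Symmetry of `genZ` undoes the permutation of variables caused by the rotation. -/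
theorem sum_cfg_append_range (q : R) {hs : List ℕ} (hs' : hs.Pairwise (· ≤ ·)) {m : ℕ}
    (hm : m ≤ n) (y : Fin n → R) :
    ∑ b ∈ cfg n hs, q ^ energy n (b ++ [range m]) * ∏ j : Fin n, y j ^ wt (b ++ [range m]) j =
      (∏ j : Fin n, if (j : ℕ) < m then y j else 1) *
        genZ q hs fun j => if (j : ℕ) < m then y j else q * y j := by
  obtain ⟨c, hc⟩ := exists_perm_rot hm
  rw [← genZ_comp q hs _ c, genZ, mul_sum]
  refine sum_nbij' (fun b => b.map (rot n m)) (fun b => b.map (rot n (n - m)))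
    (fun b hb => map_rot_mem_cfg hm hb) (fun b hb => map_rot_mem_cfg (Nat.sub_le _ _) hb)
    (fun b hb => map_rot_map_rot hm hb) (fun b hb => ?_) (fun b hb => ?_)
  · have := map_rot_map_rot (Nat.sub_le n m) hb
    rwa [Nat.sub_sub_self hm] at this
  · rw [energy_append_range hm (pairwise_of_mem_cfg hs' hb), pow_add]
    simp only [hc, Function.comp]
    rw [Equiv.prod_comp c fun j : Fin n => (if (j : ℕ) < m then y j else q * y j) ^ wt b j]
    have h1 : ∏ j : Fin n, y j ^ wt (b ++ [range m]) j =
        (∏ j : Fin n, y j ^ wt b j) * ∏ j : Fin n, if (j : ℕ) < m then y j else 1 := by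
      rw [← prod_mul_distrib]
      refine prod_congr rfl fun j _ => ?_
      rw [wt_append, pow_add]
      congr 1
      simp only [wt, bit, mem_range, add_zero]
      split_ifs <;> simp
    have h2 : q ^ (∑ j ∈ Ico m n, wt b j) * ∏ j : Fin n, y j ^ wt b j =
        ∏ j : Fin n, (if (j : ℕ) < m then y j else q * y j) ^ wt b j := by
      have h3 : q ^ (∑ j ∈ Ico m n, wt b j) =
          ∏ j : Fin n, if (j : ℕ) < m then 1 else q ^ wt b j := by
        rw [Fin.prod_univ_eq_prod_range (fun j => if j < m then 1 else q ^ wt b j),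
          ← prod_range_mul_prod_Ico _ hm, prod_eq_one, one_mul, ← prod_pow_eq_pow_sum]
        · refine prod_congr rfl fun j hj => ?_
          rw [if_neg (by have := (mem_Ico.mp hj).1; omega)]
        · intro j hj
          rw [if_pos (mem_range.mp hj)]
      rw [h3, ← prod_mul_distrib]
      refine prod_congr rfl fun j _ => ?_
      split_ifs
      · rw [one_mul]
      · rw [mul_pow]
    rw [h1, ← h2]
    ring

theorem cfg_eq_empty_of_lt {m : ℕ} (hm : n < m) (hs hs' : List ℕ) :
    cfg n (hs ++ m :: hs') = ∅ := by
  induction hs with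
  | nil =>
    rw [List.nil_append, cfg, powersetCard_eq_empty.mpr (by rwa [card_range]), empty_product,
      image_empty]
  | cons h hs ih => rw [List.cons_append, cfg, ih, product_empty, image_empty]

/-- Multiplication by the Vandermonde determinant antisymmetrises. Only the last column `range m`
survives, the rotation evaluates its contribution, and grouping permutations by the image `I` of the
first `m` positions recovers the coefficients by `sum_perm_fiber`. -/
theorem genZ_append {K : Type u} [Field K] [CharZero K] (q : K) {hs : List ℕ}
    (hs' : hs.Pairwise (· ≤ ·)) (m : ℕ) {x : Fin n → K} (hx : Function.Injective x) :
    genZ q (hs ++ [m]) x = ∑ I ∈ powersetCard m (univ : Finset (Fin n)),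
      (∏ i ∈ I, x i) * (∏ i ∈ I, ∏ j ∈ Iᶜ, x i / (x i - x j)) *
        genZ q hs fun i => if i ∈ I then x i else q * x i := by
  rcases lt_or_ge n m with hm | hm
  · rw [powersetCard_eq_empty.mpr (by simpa using hm), sum_empty, genZ,
      cfg_eq_empty_of_lt hm, sum_empty]
  apply mul_left_cancel₀ (altern_rho_ne_zero hx)
  have h1 : altern x (rho n) * genZ q (hs ++ [m]) x =
      ∑ b ∈ cfg n hs, q ^ energy n (b ++ [range m]) *
        altern x fun j => rho n j + wt (b ++ [range m]) j := by
    rw [altern_mul_genZ, sum_cfg_append, sum_comm, sum_cfg_cons]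
    simp only [cfg, sum_singleton]
    refine sum_eq_single (range m) (fun c hc hcm => ?_) fun h => ?_
    · rw [mem_powersetCard] at hc
      -- Any other subset of this size has a gap, and `sum_altern_eq_zero` applies at the gap.
      obtain ⟨i, h1, h2⟩ : ∃ i, i ∉ c ∧ i + 1 ∈ c := by
        by_contra! h
        have h3 : ∀ k ∈ c, k < m := by
          intro k hk
          have h4 : ∀ j, j ≤ k → k - j ∈ c := by
            intro j
            induction j with
            | zero => intro _; exact hk
            | succ j ih =>
              intro hj
              by_contra h5
              refine h _ h5 ?_
              rw [show k - (j + 1) + 1 = k - j by omega]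
              exact ih (by omega)
          have h5 : range (k + 1) ⊆ c := by
            intro j hj
            have := mem_range.mp hj
            have h6 := h4 (k - j) (by omega)
            rwa [show k - (k - j) = j by omega] at h6
          have := card_le_card h5
          rw [card_range, hc.2] at this
          omega
        refine hcm (eq_of_subset_of_card_le (fun k hk => mem_range.mpr (h3 k hk)) ?_)
        rw [card_range, hc.2]
      have h3 := mem_range.mp (hc.1 h2)
      refine sum_altern_eq_zero q hs x h3 (t := [c]) ?_ ?_
      · simp [phi, epsOne, phiOne, bit, h1, h2]
      · simp [phi, eps, epsOne, bit, h1, h2]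
    · exact absurd (mem_powersetCard.mpr ⟨range_subset_range.mpr hm, card_range m⟩) h
  have h2 : altern x (rho n) * genZ q (hs ++ [m]) x = ∑ s : Equiv.Perm (Fin n),
      ((Equiv.Perm.sign s : ℤ) : K) * (∏ j : Fin n, x (s j) ^ rho n j) *
        ((∏ j : Fin n, if (j : ℕ) < m then x (s j) else 1) *
          genZ q hs fun j => if (j : ℕ) < m then x (s j) else q * x (s j)) := by
    rw [h1]
    simp only [altern_eq_sum, mul_sum]
    rw [sum_comm]
    refine sum_congr rfl fun s _ => ?_
    rw [← sum_cfg_append_range q hs' hm fun j => x (s j), mul_sum]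
    refine sum_congr rfl fun b _ => ?_
    simp only [pow_add, prod_mul_distrib]
    ring
  have hcard : ((univ : Finset (Fin n)).filter fun j : Fin n => (j : ℕ) < m).card = m := by
    rw [Fin.card_filter_val_lt]; omega
  rw [h2, ← sum_fiberwise_of_maps_to (s := univ) (t := powersetCard m (univ : Finset (Fin n)))
    (g := fun s : Equiv.Perm (Fin n) =>
      (univ.filter fun j : Fin n => (j : ℕ) < m).map s.toEmbedding)
    (fun s _ => mem_powersetCard.mpr ⟨subset_univ _, by rw [card_map, hcard]⟩), mul_sum]
  refine sum_congr rfl fun I hI => ?_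
  have e : (univ.filter fun s : Equiv.Perm (Fin n) =>
      (univ.filter fun j : Fin n => (j : ℕ) < m).map s.toEmbedding = I) =
      univ.filter fun s : Equiv.Perm (Fin n) => ∀ j : Fin n, s j ∈ I ↔ (j : ℕ) < m := by
    ext s
    simp only [mem_filter, mem_univ, true_and]
    constructor
    · rintro rfl j
      simp
    · intro h
      ext i
      obtain ⟨j, rfl⟩ := s.surjective i
      simp [h]
  rw [e]
  have h3 := sum_perm_fiber hx hm (mem_powersetCard.mp hI).2
  have h4 : ∀ a b c : K, altern x (rho n) * (a * b * c) = altern x (rho n) * b * (a * c) :=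
    fun a b c => by ring
  rw [h4, ← h3, sum_mul]
  refine sum_congr rfl fun s hs => ?_
  simp only [mem_filter, mem_univ, true_and] at hs
  congr 2
  · simp only [← hs]
    rw [Equiv.prod_comp s fun i => if i ∈ I then x i else 1, ← prod_filter]
    congr 1
    ext i
    simp
  · simp only [← hs]
    exact genZ_comp q _ (fun i => if i ∈ I then x i else q * x i) s

end GeneratingFunction

/-! ### `q`-Whittaker polynomials as generating functions of the energy -/

section Columns

variable {K : Type u} [Field K]

theorem raise_genZ (q : K) {n : ℕ} (hs : List ℕ) (m : ℕ) (x : ℕ → K) :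
    raise q (range n) m (fun y => genZ q hs fun i : Fin n => y i) x =
      ∑ I ∈ powersetCard m (univ : Finset (Fin n)),
        (∏ i ∈ I, x i) * (∏ i ∈ I, ∏ j ∈ Iᶜ, x i / (x i - x j)) *
          genZ q hs fun i : Fin n => if i ∈ I then x i else q * x i := by
  have hr : range n = (univ : Finset (Fin n)).map Fin.valEmbedding := by
    rw [Fin.map_valEmbedding_univ, Nat.Iio_eq_range]
  rw [raise, hr, powersetCard_map, sum_map]
  refine sum_congr rfl fun I _ => ?_
  have e : (univ : Finset (Fin n)).map Fin.valEmbedding \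
      (mapEmbedding Fin.valEmbedding).toEmbedding I = Iᶜ.map Fin.valEmbedding := by
    rw [RelEmbedding.coe_toEmbedding, mapEmbedding_apply, ← Finset.map_sdiff, compl_eq_univ_sdiff]
  rw [raiseCoeff, e, RelEmbedding.coe_toEmbedding, mapEmbedding_apply, prod_map, prod_map]
  simp only [prod_map, Fin.valEmbedding_apply]
  congr 2
  funext i
  unfold shift
  by_cases h : i ∈ I
  · rw [if_pos h, if_neg]
    simpa [Fin.val_inj] using h
  · rw [if_neg h, if_pos]
    simpa [Fin.val_inj] using h

theorem wt_map_range_eq_zero {hs : List ℕ} {k : ℕ} (h : ∀ a ∈ hs, a ≤ k) :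
    wt (hs.map range) k = 0 := by
  induction hs with
  | nil => rfl
  | cons a hs ih =>
    rw [List.map_cons, wt, ih fun b hb => h b (by simp [hb])]
    have := h a (by simp)
    simpa [bit] using this

theorem genZ_nil {R : Type u} [CommRing R] (q : R) {n : ℕ} (x : Fin n → R) : genZ q [] x = 1 := by
  simp [genZ, cfg, energy, wt]

/-- The columns are listed by increasing length: full columns are appended last, through
`whittakerRaising` on one side and `genZ_append` on the other. The list is chosen before the field,
so it serves for every specialisation. -/
theorem exists_columns {m : ℕ} (l : Fin m → ℕ) (hl : Antitone l) :
    ∃ hs : List ℕ, hs.Pairwise (· ≤ ·) ∧ (∀ h ∈ hs, h ≤ m) ∧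
      (∀ i : Fin m, wt (hs.map range) i = l i) ∧
      ∀ (K : Type u) [Field K] [CharZero K] (q : K) (n : ℕ) (x : ℕ → K), Generic q x →
        wRows q n l x = genZ q hs fun i : Fin n => x i := by
  induction m with
  | zero =>
    exact ⟨[], List.Pairwise.nil, by simp, fun i => i.elim0, fun K _ _ q n x _ => by
      rw [wRows_zero_rows, genZ_nil]⟩
  | succ m ih =>
    generalize hp : l (Fin.last m) = p
    induction p generalizing l with
    | zero =>
      obtain ⟨hs, h1, h2, h3, h4⟩ := ih (fun i => l i.castSucc)
        fun i j hij => hl (Fin.castSucc_le_castSucc_iff.mpr hij)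
      have e : l = Fin.snoc (α := fun _ => ℕ) (fun i => l i.castSucc) 0 := by
        rw [← hp]; exact (Fin.snoc_init_self l).symm
      refine ⟨hs, h1, fun h hh => (h2 h hh).trans (Nat.le_succ m), fun i => ?_, ?_⟩
      · refine Fin.lastCases ?_ (fun i => ?_) i
        · rw [hp, Fin.val_last, wt_map_range_eq_zero h2]
        · exact h3 i
      · intro K _ _ q n x hx
        rw [e, wRows_snoc_zero, h4 K q n x hx]
    | succ p ihp =>
      have hpos : ∀ i, p + 1 ≤ l i := fun i => hp ▸ hl (Fin.le_last i)
      obtain ⟨hs, h1, h2, h3, h4⟩ := ihp (fun i => l i - 1)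
        (fun i j hij => Nat.sub_le_sub_right (hl hij) 1) (by rw [hp]; rfl)
      have e : l = fun i => (l i - 1) + 1 := by
        funext i; have := hpos i; omega
      refine ⟨hs ++ [m + 1], ?_, ?_, fun i => ?_, ?_⟩
      · rw [List.pairwise_append]
        exact ⟨h1, List.pairwise_singleton _ _, fun a ha b hb => by
          rw [List.mem_singleton.mp hb]; exact h2 a ha⟩
      · intro h hh
        rcases List.mem_append.mp hh with hh | hh
        · exact h2 h hh
        · rw [List.mem_singleton.mp hh]
      · have := hpos i
        have hi : bit (range (m + 1)) i = 1 := bit_eq_one.mpr (mem_range.mpr i.2)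
        rw [List.map_append, wt_append, h3]
        simp only [List.map_cons, List.map_nil, wt, hi]
        omega
      · intro K _ _ q n x hx
        have hanti : Antitone fun i => l i - 1 := fun i j hij => Nat.sub_le_sub_right (hl hij) 1
        rw [e, (whittakerRaising q n _ (fun i => l i - 1) hanti).2.2 x hx,
          raise_congr hx (range n) (m + 1) (h4 K q n), raise_genZ, genZ_append q h1]
        intro i j hij
        by_contra hne
        exact hx.ne (fun h => hne (Fin.ext h)) hij

end Columns

/-! ### Highest weights -/

section HighestWeight

variable {n : ℕ}

/-- The raising operators annihilate a list of columns. -/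
def IsHighest (n : ℕ) (b : List (Finset ℕ)) : Prop := ∀ i ∈ range (n - 1), eps i b = 0

instance (b : List (Finset ℕ)) : Decidable (IsHighest n b) :=
  inferInstanceAs (Decidable (∀ i ∈ range (n - 1), eps i b = 0))

/-- The lists of columns that are annihilated by the raising operators. -/
def highest (n : ℕ) (hs : List ℕ) : Finset (List (Finset ℕ)) :=
  (cfg n hs).filter (IsHighest n)

theorem mem_highest {hs : List ℕ} {b : List (Finset ℕ)} :
    b ∈ highest n hs ↔ b ∈ cfg n hs ∧ ∀ i, i + 1 < n → eps i b = 0 := by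
  rw [highest, mem_filter, IsHighest]
  refine and_congr_right fun _ => forall_congr' fun i => ?_
  rw [mem_range, show i < n - 1 ↔ i + 1 < n by omega]

theorem sum_highest_cons {M : Type*} [AddCommMonoid M] (h : ℕ) (hs : List ℕ)
    (f : List (Finset ℕ) → M) :
    ∑ b ∈ highest n (h :: hs), f b = ∑ c ∈ powersetCard h (range n), ∑ t ∈ highest n hs,
      if IsHighest n (c :: t) then f (c :: t) else 0 := by
  rw [highest, sum_filter, sum_cfg_cons]
  refine sum_congr rfl fun c _ => ?_
  rw [highest, sum_filter]
  refine sum_congr rfl fun t _ => ?_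
  by_cases ht : IsHighest n t
  · rw [if_pos ht]
  · rw [if_neg ht, if_neg]
    intro h'
    refine ht fun i hi => ?_
    have := h' i hi
    rw [eps] at this
    omega

/-- Columns are moved from right to left into a suffix kept of highest weight. A new column that
violates the condition at `i` gives a suffix with `phi = 0` and `eps = 1`, and the sum over all
prefixes vanishes. -/
theorem altern_mul_genZ_eq_sum_highest {K : Type u} [Field K] [CharZero K] (q : K) (hs : List ℕ)
    (x : Fin n → K) :
    altern x (rho n) * genZ q hs x =
      ∑ b ∈ highest n hs, q ^ energy n b * altern x fun j => rho n j + wt b j := by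
  set F : List (Finset ℕ) → K := fun b => q ^ energy n b * altern x fun j => rho n j + wt b j
  have key : ∀ hs₂ hs₁ : List ℕ, ∑ b ∈ cfg n (hs₁ ++ hs₂), F b =
      ∑ t ∈ highest n hs₂, ∑ b ∈ cfg n hs₁, F (b ++ t) := by
    intro hs₂
    induction hs₂ with
    | nil => 
      intro hs₁
      have e : highest n [] = {[]} := by
        rw [highest, cfg, filter_singleton, if_pos]
        exact fun _ _ => rfl
      simp [e]
    | cons h hs₂ ih =>
      intro hs₁
      have e := ih (hs₁ ++ [h])
      rw [List.append_assoc, List.singleton_append] at e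
      rw [e, sum_highest_cons, sum_comm' (t' := highest n hs₂)
        (s' := fun _ => powersetCard h (range n)) (by simp [and_comm])]
      refine sum_congr rfl fun t ht => ?_
      rw [sum_cfg_append, sum_comm, sum_cfg_cons]
      simp only [cfg, sum_singleton, List.append_assoc, List.singleton_append]
      refine sum_congr rfl fun c _ => ?_
      split_ifs with hc
      · rfl
      · unfold IsHighest at hc
        push Not at hc
        obtain ⟨i, hi, hc⟩ := hc
        have hi' : i + 1 < n := by have := mem_range.mp hi; omega
        have h1 := (mem_highest.mp ht).2 i hi'
        have h2 := epsOne_phiOne i c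
        rw [eps] at hc
        exact sum_altern_eq_zero q hs₁ x hi' (by rw [phi]; omega) (by rw [eps]; omega)
  have := key hs []
  rw [altern_mul_genZ]
  simpa [cfg] using this

theorem eq_range_of_epsOne {c : Finset ℕ} (hc : c ⊆ range n)
    (h : ∀ i, i + 1 < n → epsOne i c = 0) : c = range c.card := by
  have h1 : ∀ i, i + 1 ∈ c → i ∈ c := by
    intro i hi
    have h2 := h i (mem_range.mp (hc hi))
    rw [← bit_pos] at hi ⊢
    rw [epsOne] at h2
    omega
  have h2 : ∀ j i, i + j ∈ c → i ∈ c := by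
    intro j
    induction j with
    | zero => exact fun i hi => hi
    | succ j ih => exact fun i hi => ih i (h1 _ hi)
  refine eq_of_subset_of_card_le (fun k hk => ?_) (by rw [card_range])
  have h3 : range (k + 1) ⊆ c := by
    intro j hj
    refine h2 (k - j) j ?_
    have := mem_range.mp hj
    rwa [show j + (k - j) = k by omega]
  have := card_le_card h3
  rw [card_range] at this
  exact mem_range.mpr this

theorem load_eq_zero_of_subset {A C : Finset ℕ} (h : A ⊆ C) (k : ℕ) : load A C 0 0 k = 0 := by
  induction k with
  | zero => rfl
  | succ k ih =>
    have h1 : 1 ≤ bit A k → 1 ≤ bit C k := by rw [bit_pos, bit_pos]; exact fun hk => h hk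
    have := bit_le A k
    simp only [load, ih, zero_add]
    omega

theorem wind_eq_zero_of_subset {A C : Finset ℕ} (h : A ⊆ C) : wind n A C = 0 :=
  load_eq_zero_of_subset h n

theorem img_of_subset {A C : Finset ℕ} (h : A ⊆ C) : img n A C = A := by
  ext k
  rw [img, mem_filter, wind_eq_zero_of_subset h, load_eq_zero_of_subset h, zero_add, bit_pos]
  exact ⟨fun hk => hk.2, fun hk => ⟨h hk, hk⟩⟩

theorem pass_eq_zero_of_subset {A : Finset ℕ} {l : List (Finset ℕ)} (h : ∀ C ∈ l, A ⊆ C) :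
    pass n A l = 0 := by
  induction l with
  | nil => rfl
  | cons C l ih =>
    rw [pass, wind_eq_zero_of_subset (h C (by simp)), img_of_subset (h C (by simp)),
      ih fun D hD => h D (by simp [hD])]

theorem subset_of_pass_eq_zero {A : Finset ℕ} (hA : A ⊆ range n) {hs : List ℕ}
    (hs' : ∀ h ∈ hs, h ≤ n) (h : pass n A (hs.map range) = 0) : ∀ a ∈ hs, A ⊆ range a := by
  induction hs with
  | nil => simp
  | cons a hs ih =>
    rw [List.map_cons, pass, Nat.add_eq_zero_iff] at h
    have h1 := wind_range (hs' a (by simp)) A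
    have h2 := below_add_sum_Ico (hs' a (by simp)) A
    have h3 : ∑ j ∈ Ico a n, bit A j = 0 := by omega
    rw [sum_eq_zero_iff] at h3
    have h4 : A ⊆ range a := by
      intro k hk
      by_contra h5
      have h6 := h3 k (mem_Ico.mpr ⟨by simpa using h5, mem_range.mp (hA hk)⟩)
      rw [← bit_pos] at hk
      omega
    rw [img_of_subset h4] at h
    intro b hb
    rcases List.mem_cons.mp hb with rfl | hb
    · exact h4
    · exact ih (fun c hc => hs' c (by simp [hc])) h.2 b hb

/-- Among initial segments, only the one ending at `i` contains `i` without `i + 1`. -/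
theorem mem_of_phi_pos {i : ℕ} {hs : List ℕ} (h : 0 < phi i (hs.map range)) : i + 1 ∈ hs := by
  induction hs with
  | nil => simp [phi] at h
  | cons a hs ih =>
    rw [List.map_cons, phi] at h
    by_cases ha : i + 1 = a
    · simp [ha]
    · refine List.mem_cons_of_mem _ (ih ?_)
      have : phiOne i (range a) = 0 := by
        unfold phiOne bit
        simp only [mem_range]
        split_ifs <;> omega
      omega

/-- Without windings, a column must lie inside every initial segment to its right. A pair at which
the suffix could compensate a gap is then excluded, so the column itself must be an initial segment.
-/
theorem filter_highest_energy {hs : List ℕ} (h1 : hs.Pairwise (· ≤ ·)) (h2 : ∀ h ∈ hs, h ≤ n) :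
    (highest n hs).filter (fun b => energy n b = 0) = {hs.map range} := by
  ext b
  rw [mem_filter, mem_singleton, mem_highest, mem_cfg]
  constructor
  · rintro ⟨⟨h3, h4⟩, h5⟩
    induction h3 with
    | nil => rfl
    | @cons c h t hs h6 h7 ih =>
      rw [List.pairwise_cons] at h1
      rw [energy, Nat.add_eq_zero_iff] at h5
      have ht := ih h1.2 (fun a ha => h2 a (by simp [ha]))
        h5.1 (fun i hi => by have := h4 i hi; rw [eps] at this; omega)
      subst ht
      rw [mem_powersetCard] at h6
      have h8 := subset_of_pass_eq_zero h6.1 (fun a ha => h2 a (by simp [ha])) h5.2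
      have h9 : ∀ i, i + 1 < n → epsOne i c = 0 := by
        intro i hi
        have h10 := h4 i hi
        rw [eps] at h10
        rcases Nat.eq_zero_or_pos (phi i (hs.map range)) with h11 | h11
        · omega
        · have h12 := h8 _ (mem_of_phi_pos h11)
          have h13 : ¬ 1 ≤ bit c (i + 1) := by
            rw [bit_pos]
            intro h
            simpa using h12 h
          rw [epsOne]
          omega
      rw [List.map_cons, eq_range_of_epsOne h6.1 h9, h6.2]
  · rintro rfl
    induction hs with
    | nil => exact ⟨⟨List.Forall₂.nil, fun _ _ => rfl⟩, rfl⟩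
    | cons h hs ih =>
      rw [List.pairwise_cons] at h1
      obtain ⟨⟨h3, h4⟩, h5⟩ := ih h1.2 fun a ha => h2 a (by simp [ha])
      refine ⟨⟨List.Forall₂.cons ?_ h3, fun i hi => ?_⟩, ?_⟩
      · rw [mem_powersetCard, range_subset_range, card_range]
        exact ⟨h2 h (by simp), rfl⟩
      · rw [List.map_cons, eps, h4 i hi]
        have : epsOne i (range h) = 0 := by
          unfold epsOne bit
          simp only [mem_range]
          split_ifs <;> omega
        omega
      · rw [List.map_cons, energy, h5, pass_eq_zero_of_subset]
        intro C hC
        obtain ⟨a, ha, rfl⟩ := List.mem_map.mp hC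
        exact range_subset_range.mpr (h1.1 a ha)

/-- With `eps = 0`, the balance `phi_add_wt` makes consecutive multiplicities decrease weakly. -/
theorem wt_antitone_of_mem_highest {hs : List ℕ} {b : List (Finset ℕ)} (hb : b ∈ highest n hs) :
    Antitone fun i : Fin n => wt b i := by
  have h1 : ∀ j i, i + j < n → wt b (i + j) ≤ wt b i := by
    intro j i
    induction j with
    | zero => exact fun _ => le_rfl
    | succ j ih =>
      intro hj
      have h2 := (mem_highest.mp hb).2 (i + j) hj
      have h3 := phi_add_wt (i + j) b
      have h4 := ih (by omega)
      rw [← add_assoc]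
      omega
  intro i j hij
  have := h1 (j - i) i (by have := Fin.le_def.mp hij; omega)
  have e : (i : ℕ) + (j - i) = j := by have := Fin.le_def.mp hij; omega
  rwa [e] at this

end HighestWeight

/-! ### Transfer from generic to arbitrary parameters -/

section Transfer

theorem map_wRows {R S : Type*} [CommSemiring R] [CommSemiring S] (f : R →+* S) (q : R) {m : ℕ}
    (n : ℕ) (l : Fin m → ℕ) (x : ℕ → R) :
    f (wRows q n l x) = wRows (f q) n l fun i => f (x i) := by
  induction n generalizing l with
  | zero => simp only [wRows]; split_ifs <;> simp
  | succ n ih => simp only [wRows, map_sum, map_mul, map_pow, map_prod, gauss_map, ih]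

theorem map_altern {R : Type*} {S : Type u} [CommRing R] [CommRing S] (f : R →+* S) {n : ℕ}
    (x : Fin n → R) (α : ℕ → ℕ) : f (altern x α) = altern (fun i => f (x i)) α := by
  rw [altern, RingHom.map_det]
  unfold altern
  congr 1
  ext i j
  simp

/-- The ring of polynomials over the integers in the parameter and the variables. -/
abbrev GenericRing : Type := MvPolynomial (Option ℕ) ℤ

/-- The field of rational functions in the parameter and the variables. -/
abbrev GenericField : Type := FractionRing GenericRing

theorem generic_point : Generic (algebraMap GenericRing GenericField (MvPolynomial.X none))
    fun i => algebraMap GenericRing GenericField (MvPolynomial.X (some i)) := by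
  have hinj := IsFractionRing.injective GenericRing GenericField
  refine ⟨?_, fun k hk h => ?_, fun i => ?_, fun i j hij k l h => ?_⟩
  · exact (map_ne_zero_iff _ hinj).mpr (MvPolynomial.X_ne_zero _)
  · rw [← map_pow, ← map_one (algebraMap GenericRing GenericField)] at h
    have := congrArg (MvPolynomial.eval fun _ => (0 : ℤ)) (hinj h)
    simp [zero_pow (by omega : k ≠ 0)] at this
  · exact (map_ne_zero_iff _ hinj).mpr (MvPolynomial.X_ne_zero _)
  · rw [← map_pow, ← map_pow, ← map_mul, ← map_mul] at h
    have := congrArg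
      (MvPolynomial.eval fun o => if o = some j then (0 : ℤ) else 1) (hinj h)
    simp [hij] at this

theorem eq_of_generic {S : Type u} [CommRing S] (q : S) (x : ℕ → S) :
    ∃ f : GenericRing →+* S, f (MvPolynomial.X none) = q ∧
      ∀ i, f (MvPolynomial.X (some i)) = x i :=
  ⟨MvPolynomial.eval₂Hom (Int.castRingHom S) fun o => o.elim q x, by simp, by simp⟩

/-- The identity is polynomial with integer coefficients: it is proved at the generic point, pulled
back along the injection into the fraction field and then specialised. -/
theorem exists_columns_altern {n : ℕ} (l : Fin n → ℕ) (hl : Antitone l) :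
    ∃ hs : List ℕ, hs.Pairwise (· ≤ ·) ∧ (∀ h ∈ hs, h ≤ n) ∧
      (∀ i : Fin n, wt (hs.map range) i = l i) ∧
      ∀ (S : Type u) [CommRing S] (q : S) (x : ℕ → S),
        altern (fun i : Fin n => x i) (rho n) * wRows q n l x = ∑ b ∈ highest n hs,
          q ^ energy n b * altern (fun i : Fin n => x i) fun j => rho n j + wt b j := by
  obtain ⟨hs, h1, h2, h3, h4⟩ := exists_columns l hl
  refine ⟨hs, h1, h2, h3, fun S _ q x => ?_⟩
  have e1 := altern_mul_genZ_eq_sum_highest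
    (algebraMap GenericRing GenericField (MvPolynomial.X none)) hs
    fun i : Fin n => algebraMap GenericRing GenericField (MvPolynomial.X (some i))
  rw [← h4 _ _ n _ generic_point, ← map_wRows] at e1
  simp only [← map_altern, ← map_mul, ← map_pow, ← map_sum] at e1
  obtain ⟨f, hq, hx⟩ := eq_of_generic q x
  have e2 := congrArg f (IsFractionRing.injective GenericRing GenericField e1)
  simpa only [map_mul, map_sum, map_pow, map_altern, map_wRows, hq, hx] using e2

/-- The bialternant formula: at `q = 0` only lists of energy zero contribute, and there is just one.
-/
theorem altern_rho_mul_wRows_zero {S : Type u} [CommRing S] {n : ℕ} (a : ℕ → ℕ)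
    (ha : Antitone fun i : Fin n => a i) (x : ℕ → S) :
    altern (fun i : Fin n => x i) (rho n) * wRows 0 n (fun i : Fin n => a i) x =
      altern (fun i : Fin n => x i) fun j => rho n j + a j := by
  obtain ⟨hs, h1, h2, h3, h4⟩ := exists_columns_altern _ ha
  rw [h4 S 0 x]
  have e : ∀ b ∈ highest n hs,
      (0 : S) ^ energy n b * altern (fun i : Fin n => x i) (fun j => rho n j + wt b j) =
      if energy n b = 0 then altern (fun i : Fin n => x i) (fun j => rho n j + wt b j) else 0 := by
    intro b _
    split_ifs with h
    · rw [h, pow_zero, one_mul]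
    · rw [zero_pow h, zero_mul]
  rw [sum_congr rfl e, ← sum_filter, filter_highest_energy h1 h2, sum_singleton]
  exact altern_congr _ fun j hj => by rw [h3 ⟨j, hj⟩]

/-- The Vandermonde determinant may be cancelled at the generic point, where it is non-zero; the
resulting identity is again polynomial and specialises even where variables coincide. -/
theorem exists_columns_wRows {n : ℕ} (l : Fin n → ℕ) (hl : Antitone l) :
    ∃ hs : List ℕ, ∀ (S : Type u) [CommRing S] (q : S) (x : ℕ → S),
      wRows q n l x =
        ∑ b ∈ highest n hs, q ^ energy n b * wRows 0 n (fun i : Fin n => wt b i) x := by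
  obtain ⟨hs, _, _, _, h⟩ := exists_columns_altern l hl
  refine ⟨hs, fun S _ q x => ?_⟩
  have hne : altern (fun i : Fin n =>
      algebraMap GenericRing GenericField (MvPolynomial.X (some (i : ℕ)))) (rho n) ≠ 0 := by
    apply altern_rho_ne_zero
    intro i j hij
    by_contra hne
    exact generic_point.ne (fun h => hne (Fin.ext h)) hij
  have e1 := h GenericField (algebraMap GenericRing GenericField (MvPolynomial.X none))
    fun i => algebraMap GenericRing GenericField (MvPolynomial.X (some i))
  have e : ∀ b ∈ highest n hs,
      algebraMap GenericRing GenericField (MvPolynomial.X none) ^ energy n b *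
        altern (fun i : Fin n => algebraMap GenericRing GenericField (MvPolynomial.X (some (i : ℕ))))
          (fun j => rho n j + wt b j) =
      altern (fun i : Fin n => algebraMap GenericRing GenericField (MvPolynomial.X (some (i : ℕ))))
          (rho n) * (algebraMap GenericRing GenericField (MvPolynomial.X none) ^ energy n b *
        wRows 0 n (fun i : Fin n => wt b i)
          fun i => algebraMap GenericRing GenericField (MvPolynomial.X (some i))) := by
    intro b hb
    rw [mul_left_comm, ← altern_rho_mul_wRows_zero _ (wt_antitone_of_mem_highest hb)
      fun i => algebraMap GenericRing GenericField (MvPolynomial.X (some i))]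
  rw [sum_congr rfl e, ← mul_sum] at e1
  have e2 := mul_left_cancel₀ hne e1
  rw [← map_zero (algebraMap GenericRing GenericField)] at e2
  simp only [← map_wRows, ← map_mul, ← map_pow, ← map_sum] at e2
  obtain ⟨f, hq, hx⟩ := eq_of_generic q x
  have e3 := congrArg f (IsFractionRing.injective GenericRing GenericField e2)
  simpa only [map_mul, map_sum, map_pow, map_wRows, map_zero, hq, hx] using e3

end Transfer

/-! ### `q`-Whittaker polynomials in terms of `wRows` -/

section Rows

theorem wRows_eq_zero {R : Type*} [CommSemiring R] (q : R) {m : ℕ} (n : ℕ) (l : Fin m → ℕ)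
    (x : ℕ → R) {k : Fin m} (hk : n ≤ k) (hl : 0 < l k) : wRows q n l x = 0 := by
  induction n generalizing l k with
  | zero => exact if_neg fun h => by simp [h] at hl
  | succ n ih =>
    rw [wRows]
    refine sum_eq_zero fun κ hκ => ?_
    obtain ⟨j, hj⟩ : ∃ j, (k : ℕ) = j + 1 := ⟨k - 1, by omega⟩
    have h1 := (mem_Icc.mp (Fintype.mem_piFinset.mp hκ ⟨j, by omega⟩)).1
    rw [nextPart, dif_pos (show j + 1 < m by omega)] at h1
    have e : (⟨j + 1, by omega⟩ : Fin m) = k := Fin.ext hj.symm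
    rw [e] at h1
    rw [ih κ (k := ⟨j, by omega⟩) (by simp only; omega) (by omega), mul_zero]

/-- A partition cannot have more non-zero parts than variables (`wRows_eq_zero`), so the extra last
part in the branching rule of `wRows` is forced to be zero. -/
theorem whittakerSeq_eq_wRows {F : Type u} [Field F] {q : F} (hq : ∀ k : ℕ, 1 ≤ k → q ^ k ≠ 1)
    {n : ℕ} (l : Fin n → ℕ) (x : ℕ → F) :
    whittakerSeq q n (fun i => x i) l = wRows q n l x := by
  induction n with
  | zero => rw [whittakerSeq, wRows, if_pos (Subsingleton.elim _ _)]
  | succ n ih =>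
    rw [whittakerSeq, wRows, sum_piFinset_snoc]
    simp only [nextPart_castSucc, nextPart_last]
    refine sum_congr rfl fun κ hκ => ?_
    symm
    rw [sum_eq_single (0 : ℕ)]
    · rw [wRows_snoc_zero, ← ih κ, Fin.sum_univ_castSucc (fun i => Fin.snoc (α := fun _ => ℕ) κ 0 i),
        Fin.prod_univ_castSucc (fun i => gauss q (l i - nextPart l i) (l i - _))]
      simp only [nextPart_castSucc, nextPart_last, Fin.snoc_castSucc, Fin.snoc_last, Nat.sub_zero,
        gauss_self, add_zero, mul_one, Fin.val_last, Fin.val_castSucc]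
      congr 2
      refine prod_congr rfl fun i _ => ?_
      have h := mem_Icc.mp (Fintype.mem_piFinset.mp hκ i)
      have e := gauss_eq_div hq (κ i - l i.succ) (l i.castSucc - κ i)
      rw [show κ i - l i.succ + (l i.castSucc - κ i) = l i.castSucc - l i.succ by omega] at e
      rw [e, mul_comm (qPoch q q (κ i - l i.succ))]
    · intro c _ hc
      rw [wRows_eq_zero q n _ x (k := Fin.last n) (by simp)
        (by rw [Fin.snoc_last]; omega), mul_zero]
    · intro h; simp at h

theorem gauss_zero_param {R : Type*} [CommSemiring R] {a b : ℕ} (h : b ≤ a) :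
    gauss (0 : R) a b = 1 := by
  induction a generalizing b with
  | zero => rw [Nat.le_zero.mp h, gauss_self]
  | succ a ih =>
    cases b with
    | zero => simp
    | succ b => rw [gauss_succ_succ, ih (by omega), zero_pow (by omega), zero_mul, add_zero]

end Rows

/-! ### Schur polynomials -/

section Schur

/-- A semistandard tableau of shape `nu` with entries less than `n`, as a function. -/
def IsTab (nu : YoungDiagram) (n : ℕ) (T : ℕ → ℕ → ℕ) : Prop :=
  (∀ i j₁ j₂, j₁ < j₂ → (i, j₂) ∈ nu → T i j₁ ≤ T i j₂) ∧
    (∀ i₁ i₂ j, i₁ < i₂ → (i₂, j) ∈ nu → T i₁ j < T i₂ j) ∧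
    (∀ i j, (i, j) ∉ nu → T i j = 0) ∧ ∀ i j, (i, j) ∈ nu → T i j < n

/-- The semistandard tableaux of shape `nu` with entries less than `n`. -/
def tabs (nu : YoungDiagram) (n : ℕ) : Finset (ℕ → ℕ → ℕ) :=
  univ.map ⟨fun T : BoundedSSYT nu n => fun i j => T.1 i j, fun S T h => by
    apply Subtype.ext
    apply SemistandardYoungTableau.ext
    intro i j
    exact congrFun (congrFun h i) j⟩

theorem mem_tabs {nu : YoungDiagram} {n : ℕ} {T : ℕ → ℕ → ℕ} : T ∈ tabs nu n ↔ IsTab nu n T := by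
  rw [tabs, mem_map]
  constructor
  · rintro ⟨S, _, rfl⟩
    exact ⟨fun i j₁ j₂ h h' => S.1.row_weak h h', fun i₁ i₂ j h h' => S.1.col_strict h h',
      fun i j h => S.1.zeros h, fun i j h => S.2 (i, j) ((YoungDiagram.mem_cells _).mpr h)⟩
  · rintro ⟨h1, h2, h3, h4⟩
    exact ⟨⟨⟨T, fun h h' => h1 _ _ _ h h', fun h h' => h2 _ _ _ h h', fun h => h3 _ _ h⟩,
      fun c hc => h4 _ _ ((YoungDiagram.mem_cells _).mp hc)⟩, mem_univ _, rfl⟩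

variable {F : Type u} [Field F]

theorem schur_eq_sum_tabs (nu : YoungDiagram) (n : ℕ) (x : ℕ → F) :
    schur (fun i : Fin n => x i) nu = ∑ T ∈ tabs nu n, ∏ c ∈ nu.cells, x (T c.1 c.2) := by
  rw [schur, tabs, sum_map]
  exact sum_congr rfl fun T _ => prod_coe_sort nu.cells fun c => x (T.1 c.1 c.2)

theorem card_cells {m : ℕ} {nu : YoungDiagram} (h : numParts nu ≤ m) :
    nu.cells.card = ∑ i : Fin m, nu.rowLen i := by
  rw [card_eq_sum_card_fiberwise (f := Prod.fst) (t := range m),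
    ← Fin.sum_univ_eq_sum_range (fun i => (nu.cells.filter fun c => c.1 = i).card)]
  · exact sum_congr rfl fun i _ => (YoungDiagram.rowLen_eq_card nu).symm
  · intro c hc
    rw [mem_coe, mem_range]
    by_contra h'
    have h1 := (rowLen_eq_zero_iff (mu := nu) (i := c.1)).mpr (h.trans (not_lt.mp h'))
    have h2 := YoungDiagram.mem_iff_lt_rowLen.mp
      (show (c.1, c.2) ∈ nu from (YoungDiagram.mem_cells _).mp hc)
    omega

/-- The lengths of the rows of the subtableau of entries less than `n`. -/
def subShape (nu : YoungDiagram) (n m : ℕ) (T : ℕ → ℕ → ℕ) (i : Fin m) : ℕ :=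
  ((range (nu.rowLen i)).filter fun j => T i j < n).card

/-- Rows increase weakly, so the entries below `n` form an initial segment of each row. -/
theorem lt_subShape {nu : YoungDiagram} {n m k : ℕ} {T : ℕ → ℕ → ℕ} (hT : IsTab nu k T) (i : Fin m)
    (j : ℕ) : j < subShape nu n m T i ↔ j < nu.rowLen i ∧ T i j < n := by
  have hdown : ∀ j₁ j₂, j₁ ≤ j₂ → j₂ < nu.rowLen i ∧ T i j₂ < n → T i j₁ < n := by
    intro j₁ j₂ h h'
    rcases eq_or_lt_of_le h with rfl | h
    · exact h'.2
    · exact (hT.1 i j₁ j₂ h (YoungDiagram.mem_iff_lt_rowLen.mpr h'.1)).trans_lt h'.2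
  constructor
  · intro h
    by_contra h'
    have : (range (nu.rowLen i)).filter (fun j => T i j < n) ⊆ range j := by
      intro a ha
      rw [mem_filter, mem_range] at ha
      rw [mem_range]
      by_contra h2
      exact h' ⟨by omega, hdown j a (by omega) ha⟩
    have := card_le_card this
    rw [card_range] at this
    unfold subShape at h
    omega
  · intro h
    have : range (j + 1) ⊆ (range (nu.rowLen i)).filter fun j => T i j < n := by
      intro a ha
      rw [mem_filter, mem_range]
      have := mem_range.mp ha
      exact ⟨by omega, hdown a j (by omega) h⟩
    have := card_le_card this
    rw [card_range] at this
    exact this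

/-- At `q = 0` all branching coefficients of interlacing partitions are `1`. Deleting the boxes with
the largest entry leaves an arbitrary tableau of interlacing shape, the deleted boxes forming a
horizontal strip. -/
theorem sum_tabs_eq_wRows {m : ℕ} (n : ℕ) (nu : YoungDiagram) (h : numParts nu ≤ m) (x : ℕ → F) :
    ∑ T ∈ tabs nu n, ∏ c ∈ nu.cells, x (T c.1 c.2) =
      wRows 0 n (fun i : Fin m => nu.rowLen i) x := by
  induction n generalizing nu with
  | zero =>
    rw [wRows]
    split_ifs with h0
    · have hc : nu.cells = ∅ := by
        rw [← card_eq_zero, card_cells h]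
        exact sum_eq_zero fun i _ => congrFun h0 i
      have hmem : ∀ i j, (i, j) ∉ nu := fun i j hij => by
        have := (YoungDiagram.mem_cells _).mpr hij
        rw [hc] at this
        simp at this
      have ht : tabs nu 0 = {fun _ _ => 0} := by
        ext T
        rw [mem_tabs, mem_singleton]
        constructor
        · intro hT; funext i j; exact hT.2.2.1 i j (hmem i j)
        · rintro rfl
          exact ⟨fun _ _ _ _ _ => le_rfl, fun _ _ _ _ h => absurd h (hmem _ _), fun _ _ _ => rfl,
            fun _ _ h => absurd h (hmem _ _)⟩
      rw [ht, sum_singleton, hc, prod_empty]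
    · refine sum_eq_zero fun T hT => ?_
      exfalso
      apply h0
      funext i
      by_contra h1
      exact Nat.not_lt_zero _ ((mem_tabs.mp hT).2.2.2 i 0
        (YoungDiagram.mem_iff_lt_rowLen.mpr (Nat.pos_of_ne_zero h1)))
  | succ n ih =>
    set l : Fin m → ℕ := fun i => nu.rowLen i with hl
    have hnext : ∀ i : Fin m, nextPart l i = nu.rowLen (i + 1) := by
      intro i
      rw [nextPart]
      split_ifs with hi
      · rfl
      · exact (rowLen_eq_zero_iff.mpr (by omega)).symm
    have hmaps : ∀ T ∈ tabs nu (n + 1), subShape nu n m T ∈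
        Fintype.piFinset fun i => Icc (nextPart l i) (l i) := by
      intro T hT
      rw [mem_tabs] at hT
      rw [Fintype.mem_piFinset]
      intro i
      rw [mem_Icc, hnext]
      constructor
      · by_contra h1
        obtain ⟨h2, h3, _, h4⟩ := id hT
        have h5 := YoungDiagram.mem_iff_lt_rowLen.mpr (not_le.mp h1)
        have h6 := h3 i (i + 1) _ (Nat.lt_succ_self _) h5
        have h7 := h4 _ _ h5
        have h8 := (lt_subShape (n := n) hT i (subShape nu n m T i)).mpr
          ⟨(not_le.mp h1).trans_le (nu.rowLen_anti _ _ (Nat.le_succ _)), by omega⟩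
        omega
      · by_contra h1
        have := ((lt_subShape (n := n) hT i (l i)).mp (not_le.mp h1)).1
        exact lt_irrefl _ this
    rw [← sum_fiberwise_of_maps_to hmaps, wRows]
    refine sum_congr rfl fun κ hκ => ?_
    have hanti := antitone_of_interlace hκ
    rw [Fintype.mem_piFinset] at hκ
    set mu := diagramOf κ with hmu
    have hrow : ∀ i : Fin m, mu.rowLen i = κ i := rowLen_diagramOf hanti
    have hparts : numParts mu ≤ m := numParts_diagramOf κ
    have hmem : ∀ i j, (i, j) ∈ mu ↔ ∃ hi : i < m, j < κ ⟨i, hi⟩ := by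
      intro i j
      rw [YoungDiagram.mem_iff_lt_rowLen]
      constructor
      · intro hj
        have hi : i < m := by
          by_contra hi
          rw [rowLen_eq_zero_iff.mpr (hparts.trans (not_lt.mp hi))] at hj
          omega
        exact ⟨hi, by rwa [← hrow ⟨i, hi⟩]⟩
      · rintro ⟨hi, hj⟩
        rwa [← hrow ⟨i, hi⟩] at hj
    have hsub : ∀ i j, (i, j) ∈ mu → (i, j) ∈ nu := by
      intro i j hij
      obtain ⟨hi, hj⟩ := (hmem i j).mp hij
      exact YoungDiagram.mem_iff_lt_rowLen.mpr
        (hj.trans_le (mem_Icc.mp (hκ ⟨i, hi⟩)).2)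
    have hlt : ∀ i j, (i, j) ∈ nu → i < m := by
      intro i j hij
      by_contra hi
      have := YoungDiagram.mem_iff_lt_rowLen.mp hij
      rw [rowLen_eq_zero_iff.mpr (h.trans (not_lt.mp hi))] at this
      omega
    -- Interlacing in box form: a box of `nu` has every box above it in `mu`, so filling `nu \ mu`
    -- with `n` keeps columns strict.
    have hup : ∀ i₁ i₂ j, i₁ < i₂ → (i₂, j) ∈ nu → (i₁, j) ∈ mu := by
      intro i₁ i₂ j hi hj
      have h1 := hlt _ _ hj
      have h2 := (mem_Icc.mp (hκ ⟨i₁, by omega⟩)).1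
      rw [hnext] at h2
      refine (hmem _ _).mpr ⟨by omega, lt_of_lt_of_le ?_ h2⟩
      exact (YoungDiagram.mem_iff_lt_rowLen.mp hj).trans_le (nu.rowLen_anti _ _ hi)
    have hfib : ∀ T, IsTab nu (n + 1) T → subShape nu n m T = κ →
        ∀ i j, (i, j) ∈ nu → (T i j < n ↔ (i, j) ∈ mu) := by
      intro T hT hs i j hij
      rw [hmem, ← hs]
      have hi := hlt _ _ hij
      constructor
      · intro h1
        exact ⟨hi, (lt_subShape hT ⟨i, hi⟩ j).mpr ⟨YoungDiagram.mem_iff_lt_rowLen.mp hij, h1⟩⟩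
      · rintro ⟨hi, h1⟩
        exact ((lt_subShape hT ⟨i, hi⟩ j).mp h1).2
    have hg : ∏ i, gauss (0 : F) (l i - nextPart l i) (l i - κ i) = 1 :=
      prod_eq_one fun i _ => gauss_zero_param (by
        have := mem_Icc.mp (hκ i)
        omega)
    have hih := ih mu hparts
    simp only [hrow] at hih
    rw [hg, mul_one, ← hih, mul_sum]
    classical
    refine sum_bij' (fun T _ => fun i j => if (i, j) ∈ mu then T i j else 0)
      (fun T _ => fun i j => if (i, j) ∈ mu then T i j else if (i, j) ∈ nu then n else 0)
      ?_ ?_ ?_ ?_ ?_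
    · intro T hT
      rw [mem_filter, mem_tabs] at hT
      obtain ⟨hT, hs⟩ := hT
      rw [mem_tabs]
      refine ⟨fun i j₁ j₂ hj hm => ?_, fun i₁ i₂ j hi hm => ?_, fun i j hm => if_neg hm,
        fun i j hm => ?_⟩
      · beta_reduce
        rw [if_pos hm, if_pos (mu.up_left_mem le_rfl hj.le hm)]
        exact hT.1 _ _ _ hj (hsub _ _ hm)
      · beta_reduce
        rw [if_pos hm, if_pos (mu.up_left_mem hi.le le_rfl hm)]
        exact hT.2.1 _ _ _ hi (hsub _ _ hm)
      · beta_reduce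
        rw [if_pos hm]
        exact (hfib T hT hs i j (hsub _ _ hm)).mpr hm
    · intro T hT
      rw [mem_tabs] at hT
      have htab : IsTab nu (n + 1) fun i j =>
          if (i, j) ∈ mu then T i j else if (i, j) ∈ nu then n else 0 := by
        refine ⟨fun i j₁ j₂ hj hm => ?_, fun i₁ i₂ j hi hm => ?_, fun i j hm => ?_,
          fun i j hm => ?_⟩
        · beta_reduce
          by_cases hm2 : (i, j₂) ∈ mu
          · rw [if_pos hm2, if_pos (mu.up_left_mem le_rfl hj.le hm2)]
            exact hT.1 _ _ _ hj hm2
          · rw [if_neg hm2, if_pos hm]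
            split_ifs with h1 h2
            · exact (hT.2.2.2 _ _ h1).le
            · exact le_rfl
            · exact Nat.zero_le _
        · beta_reduce
          have h1 := hup _ _ _ hi hm
          rw [if_pos h1]
          by_cases hm2 : (i₂, j) ∈ mu
          · rw [if_pos hm2]
            exact hT.2.1 _ _ _ hi hm2
          · rw [if_neg hm2, if_pos hm]
            exact hT.2.2.2 _ _ h1
        · beta_reduce
          rw [if_neg fun h1 => hm (hsub _ _ h1), if_neg hm]
        · beta_reduce
          split_ifs with h1
          · exact (hT.2.2.2 _ _ h1).trans (Nat.lt_succ_self n)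
          · exact Nat.lt_succ_self n
      rw [mem_filter, mem_tabs]
      refine ⟨htab, ?_⟩
      funext i
      refine eq_of_forall_lt_iff fun j => ?_
      rw [lt_subShape htab]
      have e : (((i : ℕ), j) ∈ mu ↔ j < κ i) := by
        rw [hmem]
        exact ⟨fun ⟨_, h⟩ => h, fun h => ⟨i.2, h⟩⟩
      rw [← YoungDiagram.mem_iff_lt_rowLen]
      constructor
      · rintro ⟨h1, h2⟩
        by_contra h3
        rw [if_neg (fun h4 => h3 (e.mp h4)), if_pos h1] at h2
        exact lt_irrefl _ h2
      · intro h1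
        have h2 := e.mpr h1
        refine ⟨hsub _ _ h2, ?_⟩
        rw [if_pos h2]
        exact hT.2.2.2 _ _ h2
    · intro T hT
      rw [mem_filter, mem_tabs] at hT
      obtain ⟨hT, hs⟩ := hT
      funext i j
      by_cases h1 : (i, j) ∈ mu
      · simp only [if_pos h1]
      · simp only [if_neg h1]
        split_ifs with h2
        · have h3 := hfib T hT hs i j h2
          have h4 := hT.2.2.2 i j h2
          have h5 : ¬ T i j < n := fun h => h1 (h3.mp h)
          omega
        · exact (hT.2.2.1 i j h2).symm
    · intro T hT
      rw [mem_tabs] at hT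
      funext i j
      by_cases h1 : (i, j) ∈ mu
      · simp only [if_pos h1]
      · simp only [if_neg h1]
        exact (hT.2.2.1 i j h1).symm
    · intro T hT
      rw [mem_filter, mem_tabs] at hT
      obtain ⟨hT, hs⟩ := hT
      have hsubc : mu.cells ⊆ nu.cells := by
        rintro ⟨i, j⟩ hij
        exact (YoungDiagram.mem_cells _).mpr (hsub i j ((YoungDiagram.mem_cells _).mp hij))
      rw [← prod_sdiff hsubc]
      congr 1
      · have hc : (nu.cells \ mu.cells).card = ∑ i, l i - ∑ i, κ i := by
          rw [card_sdiff_of_subset hsubc, card_cells h, card_cells hparts]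
          simp only [hrow, hl]
        rw [← hc, ← prod_const]
        refine prod_congr rfl ?_
        rintro ⟨i, j⟩ hij
        rw [mem_sdiff, YoungDiagram.mem_cells, YoungDiagram.mem_cells] at hij
        have h3 := hfib T hT hs i j hij.1
        have h4 := hT.2.2.2 i j hij.1
        have h5 : ¬ T i j < n := fun h => hij.2 (h3.mp h)
        rw [show T i j = n by omega]
      · refine prod_congr rfl ?_
        rintro ⟨i, j⟩ hij
        simp only [if_pos ((YoungDiagram.mem_cells _).mp hij)]

theorem schur_eq_wRows {m n : ℕ} {nu : YoungDiagram} (h : numParts nu ≤ m) (x : ℕ → F) :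
    schur (fun i : Fin n => x i) nu = wRows 0 n (fun i : Fin m => nu.rowLen i) x := by
  rw [schur_eq_sum_tabs, sum_tabs_eq_wRows n nu h]

end Schur

/-! ### Schur positivity -/

section Positivity

/-- Each highest-weight list contributes `X ^ energy` at the partition given by its weight; distinct
lists may have the same weight, and the finitely supported sum collects them. -/
theorem exists_schur_expansion (n : ℕ) (mu : YoungDiagram) :
    ∃ P : YoungDiagram →₀ Polynomial ℕ, ∀ (F : Type u) [Field F] (q : F),
      (∀ k : ℕ, 1 ≤ k → q ^ k ≠ 1) → ∀ x : Fin n → F,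
        qWhittaker q x mu = P.sum fun nu p => Polynomial.aeval q p * schur x nu := by
  by_cases hmu : numParts mu ≤ n
  swap
  · exact ⟨0, fun F _ q _ x => by rw [qWhittaker, if_neg hmu, Finsupp.sum_zero_index]⟩
  obtain ⟨hs, h⟩ := exists_columns_wRows (fun i : Fin n => mu.rowLen i)
    fun i j hij => mu.rowLen_anti _ _ hij
  refine ⟨∑ b ∈ highest n hs, Finsupp.single (diagramOf fun i : Fin n => wt b i)
    (Polynomial.X ^ energy n b), fun F _ q hq x => ?_⟩
  obtain ⟨y, rfl⟩ : ∃ y : ℕ → F, x = fun i : Fin n => y i :=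
    ⟨fun i => if hi : i < n then x ⟨i, hi⟩ else 0, by funext i; simp⟩
  rw [qWhittaker, if_pos hmu, whittakerSeq_eq_wRows hq, h F q y,
    ← Finsupp.sum_finsetSum_index (by simp) (by intros; rw [map_add, add_mul])]
  refine sum_congr rfl fun b hb => ?_
  rw [Finsupp.sum_single_index (by simp), schur_eq_wRows (numParts_diagramOf _) y, map_pow,
    Polynomial.aeval_X]
  congr 2
  funext i
  exact (rowLen_diagramOf (wt_antitone_of_mem_highest hb) i).symm

/-- The two expansions are composed with `N` equal to the number of parts, and sums and products of
polynomials over ℕ stay over ℕ. -/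
theorem exists_schur_expansion_dual (n : ℕ) (lam : YoungDiagram) :
    ∃ P : YoungDiagram →₀ Polynomial ℕ, ∀ (F : Type u) [Field F] (q : F),
      (∀ k : ℕ, 1 ≤ k → q ^ k ≠ 1) → ∀ x : Fin n → F, (∀ i, x i ≠ 0) →
        dualInhomWhittaker q x lam = P.sum fun nu p => Polynomial.aeval q p * schur x nu := by
  choose P hP using exists_schur_expansion.{u} n
  have hC : ∀ mu, ∃ p : Polynomial ℕ, ∀ (F : Type u) [Field F] (q : F),
      (∀ k : ℕ, 1 ≤ k → q ^ k ≠ 1) →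
        transCoeff q n (numParts lam) lam mu = Polynomial.aeval q p :=
    fun mu => ⟨_, fun F _ q hq => transCoeff_eq_aeval n (numParts lam) lam mu hq⟩
  choose C hC using hC
  refine ⟨∑ mu ∈ expansionSupport n (numParts lam) lam, C mu • P mu, fun F _ q hq x hx => ?_⟩
  rw [dualInhomWhittaker_eq_sum hq x hx lam le_rfl,
    ← Finsupp.sum_finsetSum_index (by simp) (by intros; rw [map_add, add_mul])]
  refine sum_congr rfl fun mu _ => ?_
  rw [hC mu F q hq, hP mu F q hq, Finsupp.sum_smul_index (by simp), Finsupp.mul_sum]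
  simp only [map_mul, mul_assoc]

end Positivity

end LatticeWhittaker

end

/-! ### The three claims together -/

theorem mainTheorem4 (n : ℕ) (hn : 0 < n) (lam : YoungDiagram)
    (N : ℕ) (hN : LatticeWhittaker.numParts lam ≤ N) :
    -- the expansion into `q`-Whittaker polynomials, a sum with finitely many non-zero terms
    (∀ (F : Type u) [Field F] (q : F), (∀ k : ℕ, 1 ≤ k → q ^ k ≠ 1) →
      ∀ x : Fin n → F, (∀ i, x i ≠ 0) →
        (Function.support fun mu : YoungDiagram =>
          LatticeWhittaker.transCoeff q n N lam mu * LatticeWhittaker.qWhittaker q x mu).Finite ∧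
        LatticeWhittaker.dualInhomWhittaker q x lam =
          ∑ᶠ mu : YoungDiagram,
            LatticeWhittaker.transCoeff q n N lam mu * LatticeWhittaker.qWhittaker q x mu) ∧
    -- the coefficients lie in `ℕ[q]`
    (∀ mu : YoungDiagram, ∃ P : Polynomial ℕ,
      ∀ (F : Type u) [Field F] (q : F), (∀ k : ℕ, 1 ≤ k → q ^ k ≠ 1) →
        LatticeWhittaker.transCoeff q n N lam mu = Polynomial.aeval q P) ∧
    -- Schur positivity
    (∃ K : YoungDiagram →₀ Polynomial ℕ,
      ∀ (F : Type u) [Field F] (q : F), (∀ k : ℕ, 1 ≤ k → q ^ k ≠ 1) →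
        ∀ x : Fin n → F, (∀ i, x i ≠ 0) →
          LatticeWhittaker.dualInhomWhittaker q x lam =
            K.sum fun nu P => Polynomial.aeval q P * LatticeWhittaker.schur x nu) := by
  refine ⟨fun F _ q hq x hx => ⟨?_, ?_⟩, fun mu => ?_, ?_⟩
  · exact (Finset.finite_toSet _).subset
      (LatticeWhittaker.support_subset_expansionSupport hq x lam N)
  · rw [finsum_eq_sum_of_support_subset _
      (LatticeWhittaker.support_subset_expansionSupport hq x lam N)]
    exact LatticeWhittaker.dualInhomWhittaker_eq_sum hq x hx lam hN
  · exact ⟨_, fun F _ q hq => LatticeWhittaker.transCoeff_eq_aeval n N lam mu hq⟩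
  · exact LatticeWhittaker.exists_schur_expansion_dual n lam
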